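/- Let $2\le k\le n-1$ and $c_1,c_2\in\mathbb R$. For $c\in\mathbb R$, let $\mathbb Q_c^m$ be the space form of curvature $c$, regarded as $\mathbb R^m$ if $c=0$, as the sphere $\{\langle x,x\rangle=1/c\}\subset\mathbb R^{m+1}$ if $c>0$, and as the upper sheet of the hyperboloid $\{\langle x,x\rangle=1/c\}$ in Lorentz space $\mathbb L^{m+1}$ if $c<0$. All maps and manifolds are smooth; a hypersurface is an immersion of a manifold of dimension one less than that of the ambient space, and carries the induced metric. Let $f\colon M^n\to\mathbb Q_{c_1}^k\times\mathbb Q_{c_2}^{n-k+1}$ be a hypersurface with local unit normal field $N$ and shape operator $A$, and let $\pi_2$ be the projection of tangent vectors onto the second factor. Define a vector field $\xi$, a function $t$ and an endomorphism field $R$ of $TM$ by $\pi_2N=f_*\xi+tN$ and $\pi_2f_*X=f_*RX+\langle X,\xi\rangle N$. The hypersurface $f$ is in class $\mathcal A$ if $AR=RA$ everywhere. It splits on an open subset $U\subset M^n$ if, up to a diffeomorphism, $U$ is a product and $f|_U$ is either $f_1\times i_2$ or $i_1\times f_2$, where $f_1$ (resp. $f_2$) is a hypersurface of $\mathbb Q_{c_1}^k$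 (resp. $\mathbb Q_{c_2}^{n-k+1}$) and $i_2$ (resp. $i_1$) is the inclusion of an open subset of $\mathbb Q_{c_2}^{n-k+1}$ (resp. $\mathbb Q_{c_1}^k$). Let $C_c(s)=\cos(\sqrt c\,s),\,1,\,\cosh(\sqrt{-c}\,s)$ and $S_c(s)=\sin(\sqrt c\,s)/\sqrt c,\,s,\,\sinh(\sqrt{-c}\,s)/\sqrt{-c}$ for $c>0$, $c=0$, $c<0$, respectively. Given hypersurfaces $h\colon M_1^{k-1}\to\mathbb Q_{c_1}^k$ and $g\colon M_2^{n-k}\to\mathbb Q_{c_2}^{n-k+1}$ with unit normal fields $N^h,N^g$, let $h_s=C_{c_1}(s)h+S_{c_1}(s)N^h$ and $g_s=C_{c_2}(s)g+S_{c_2}(s)N^g$ be their parallel families. Let $\delta>0$ and let $a,b\colon(-\delta,\delta)\to\mathbb R$ be smooth functions with $a(0)=b(0)=0$, $0<a',b'<1$ and $(a')^2+(b')^2=1$. Put $$F(s,x_1,x_2)=h_{a(s)}(x_1)+g_{b(s)}(x_2),\qquad (s,x_1,x_2)\in(-\delta,\delta)\times M_1\times M_2,$$ the sum being that of the orthogonal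 direct sum of the two flat ambient spaces. (i) For all such data, the set of regular points of $F$ (the points where its differential is injective) is open, and the restriction of $F$ to it is a hypersurface of $\mathbb Q_{c_1}^k\times\mathbb Q_{c_2}^{n-k+1}$ in class $\mathcal A$. (ii) Conversely, let $f\colon M^n\to\mathbb Q_{c_1}^k\times\mathbb Q_{c_2}^{n-k+1}$ be a hypersurface in class $\mathcal A$ that does not split on any nonempty open subset. Then there is an open dense subset $W\subset M^n$ such that every point of $W$ has an open neighbourhood $U$ for which there are data $h,N^h,g,N^g,\delta,a,b$ as above and a diffeomorphism $\Phi\colon(-\delta,\delta)\times M_1\times M_2\to U$ with $f\circ\Phi=F$. -/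

import Mathlib

open scoped Manifold ContDiff
open Set

universe u v w

noncomputable section

/-! ### Space forms in their standard flat ambient spaces -/

/-- Dimension of the flat space containing the `m`-dimensional space form of curvature `c`:
`m` if `c = 0` and `m + 1` otherwise. -/
def ambientDim (c : ℝ) (m : ℕ) : ℕ := if c = 0 then m else m + 1

/-- The vector space underlying the flat space that contains the space form. Only its linear and
smooth structures are used; the (Euclidean or Lorentzian) metric is `flatForm`. -/
abbrev FlatSpace (c : ℝ) (m : ℕ) : Type := EuclideanSpace ℝ (Fin (ambientDim c m))

/-- The flat metric: Euclidean if `0 ≤ c`, Lorentzian (coordinate `0` is timelike) if `c < 0`. -/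
def flatForm (c : ℝ) {m : ℕ} (v w : FlatSpace c m) : ℝ :=
  ∑ i, (if c < 0 ∧ i.val = 0 then -1 else 1) * (v i * w i)

/-- The complete simply connected space form of dimension `m ≥ 2` and curvature `c`:
the sphere `⟨x, x⟩ = 1 / c` if `c > 0`, the whole Euclidean space if `c = 0`,
the upper sheet of the hyperboloid `⟨x, x⟩ = 1 / c` if `c < 0`. -/
def spaceForm (c : ℝ) (m : ℕ) : Set (FlatSpace c m) :=
  {x | c ≠ 0 → flatForm c x x = 1 / c ∧ (c < 0 → ∀ i : Fin (ambientDim c m), i.val = 0 → 0 < x i)}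

/-- The tangent space of the space form at a point `x` of it, as a set of vectors of the
ambient flat space. -/
def spaceFormTangent (c : ℝ) {m : ℕ} (x : FlatSpace c m) : Set (FlatSpace c m) :=
  {v | c ≠ 0 → flatForm c x v = 0}

/-- The flat metric of the product of the two ambient flat spaces. -/
def prodForm (c₁ c₂ : ℝ) {k l : ℕ} (v w : FlatSpace c₁ k × FlatSpace c₂ l) : ℝ :=
  flatForm c₁ v.1 w.1 + flatForm c₂ v.2 w.2

/-- The projection of tangent vectors of the product onto the second factor. -/
def proj₂ {c₁ c₂ : ℝ} {k l : ℕ} (v : FlatSpace c₁ k × FlatSpace c₂ l) :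
    FlatSpace c₁ k × FlatSpace c₂ l := (0, v.2)

/-! ### Immersions and unit normals

`M` is a smooth manifold and `U` an open subset of it; maps are defined on `M`
but only their restrictions to `U` matter. -/

section General

variable {E : Type*} [NormedAddCommGroup E] [NormedSpace ℝ E] {H : Type*} [TopologicalSpace H]
  (I : ModelWithCorners ℝ E H) {M : Type*} [TopologicalSpace M] [ChartedSpace H M]
  {V : Type*} [NormedAddCommGroup V] [NormedSpace ℝ V]

/-- The differential `f_*` at `x` of a map into a vector space `V`, with values in `V`. -/
abbrev pushforward (f : M → V) (x : M) : TangentSpace I x →L[ℝ] V := mfderiv I 𝓘(ℝ, V) f x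

/-- `f` restricts to a smooth immersion of `U` into the vector space `V` with image in `Q`. -/
structure IsImmersionOn (Q : Set V) (U : Set M) (f : M → V) : Prop where
  smooth : ContMDiffOn I 𝓘(ℝ, V) ∞ f U
  mapsTo : MapsTo f U Q
  immersion : ∀ x ∈ U, Function.Injective (pushforward I f x)

/-- `N` is on `U` a smooth unit normal vector field along `f`, where the ambient manifold has
tangent space `T y` at `y` and metric `B`. -/
structure IsUnitNormalOn (B : V → V → ℝ) (T : V → Set V) (U : Set M) (f N : M → V) : Prop where
  smooth : ContMDiffOn I 𝓘(ℝ, V) ∞ N U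
  tangent : ∀ x ∈ U, N x ∈ T (f x)
  unit : ∀ x ∈ U, B (N x) (N x) = 1
  normal : ∀ x ∈ U, ∀ X : TangentSpace I x, B (N x) (pushforward I f x X) = 0

/-- `A` is the shape operator at `x` of `f` with respect to the unit normal field `N`:
`f_* (A X)` is minus the component tangent to `f` of the derivative of `N` along `X`. -/
def IsShapeOperatorAt (B : V → V → ℝ) (f N : M → V) (x : M)
    (A : TangentSpace I x →ₗ[ℝ] TangentSpace I x) : Prop :=
  ∀ X Y : TangentSpace I x,
    B (pushforward I f x (A X)) (pushforward I f x Y) =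
      - B (pushforward I N x X) (pushforward I f x Y)

/-- The tensor `R` at `x` of a hypersurface `f` of the product of two space forms. With
`π₂ N = f_* ξ + t N`, it is defined by `π₂ f_* X = f_* (R X) + ⟨X, ξ⟩ N`, where `⟨ , ⟩` is the
metric induced by `f`. -/
def IsProductTensorAt (c₁ c₂ : ℝ) {k l : ℕ} (f N : M → FlatSpace c₁ k × FlatSpace c₂ l) (x : M)
    (R : TangentSpace I x →ₗ[ℝ] TangentSpace I x) : Prop :=
  ∃ (ξ : TangentSpace I x) (t : ℝ),
    proj₂ (N x) = pushforward I f x ξ + t • N x ∧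
    ∀ X : TangentSpace I x,
      proj₂ (pushforward I f x X) =
        pushforward I f x (R X) +
          prodForm c₁ c₂ (pushforward I f x X)
            (pushforward I f x ξ) • N x

/-- `f` restricted to the open set `U` is in class `𝒜`: its shape operator commutes with `R`.
Near a point, the unit normal field is unique up to sign, and it determines `A` and `R`; a change
of its sign changes `A` to `-A` and leaves `R` unchanged. -/
def InClassAOn (c₁ c₂ : ℝ) {k l : ℕ} (U : Set M) (f : M → FlatSpace c₁ k × FlatSpace c₂ l) : Prop :=
  ∀ x ∈ U, ∃ (W : Set M) (N : M → FlatSpace c₁ k × FlatSpace c₂ l)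
      (A R : TangentSpace I x →ₗ[ℝ] TangentSpace I x),
    IsOpen W ∧ x ∈ W ∧ W ⊆ U ∧
    IsUnitNormalOn I (prodForm c₁ c₂) (fun y => spaceFormTangent c₁ y.1 ×ˢ spaceFormTangent c₂ y.2)
      W f N ∧
    IsShapeOperatorAt I (prodForm c₁ c₂) f N x A ∧
    IsProductTensorAt I c₁ c₂ f N x R ∧
    A ∘ₗ R = R ∘ₗ A

/-- `h` restricts on `U` to an immersion into the space form (a hypersurface when the
dimension of `M` is one less), with unit normal vector field `N`. -/
def IsHypersurfaceWithNormalOn (c : ℝ) {m : ℕ} (U : Set M) (h N : M → FlatSpace c m) : Prop :=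
  IsImmersionOn I (spaceForm c m) U h ∧
    IsUnitNormalOn I (flatForm c) (spaceFormTangent c) U h N

end General

/-! ### Splitting -/

/-- The hypersurface `f` splits on the open set `U`: up to a diffeomorphism (which is then an
isometry for the induced metrics), `f` restricted to `U` is either `f₁ × i₂` or `i₁ × f₂`, where
`fⱼ` is a hypersurface of one factor and `iⱼ` is the inclusion of an open subset of the other one.
The domains of `f₁`, `f₂` and the open subsets are taken to be coordinate domains, so open subsets
of some `ℝ^d` (the inclusion `iⱼ` is then an injective immersion between manifolds of the same
dimension); as this is used only to say that `f` splits on no nonempty open set, it is no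
restriction. -/
def SplitsOn (n : ℕ) (c₁ c₂ : ℝ) {k l : ℕ} {M : Type*} [TopologicalSpace M]
    [ChartedSpace (EuclideanSpace ℝ (Fin n)) M]
    (U : Set M) (f : M → FlatSpace c₁ k × FlatSpace c₂ l) : Prop :=
  (∃ (O₁ : Set (EuclideanSpace ℝ (Fin (k - 1)))) (O₂ : Set (EuclideanSpace ℝ (Fin l)))
      (f₁ : EuclideanSpace ℝ (Fin (k - 1)) → FlatSpace c₁ k)
      (i₂ : EuclideanSpace ℝ (Fin l) → FlatSpace c₂ l)
      (Φ : PartialDiffeomorph ((𝓡 (k - 1)).prod (𝓡 l)) (𝓡 n)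
        (EuclideanSpace ℝ (Fin (k - 1)) × EuclideanSpace ℝ (Fin l)) M ∞),
    IsOpen O₁ ∧ IsOpen O₂ ∧
    IsImmersionOn (𝓡 (k - 1)) (spaceForm c₁ k) O₁ f₁ ∧
    IsImmersionOn (𝓡 l) (spaceForm c₂ l) O₂ i₂ ∧ InjOn i₂ O₂ ∧
    Φ.source = O₁ ×ˢ O₂ ∧ Φ.target = U ∧
    ∀ z ∈ O₁ ×ˢ O₂, f (Φ z) = (f₁ z.1, i₂ z.2)) ∨
  (∃ (O₁ : Set (EuclideanSpace ℝ (Fin k))) (O₂ : Set (EuclideanSpace ℝ (Fin (l - 1))))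
      (i₁ : EuclideanSpace ℝ (Fin k) → FlatSpace c₁ k)
      (f₂ : EuclideanSpace ℝ (Fin (l - 1)) → FlatSpace c₂ l)
      (Φ : PartialDiffeomorph ((𝓡 k).prod (𝓡 (l - 1))) (𝓡 n)
        (EuclideanSpace ℝ (Fin k) × EuclideanSpace ℝ (Fin (l - 1))) M ∞),
    IsOpen O₁ ∧ IsOpen O₂ ∧
    IsImmersionOn (𝓡 k) (spaceForm c₁ k) O₁ i₁ ∧ InjOn i₁ O₁ ∧
    IsImmersionOn (𝓡 (l - 1)) (spaceForm c₂ l) O₂ f₂ ∧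
    Φ.source = O₁ ×ˢ O₂ ∧ Φ.target = U ∧
    ∀ z ∈ O₁ ×ˢ O₂, f (Φ z) = (i₁ z.1, f₂ z.2))

/-! ### Parallel families and the construction -/

/-- `C_ε (s / r)`, where `c = ε / r²`. -/
def cosC (c s : ℝ) : ℝ :=
  if 0 < c then Real.cos (√c * s) else if c < 0 then Real.cosh (√(-c) * s) else 1

/-- `r S_ε (s / r)`, where `c = ε / r²`. -/
def sinC (c s : ℝ) : ℝ :=
  if 0 < c then Real.sin (√c * s) / √c else if c < 0 then Real.sinh (√(-c) * s) / √(-c) else s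

/-- The parallel map `h_s` at distance `s` of `h` with unit normal field `N`. -/
def parallelMap (c : ℝ) {m : ℕ} {M : Type*} (h N : M → FlatSpace c m) (s : ℝ) (x : M) :
    FlatSpace c m :=
  cosC c s • h x + sinC c s • N x

/-- The map `(s, x₁, x₂) ↦ h_{a(s)}(x₁) + g_{b(s)}(x₂)`, the sum being that of the orthogonal
direct sum of the two flat spaces. -/
def cylinderMap (c₁ c₂ : ℝ) {k l : ℕ} {M₁ M₂ : Type*} (h Nh : M₁ → FlatSpace c₁ k)
    (g Ng : M₂ → FlatSpace c₂ l) (a b : ℝ → ℝ) (z : ℝ × (M₁ × M₂)) :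
    FlatSpace c₁ k × FlatSpace c₂ l :=
  (parallelMap c₁ h Nh (a z.1) z.2.1, parallelMap c₂ g Ng (b z.1) z.2.2)

/-- The conditions on the functions `a`, `b` on the interval `(-δ, δ)`. -/
structure IsAdmissiblePair (δ : ℝ) (a b : ℝ → ℝ) : Prop where
  pos : 0 < δ
  smooth_a : ContDiffOn ℝ ∞ a (Ioo (-δ) δ)
  smooth_b : ContDiffOn ℝ ∞ b (Ioo (-δ) δ)
  a_zero : a 0 = 0
  b_zero : b 0 = 0
  deriv_a : ∀ s ∈ Ioo (-δ) δ, 0 < deriv a s ∧ deriv a s < 1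
  deriv_b : ∀ s ∈ Ioo (-δ) δ, 0 < deriv b s ∧ deriv b s < 1
  sq_add_sq : ∀ s ∈ Ioo (-δ) δ, deriv a s ^ 2 + deriv b s ^ 2 = 1

/-- The set of regular points of a map `f` defined on `(-δ, δ) × M₁ × M₂`. -/
def regularPoints {d₁ d₂ : ℕ} {M₁ M₂ : Type*}
    [TopologicalSpace M₁] [ChartedSpace (EuclideanSpace ℝ (Fin d₁)) M₁]
    [TopologicalSpace M₂] [ChartedSpace (EuclideanSpace ℝ (Fin d₂)) M₂]
    {V : Type*} [NormedAddCommGroup V] [NormedSpace ℝ V]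
    (δ : ℝ) (f : ℝ × (M₁ × M₂) → V) : Set (ℝ × (M₁ × M₂)) :=
  {z | z.1 ∈ Ioo (-δ) δ ∧
    Function.Injective (pushforward (𝓘(ℝ, ℝ).prod ((𝓡 d₁).prod (𝓡 d₂))) f z)}

end

/-! Write N = (N₁, N₂), f = (f₁, f₂), and let β = ⟨N₂, df₂⟩. This is the 1-form X ↦ ⟨X, ξ⟩, and
normality of N gives ⟨N₁, df₁⟩ = -β. Expanding ⟨ARX, Y⟩ and ⟨RAX, Y⟩ shows that A and R commute
exactly when ⟨dN₂ X, df₂ Y⟩ is symmetric in X and Y (`IsTangentHyperplane.commute_iff`). Second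
derivatives of f₂ being symmetric, this holds throughout an open set exactly when dβ = 0 there
(`pullForm_closed_iff`). Class 𝒜 is thus closedness of β, and both directions use it in this form.

(i) Let V₁, V₂ be the velocities of the normal geodesics of h and g. By the first variation formula
(`IsUnitFieldAlong.flatForm_geodesicVelocity`), (b' V₁, -a' V₂) is a unit normal of F, and its form
β = -a'(s) b'(s) ds is closed.

(ii) Let t = |N₂|², a function with values in [0, 1]. On an open set where t takes only the values 0
and 1, N is locally tangent to one fixed factor, ξ = 0, every tangent space is ker df₁ + ker df₂,
and f splits (`exists_splitsOn`). Hence 0 < t < 1 on a dense set, and it is enough to treat a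
neighbourhood of such a point.

There ker β = ker df₁ + ker df₂. Symmetry forces dN₂ = 0 on ker df₂ and dN₁ = 0 on ker df₁; as t =
|N₂|² = 1 - |N₁|², dt vanishes on ker β, so dt is a multiple of β
(`IsHypersurfaceOn.exists_fderiv_angle_eq_smul`). Therefore ψ(t) β is closed for every function ψ,
and on a ball there are primitives with dσ₁ = β / √(1 - t), dσ₂ = β / √t, ds = β / √(t (1 - t)).
With the unit fields n₁ = -N₁ / √(1 - t) and n₂ = N₂ / √t one has dσᵢ = ⟨nᵢ, dfᵢ⟩: each σᵢ behaves
like the pull-back by fᵢ of a function with gradient of length one (`IsGradientFactor`). The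
gradient lines of such a function are geodesics and its levels are parallel hypersurfaces. Following
the geodesic of nᵢ back for the time σᵢ leads to a foot point Pᵢ with unit normal Qᵢ, and fᵢ is the
point at distance σᵢ from Pᵢ in the direction Qᵢ. Both Pᵢ and Qᵢ are constant along ξ and along ker
dfᵢ, while dσ₁ = √t ds and dσ₂ = √(1 - t) ds. In coordinates built from (s, P₁, P₂), then, σᵢ
depends on s only and Pᵢ, Qᵢ on the i-th block only (`exists_cylinder_coordinates`). This is the
required form, with a' = √t and b' = √(1 - t). -/

/-! ### The flat metric as a continuous bilinear map -/

/-- The flat metric as a continuous bilinear map. -/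
noncomputable def flatBilin (c : ℝ) (m : ℕ) : FlatSpace c m →L[ℝ] FlatSpace c m →L[ℝ] ℝ :=
  (LinearMap.mk₂ ℝ (flatForm c (m := m))
    (fun v₁ v₂ w => by
      simp only [flatForm, ← Finset.sum_add_distrib, PiLp.add_apply]; congr! 1; ring)
    (fun r v w => by
      simp only [flatForm, smul_eq_mul, Finset.mul_sum, PiLp.smul_apply]; congr! 1; ring)
    (fun v w₁ w₂ => by
      simp only [flatForm, ← Finset.sum_add_distrib, PiLp.add_apply]; congr! 1; ring)
    (fun r v w => by
      simp only [flatForm, smul_eq_mul, Finset.mul_sum, PiLp.smul_apply]; congr! 1; ring)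
    ).toContinuousBilinearMap

section FlatForm

variable {c : ℝ} {m : ℕ}

theorem flatBilin_apply (v w : FlatSpace c m) : flatBilin c m v w = flatForm c v w := rfl

theorem flatForm_comm (v w : FlatSpace c m) : flatForm c v w = flatForm c w v := by
  simp only [flatForm, mul_comm (v _)]

theorem flatForm_add_left (u v w : FlatSpace c m) :
    flatForm c (u + v) w = flatForm c u w + flatForm c v w := by
  simp [← flatBilin_apply]

theorem flatForm_add_right (u v w : FlatSpace c m) :
    flatForm c u (v + w) = flatForm c u v + flatForm c u w := by
  simp [← flatBilin_apply]

theorem flatForm_sub_left (u v w : FlatSpace c m) :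
    flatForm c (u - v) w = flatForm c u w - flatForm c v w := by
  simp [← flatBilin_apply]

theorem flatForm_sub_right (u v w : FlatSpace c m) :
    flatForm c u (v - w) = flatForm c u v - flatForm c u w := by
  simp [← flatBilin_apply]

theorem flatForm_smul_left (r : ℝ) (v w : FlatSpace c m) :
    flatForm c (r • v) w = r * flatForm c v w := by
  simp [← flatBilin_apply]

theorem flatForm_smul_right (r : ℝ) (v w : FlatSpace c m) :
    flatForm c v (r • w) = r * flatForm c v w := by
  simp [← flatBilin_apply]

theorem flatForm_zero_left (w : FlatSpace c m) : flatForm c 0 w = 0 := by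
  simp [← flatBilin_apply]

theorem flatForm_zero_right (w : FlatSpace c m) : flatForm c w 0 = 0 := by
  simp [← flatBilin_apply]

theorem flatForm_of_nonneg (hc : 0 ≤ c) (v w : FlatSpace c m) :
    flatForm c v w = ∑ i, v i * w i := by
  simp [flatForm, not_lt.2 hc]

theorem exists_timelike_index (hc : c < 0) (m : ℕ) : ∃ i : Fin (ambientDim c m), i.val = 0 :=
  ⟨⟨0, by simp [ambientDim, hc.ne]⟩, rfl⟩

theorem flatForm_of_neg (hc : c < 0) {i₀ : Fin (ambientDim c m)} (hi : i₀.val = 0)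
    (v w : FlatSpace c m) :
    flatForm c v w = -(v i₀ * w i₀) + ∑ i ∈ Finset.univ.erase i₀, v i * w i := by
  rw [flatForm, ← Finset.add_sum_erase _ _ (Finset.mem_univ i₀)]
  congr 1
  · simp [hc, hi]
  · refine Finset.sum_congr rfl fun i hi' => ?_
    have : i.val ≠ 0 := fun h => Finset.ne_of_mem_erase hi' (Fin.ext (h.trans hi.symm))
    simp [this]

/-- The flat metric is nonnegative on the tangent spaces of the space form. -/
theorem flatForm_self_nonneg {x v : FlatSpace c m} (hx : x ∈ spaceForm c m)
    (hv : v ∈ spaceFormTangent c x) : 0 ≤ flatForm c v v := by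
  rcases le_or_gt 0 c with hc | hc
  · rw [flatForm_of_nonneg hc]
    exact Finset.sum_nonneg fun i _ => mul_self_nonneg _
  · obtain ⟨i₀, hi⟩ := exists_timelike_index hc m
    obtain ⟨h1, h2⟩ := hx hc.ne
    have h3 := hv hc.ne
    have hpos := h2 hc i₀ hi
    rw [flatForm_of_neg hc hi] at h1 h3 ⊢
    -- Cauchy–Schwarz in the spacelike coordinates. Tangency turns the left side into (x₀ v₀)², and
    -- ⟨x, x⟩ < 0 bounds the spacelike part of x by x₀², so v₀² is at most the spacelike part of v.
    have cs := Finset.sum_mul_sq_le_sq_mul_sq (Finset.univ.erase i₀) x v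
    have hc' : 1 / c < 0 := one_div_neg.2 hc
    simp only [← pow_two] at h1 h3 ⊢
    set S := ∑ i ∈ Finset.univ.erase i₀, x i ^ 2
    set S' := ∑ i ∈ Finset.univ.erase i₀, v i ^ 2
    have hS' : 0 ≤ S' := Finset.sum_nonneg fun i _ => sq_nonneg _
    have e : ∑ i ∈ Finset.univ.erase i₀, x i * v i = x i₀ * v i₀ := by linarith
    rw [e] at cs
    have : x i₀ ^ 2 * v i₀ ^ 2 ≤ x i₀ ^ 2 * S' := by nlinarith
    have := le_of_mul_le_mul_left this (by positivity)
    linarith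

/-- The flat metric is definite on the tangent spaces of the space form. -/
theorem eq_zero_of_flatForm_self {x v : FlatSpace c m} (hx : x ∈ spaceForm c m)
    (hv : v ∈ spaceFormTangent c x) (h : flatForm c v v = 0) : v = 0 := by
  rcases le_or_gt 0 c with hc | hc
  · rw [flatForm_of_nonneg hc,
      Finset.sum_eq_zero_iff_of_nonneg fun i _ => mul_self_nonneg _] at h
    ext i
    simpa using h i (Finset.mem_univ i)
  · obtain ⟨i₀, hi⟩ := exists_timelike_index hc m
    obtain ⟨h1, h2⟩ := hx hc.ne
    have h3 := hv hc.ne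
    have hpos := h2 hc i₀ hi
    rw [flatForm_of_neg hc hi] at h1 h3 h
    have cs := Finset.sum_mul_sq_le_sq_mul_sq (Finset.univ.erase i₀) x v
    have hc' : 1 / c < 0 := one_div_neg.2 hc
    simp only [← pow_two] at h1 h3 h
    set S := ∑ i ∈ Finset.univ.erase i₀, x i ^ 2
    set S' := ∑ i ∈ Finset.univ.erase i₀, v i ^ 2 with hS'
    have hS'0 : 0 ≤ S' := Finset.sum_nonneg fun i _ => sq_nonneg _
    have e : ∑ i ∈ Finset.univ.erase i₀, x i * v i = x i₀ * v i₀ := by linarith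
    rw [e] at cs
    have hz : S' = 0 := by nlinarith
    have hz0 : v i₀ = 0 := by
      have : v i₀ ^ 2 = 0 := by linarith
      simpa using this
    rw [hS', Finset.sum_eq_zero_iff_of_nonneg fun i _ => sq_nonneg _] at hz
    ext i
    by_cases hii : i = i₀
    · simpa [hii] using hz0
    · simpa using hz i (Finset.mem_erase.2 ⟨hii, Finset.mem_univ i⟩)

/-- Cauchy–Schwarz with the values ⟨x, x⟩ = 1/c and ⟨v, v⟩ = 1 inserted. The strict bound keeps cosh
· x₀ + sinh · v₀ / √(-c) positive, so that geodesics stay on the upper sheet. -/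
theorem sq_timelike_lt (hc : c < 0) {x v : FlatSpace c m} (hx : x ∈ spaceForm c m)
    (hv : v ∈ spaceFormTangent c x) (hu : flatForm c v v = 1) {i₀ : Fin (ambientDim c m)}
    (hi : i₀.val = 0) : v i₀ ^ 2 < -c * x i₀ ^ 2 := by
  obtain ⟨h1, -⟩ := hx hc.ne
  have h3 := hv hc.ne
  rw [flatForm_of_neg hc hi] at h1 h3 hu
  have cs := Finset.sum_mul_sq_le_sq_mul_sq (Finset.univ.erase i₀) x v
  simp only [← pow_two] at h1 h3 hu
  have e : ∑ i ∈ Finset.univ.erase i₀, x i * v i = x i₀ * v i₀ := by linarith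
  have e1 : ∑ i ∈ Finset.univ.erase i₀, x i ^ 2 = 1 / c + x i₀ ^ 2 := by linarith
  have e2 : ∑ i ∈ Finset.univ.erase i₀, v i ^ 2 = 1 + v i₀ ^ 2 := by linarith
  rw [e, e1, e2] at cs
  have hcc : c * (1 / c) = 1 := mul_one_div_cancel hc.ne
  nlinarith

end FlatForm

/-! ### The functions `cosC` and `sinC` -/

theorem cosC_zero (c : ℝ) : cosC c 0 = 1 := by simp [cosC]

theorem sinC_zero (c : ℝ) : sinC c 0 = 0 := by simp [sinC]

theorem cosC_neg (c s : ℝ) : cosC c (-s) = cosC c s := by simp [cosC]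

theorem sinC_neg (c s : ℝ) : sinC c (-s) = -sinC c s := by
  simp only [sinC, mul_neg, Real.sin_neg, Real.sinh_neg]
  split_ifs <;> ring

theorem cosC_sq_add (c s : ℝ) : cosC c s ^ 2 + c * sinC c s ^ 2 = 1 := by
  rcases lt_trichotomy c 0 with hc | rfl | hc
  · have h := Real.sq_sqrt (neg_nonneg.2 hc.le)
    have h0 : √(-c) ≠ 0 := (Real.sqrt_pos.2 (neg_pos.2 hc)).ne'
    simp only [cosC, sinC, hc, not_lt.2 hc.le, if_true, if_false, div_pow, h]
    have := Real.cosh_sq (√(-c) * s)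
    field_simp [hc.ne]
    linarith
  · simp [cosC]
  · have h := Real.sq_sqrt hc.le
    simp only [cosC, sinC, hc, if_true, div_pow, h]
    have := Real.sin_sq_add_cos_sq (√c * s)
    field_simp [hc.ne']
    linarith

theorem hasDerivAt_cosC (c s : ℝ) : HasDerivAt (cosC c) (-c * sinC c s) s := by
  have hl (r : ℝ) : HasDerivAt (fun s : ℝ => r * s) r s := by
    simpa using (hasDerivAt_id s).const_mul r
  rcases lt_trichotomy c 0 with hc | rfl | hc
  · have h := Real.mul_self_sqrt (neg_nonneg.2 hc.le)
    have h0 : √(-c) ≠ 0 := (Real.sqrt_pos.2 (neg_pos.2 hc)).ne'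
    convert! (hl √(-c)).cosh using 1
    · funext s; simp [cosC, hc, not_lt.2 hc.le]
    · simp only [sinC, hc, not_lt.2 hc.le, if_true, if_false]
      field_simp
      linear_combination Real.sinh (√(-c) * s) * (-1) * h
  · convert! hasDerivAt_const s (1 : ℝ) using 1
    · funext s; simp [cosC]
    · simp
  · have h := Real.mul_self_sqrt hc.le
    have h0 : √c ≠ 0 := (Real.sqrt_pos.2 hc).ne'
    convert! (hl √c).cos using 1
    · funext s; simp [cosC, hc]
    · simp only [sinC, hc, if_true]
      field_simp
      linear_combination Real.sin (√c * s) * h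

theorem hasDerivAt_sinC (c s : ℝ) : HasDerivAt (sinC c) (cosC c s) s := by
  have hl (r : ℝ) : HasDerivAt (fun s : ℝ => r * s) r s := by
    simpa using (hasDerivAt_id s).const_mul r
  rcases lt_trichotomy c 0 with hc | rfl | hc
  · have h0 : √(-c) ≠ 0 := (Real.sqrt_pos.2 (neg_pos.2 hc)).ne'
    convert! (hl √(-c)).sinh.div_const √(-c) using 1
    · funext s; simp [sinC, hc, not_lt.2 hc.le]
    · simp [cosC, hc, not_lt.2 hc.le, h0]
  · convert! hasDerivAt_id s using 1
    · funext s; simp [sinC]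
    · simp [cosC]
  · have h0 : √c ≠ 0 := (Real.sqrt_pos.2 hc).ne'
    convert! (hl √c).sin.div_const √c using 1
    · funext s; simp [sinC, hc]
    · simp [cosC, hc, h0]

theorem contDiff_cosC (c : ℝ) : ContDiff ℝ ∞ (cosC c) := by
  unfold cosC
  split_ifs <;> fun_prop

theorem contDiff_sinC (c : ℝ) : ContDiff ℝ ∞ (sinC c) := by
  unfold sinC
  split_ifs <;> fun_prop

/-! ### Geodesics of the space form -/

section Geodesic

variable {c : ℝ} {m : ℕ} {x v : FlatSpace c m}

theorem abs_sinh_lt_cosh (r : ℝ) : |Real.sinh r| < Real.cosh r := by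
  rw [abs_lt]
  constructor
  · have := Real.exp_pos r
    rw [← Real.cosh_add_sinh] at this
    linarith
  · exact Real.sinh_lt_cosh r

/-- Unit speed geodesics of the space form stay in the space form. -/
theorem geodesic_mem (hx : x ∈ spaceForm c m) (hv : v ∈ spaceFormTangent c x)
    (hu : flatForm c v v = 1) (s : ℝ) : cosC c s • x + sinC c s • v ∈ spaceForm c m := by
  intro hc
  obtain ⟨h1, h2⟩ := hx hc
  have h3 := hv hc
  have h4 : flatForm c v x = 0 := by rw [flatForm_comm, h3]
  refine ⟨?_, fun hneg i hi => ?_⟩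
  · simp only [flatForm_add_left, flatForm_add_right, flatForm_smul_left, flatForm_smul_right,
      h1, h3, h4, hu]
    have := cosC_sq_add c s
    field_simp
    linarith
  · have hlt := sq_timelike_lt hneg (fun _ => ⟨h1, h2⟩) (fun _ => h3) hu hi
    have hpos := h2 hneg i hi
    have hr := Real.sqrt_pos.2 (neg_pos.2 hneg)
    have hr2 := Real.sq_sqrt (neg_pos.2 hneg).le
    simp only [cosC, sinC, hneg, not_lt.2 hneg.le, if_true, if_false, PiLp.add_apply,
      PiLp.smul_apply, smul_eq_mul]
    set r := √(-c)
    rw [← hr2, ← mul_pow] at hlt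
    have h5 : |v i| < r * x i := abs_lt_of_sq_lt_sq hlt (by positivity)
    have h6 := abs_sinh_lt_cosh (r * s)
    have h7 : |Real.sinh (r * s) * v i| ≤ Real.cosh (r * s) * |v i| := by
      rw [abs_mul]; gcongr
    have h8 : Real.cosh (r * s) * |v i| < Real.cosh (r * s) * (r * x i) := by
      gcongr
    have h9 := neg_abs_le (Real.sinh (r * s) * v i)
    have : 0 < (r * (Real.cosh (r * s) * x i) + Real.sinh (r * s) * v i) / r := by
      apply div_pos _ hr
      nlinarith
    convert this using 1
    field_simp

/-- The velocity of a unit speed geodesic is tangent to the space form. -/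
theorem geodesic_velocity_mem (hx : x ∈ spaceForm c m) (hv : v ∈ spaceFormTangent c x)
    (hu : flatForm c v v = 1) (s : ℝ) :
    (-c * sinC c s) • x + cosC c s • v ∈ spaceFormTangent c (cosC c s • x + sinC c s • v) := by
  intro hc
  obtain ⟨h1, h2⟩ := hx hc
  have h3 := hv hc
  have h4 : flatForm c v x = 0 := by rw [flatForm_comm, h3]
  simp only [flatForm_add_left, flatForm_add_right, flatForm_smul_left, flatForm_smul_right,
      h1, h3, h4, hu]
  field_simp
  ring

theorem geodesic_velocity_unit (hx : x ∈ spaceForm c m) (hv : v ∈ spaceFormTangent c x)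
    (hu : flatForm c v v = 1) (s : ℝ) :
    flatForm c ((-c * sinC c s) • x + cosC c s • v) ((-c * sinC c s) • x + cosC c s • v) = 1 := by
  have := cosC_sq_add c s
  simp only [flatForm_add_left, flatForm_add_right, flatForm_smul_left, flatForm_smul_right, hu]
  rcases eq_or_ne c 0 with rfl | hc
  · simpa [pow_two] using this
  · obtain ⟨h1, h2⟩ := hx hc
    have h3 := hv hc
    have h4 : flatForm c v x = 0 := by rw [flatForm_comm, h3]
    rw [h1, h3, h4]
    field_simp
    linear_combination this

end Geodesic

/-! ### Dimensions of tangent spaces -/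

/-- The tangent space of the space form as a subspace of the ambient space. -/
noncomputable def tangentSubmodule (c : ℝ) {m : ℕ} (x : FlatSpace c m) :
    Submodule ℝ (FlatSpace c m) :=
  if c = 0 then ⊤ else LinearMap.ker (flatBilin c m x).toLinearMap

section Dimension

variable {c : ℝ} {m : ℕ} {x v : FlatSpace c m}

theorem mem_tangentSubmodule : v ∈ tangentSubmodule c x ↔ v ∈ spaceFormTangent c x := by
  unfold tangentSubmodule spaceFormTangent
  split_ifs with h
  · simp [h]
  · simp only [LinearMap.mem_ker, Set.mem_ofPred_eq, h, ne_eq, not_false_eq_true, forall_const]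
    rfl

theorem finrank_tangentSubmodule (hx : x ∈ spaceForm c m) :
    Module.finrank ℝ (tangentSubmodule c x) = m := by
  by_cases h : c = 0
  · have : tangentSubmodule c x = ⊤ := by simp [tangentSubmodule, h]
    rw [this, finrank_top, finrank_euclideanSpace_fin]
    simp [ambientDim, h]
  · have hne : (flatBilin c m x).toLinearMap ≠ 0 := by
      intro h0
      have h1 := (hx h).1
      have h2 : flatForm c x x = 0 := LinearMap.congr_fun h0 x
      rw [h2] at h1
      exact one_div_ne_zero h h1.symm
    have : tangentSubmodule c x = LinearMap.ker (flatBilin c m x).toLinearMap := by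
      simp [tangentSubmodule, h]
    have h3 := Module.Dual.finrank_ker_add_one_of_ne_zero hne
    have h4 : ambientDim c m = m + 1 := by simp [ambientDim, h]
    rw [finrank_euclideanSpace_fin] at h3
    rw [this]
    omega

/-- The orthogonal complement of `v` in the tangent space. -/
noncomputable def normalComplement (c : ℝ) {m : ℕ} (x v : FlatSpace c m) :
    Submodule ℝ (FlatSpace c m) :=
  tangentSubmodule c x ⊓ LinearMap.ker (flatBilin c m v).toLinearMap

theorem mem_normalComplement {u : FlatSpace c m} :
    u ∈ normalComplement c x v ↔ u ∈ spaceFormTangent c x ∧ flatForm c v u = 0 := by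
  rw [normalComplement, Submodule.mem_inf, mem_tangentSubmodule, LinearMap.mem_ker]
  rfl

/-- The complement is proper because the metric is definite on the tangent space. The inequality
suffices: it is used only to embed the complement linearly in a Euclidean space of dimension m - 1.
-/
theorem finrank_normalComplement_lt (hx : x ∈ spaceForm c m) (hv : v ∈ spaceFormTangent c x)
    (hv0 : v ≠ 0) : Module.finrank ℝ (normalComplement c x v) < m := by
  have hlt : normalComplement c x v < tangentSubmodule c x := by
    refine lt_of_le_of_ne inf_le_left fun h => hv0 ?_
    have : v ∈ normalComplement c x v := h ▸ mem_tangentSubmodule.2 hv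
    exact eq_zero_of_flatForm_self hx hv (mem_normalComplement.1 this).2
  have h1 := Submodule.finrank_lt_finrank_of_lt hlt
  rwa [finrank_tangentSubmodule hx] at h1

/-- A subspace of dimension at most `d` is mapped injectively by some linear map to `ℝ^d`. -/
theorem exists_injOn_clm {V : Type*} [NormedAddCommGroup V] [NormedSpace ℝ V]
    [FiniteDimensional ℝ V] (S : Submodule ℝ V) {d : ℕ} (hd : Module.finrank ℝ S ≤ d) :
    ∃ p : V →L[ℝ] EuclideanSpace ℝ (Fin d), ∀ v ∈ S, p v = 0 → v = 0 := by
  obtain ⟨e, he⟩ : ∃ e : S →ₗ[ℝ] EuclideanSpace ℝ (Fin d), Function.Injective e :=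
    finrank_le_iff_exists_linearMap.1 (by simpa using hd)
  obtain ⟨p, hp⟩ := LinearMap.exists_extend e
  refine ⟨LinearMap.toContinuousLinearMap p, fun v hv h => ?_⟩
  have h1 : e ⟨v, hv⟩ = e 0 := by
    rw [map_zero, ← h]
    exact (LinearMap.congr_fun hp ⟨v, hv⟩).symm
  simpa using congrArg Subtype.val (he h1)

end Dimension

/-! ### Linear algebra of a tangent hyperplane -/

section ProdForm

variable {c₁ c₂ : ℝ} {k l : ℕ}

theorem prodForm_comm (v w : FlatSpace c₁ k × FlatSpace c₂ l) :
    prodForm c₁ c₂ v w = prodForm c₁ c₂ w v := by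
  simp only [prodForm, flatForm_comm v.1, flatForm_comm v.2]

theorem prodForm_add_left (u v w : FlatSpace c₁ k × FlatSpace c₂ l) :
    prodForm c₁ c₂ (u + v) w = prodForm c₁ c₂ u w + prodForm c₁ c₂ v w := by
  simp only [prodForm, Prod.fst_add, Prod.snd_add, flatForm_add_left]; ring

theorem prodForm_smul_left (r : ℝ) (v w : FlatSpace c₁ k × FlatSpace c₂ l) :
    prodForm c₁ c₂ (r • v) w = r * prodForm c₁ c₂ v w := by
  simp only [prodForm, Prod.smul_fst, Prod.smul_snd, flatForm_smul_left]; ring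

theorem prodForm_sub_left (u v w : FlatSpace c₁ k × FlatSpace c₂ l) :
    prodForm c₁ c₂ (u - v) w = prodForm c₁ c₂ u w - prodForm c₁ c₂ v w := by
  simp only [prodForm, Prod.fst_sub, Prod.snd_sub, flatForm_sub_left]; ring

theorem prodForm_add_right (u v w : FlatSpace c₁ k × FlatSpace c₂ l) :
    prodForm c₁ c₂ u (v + w) = prodForm c₁ c₂ u v + prodForm c₁ c₂ u w := by
  simp only [prodForm_comm u, prodForm_add_left]

theorem prodForm_sub_right (u v w : FlatSpace c₁ k × FlatSpace c₂ l) :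
    prodForm c₁ c₂ u (v - w) = prodForm c₁ c₂ u v - prodForm c₁ c₂ u w := by
  simp only [prodForm_comm u, prodForm_sub_left]

theorem prodForm_smul_right (r : ℝ) (v w : FlatSpace c₁ k × FlatSpace c₂ l) :
    prodForm c₁ c₂ v (r • w) = r * prodForm c₁ c₂ v w := by
  simp only [prodForm_comm v, prodForm_smul_left]

theorem prodForm_proj₂_left (v w : FlatSpace c₁ k × FlatSpace c₂ l) :
    prodForm c₁ c₂ (proj₂ v) w = flatForm c₂ v.2 w.2 := by
  simp [prodForm, proj₂, flatForm_zero_left]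

theorem prodForm_proj₂_right (v w : FlatSpace c₁ k × FlatSpace c₂ l) :
    prodForm c₁ c₂ v (proj₂ w) = flatForm c₂ v.2 w.2 := by
  simp [prodForm, proj₂, flatForm_zero_right]

/-- The metric of the product as a bilinear map. -/
noncomputable def prodBilin (c₁ c₂ : ℝ) (k l : ℕ) :
    (FlatSpace c₁ k × FlatSpace c₂ l) →ₗ[ℝ] (FlatSpace c₁ k × FlatSpace c₂ l) →ₗ[ℝ] ℝ :=
  LinearMap.mk₂ ℝ (prodForm c₁ c₂) prodForm_add_left prodForm_smul_left prodForm_add_right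
    prodForm_smul_right

end ProdForm

/-- `L` is a linear isomorphism onto the hyperplane with unit normal `N` of the tangent space at
`x` of the product of two space forms. -/
structure IsTangentHyperplane (c₁ c₂ : ℝ) {k l : ℕ} {E : Type*} [AddCommGroup E] [Module ℝ E]
    (x N : FlatSpace c₁ k × FlatSpace c₂ l) (L : E →ₗ[ℝ] FlatSpace c₁ k × FlatSpace c₂ l) :
    Prop where
  mem : x ∈ spaceForm c₁ k ×ˢ spaceForm c₂ l
  tangent : ∀ X, L X ∈ spaceFormTangent c₁ x.1 ×ˢ spaceFormTangent c₂ x.2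
  inj : Function.Injective L
  normal_mem : N ∈ spaceFormTangent c₁ x.1 ×ˢ spaceFormTangent c₂ x.2
  unit : prodForm c₁ c₂ N N = 1
  normal : ∀ X, prodForm c₁ c₂ N (L X) = 0
  finrank_add_one : Module.finrank ℝ E + 1 = k + l

namespace IsTangentHyperplane

variable {c₁ c₂ : ℝ} {k l : ℕ} {E : Type*} [AddCommGroup E] [Module ℝ E]
  {x N : FlatSpace c₁ k × FlatSpace c₂ l} {L : E →ₗ[ℝ] FlatSpace c₁ k × FlatSpace c₂ l}

/-- The ambient form may be Lorentzian in either factor. Definiteness on the tangent space is what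
allows vectors to be compared through their inner products. -/
theorem prodForm_self_eq_zero (h : IsTangentHyperplane c₁ c₂ x N L)
    {w : FlatSpace c₁ k × FlatSpace c₂ l}
    (hw : w ∈ spaceFormTangent c₁ x.1 ×ˢ spaceFormTangent c₂ x.2)
    (h0 : prodForm c₁ c₂ w w = 0) : w = 0 := by
  have h1 := flatForm_self_nonneg h.mem.1 hw.1
  have h2 := flatForm_self_nonneg h.mem.2 hw.2
  rw [prodForm] at h0
  exact Prod.ext (eq_zero_of_flatForm_self h.mem.1 hw.1 (by linarith))
    (eq_zero_of_flatForm_self h.mem.2 hw.2 (by linarith))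

/-- The tangent space of the product is the sum of the hyperplane and its normal line. -/
theorem exists_eq_add [FiniteDimensional ℝ E] (h : IsTangentHyperplane c₁ c₂ x N L)
    {w : FlatSpace c₁ k × FlatSpace c₂ l}
    (hw : w ∈ spaceFormTangent c₁ x.1 ×ˢ spaceFormTangent c₂ x.2) :
    ∃ (X : E) (r : ℝ), w = L X + r • N := by
  -- Dimension count: G, corestricted to the two tangent spaces, is injective between spaces of
  -- dimension k + l, hence onto.
  let G : E × ℝ →ₗ[ℝ] FlatSpace c₁ k × FlatSpace c₂ l :=
    L.coprod (LinearMap.toSpanSingleton ℝ _ N)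
  have hG : ∀ z, G z = L z.1 + z.2 • N := fun z => by simp [G]
  have hG₁ : ∀ z, (LinearMap.fst ℝ _ _ ∘ₗ G) z ∈ tangentSubmodule c₁ x.1 := fun z => by
    rw [LinearMap.comp_apply, hG]
    exact Submodule.add_mem _ (mem_tangentSubmodule.2 (h.tangent _).1)
      (Submodule.smul_mem _ _ (mem_tangentSubmodule.2 h.normal_mem.1))
  have hG₂ : ∀ z, (LinearMap.snd ℝ _ _ ∘ₗ G) z ∈ tangentSubmodule c₂ x.2 := fun z => by
    rw [LinearMap.comp_apply, hG]
    exact Submodule.add_mem _ (mem_tangentSubmodule.2 (h.tangent _).2)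
      (Submodule.smul_mem _ _ (mem_tangentSubmodule.2 h.normal_mem.2))
  let G' := ((LinearMap.fst ℝ _ _ ∘ₗ G).codRestrict _ hG₁).prod
    ((LinearMap.snd ℝ _ _ ∘ₗ G).codRestrict _ hG₂)
  have hG' : ∀ z, (((G' z).1 : FlatSpace c₁ k), ((G' z).2 : FlatSpace c₂ l)) = G z := fun z => rfl
  have hinj : Function.Injective G' := by
    rw [← LinearMap.ker_eq_bot, LinearMap.ker_eq_bot']
    intro z hz
    replace hz : (0 : FlatSpace c₁ k × FlatSpace c₂ l) = L z.1 + z.2 • N := by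
      rw [← hG, ← hG', hz]; rfl
    have h1 : z.2 = 0 := by
      have := congrArg (prodForm c₁ c₂ N) hz
      rw [prodForm_add_right, h.normal, prodForm_smul_right, h.unit, mul_one, zero_add,
        ← zero_smul ℝ (0 : FlatSpace c₁ k × FlatSpace c₂ l), prodForm_smul_right,
        zero_mul] at this
      exact this.symm
    rw [h1, zero_smul, add_zero] at hz
    exact Prod.ext (h.inj (hz.symm.trans (map_zero L).symm)) h1
  have hdim : Module.finrank ℝ (E × ℝ) =
      Module.finrank ℝ (tangentSubmodule c₁ x.1 × tangentSubmodule c₂ x.2) := by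
    rw [Module.finrank_prod, Module.finrank_prod, Module.finrank_self, h.finrank_add_one,
      finrank_tangentSubmodule h.mem.1, finrank_tangentSubmodule h.mem.2]
  obtain ⟨z, hz⟩ := (LinearMap.injective_iff_surjective_of_finrank_eq_finrank hdim).1 hinj
    (⟨w.1, mem_tangentSubmodule.2 hw.1⟩, ⟨w.2, mem_tangentSubmodule.2 hw.2⟩)
  exact ⟨z.1, z.2, by rw [← hG, ← hG', hz]⟩

theorem eq_zero [FiniteDimensional ℝ E] (h : IsTangentHyperplane c₁ c₂ x N L)
    {w : FlatSpace c₁ k × FlatSpace c₂ l}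
    (hw : w ∈ spaceFormTangent c₁ x.1 ×ˢ spaceFormTangent c₂ x.2)
    (hwL : ∀ X, prodForm c₁ c₂ w (L X) = 0) (hwN : prodForm c₁ c₂ w N = 0) : w = 0 := by
  obtain ⟨X, r, hX⟩ := h.exists_eq_add hw
  refine h.prodForm_self_eq_zero hw ?_
  nth_rewrite 2 [hX]
  rw [prodForm_add_right, prodForm_smul_right, hwL, hwN, mul_zero, add_zero]

/-- Representation of linear functionals by the induced metric. -/
theorem exists_riesz [FiniteDimensional ℝ E] (h : IsTangentHyperplane c₁ c₂ x N L)
    {W : Type*} [AddCommGroup W] [Module ℝ W] (B : W →ₗ[ℝ] E →ₗ[ℝ] ℝ) :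
    ∃ A : W →ₗ[ℝ] E, ∀ X Y, prodForm c₁ c₂ (L (A X)) (L Y) = B X Y := by
  let g : E →ₗ[ℝ] Module.Dual ℝ E := (prodBilin c₁ c₂ k l).compl₁₂ L L
  have hg : Function.Injective g := by
    rw [← LinearMap.ker_eq_bot, LinearMap.ker_eq_bot']
    intro X hX
    have : L X = 0 := h.prodForm_self_eq_zero (h.tangent X) (LinearMap.congr_fun hX X)
    exact h.inj (this.trans (map_zero L).symm)
  let e : E ≃ₗ[ℝ] Module.Dual ℝ E :=
    LinearEquiv.ofInjectiveOfFinrankEq g hg Subspace.dual_finrank_eq.symm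
  refine ⟨e.symm.toLinearMap ∘ₗ B, fun X Y => ?_⟩
  exact LinearMap.congr_fun (e.apply_symm_apply (B X)) Y

/-- Decomposing π₂ N along the hyperplane and N gives ξ, with normal coefficient ⟨π₂ N, N⟩ = ⟨N₂,
N₂⟩; R represents the bilinear form ⟨π₂ L X, L Y⟩. -/
theorem exists_productTensor [FiniteDimensional ℝ E] (h : IsTangentHyperplane c₁ c₂ x N L) :
    ∃ (R : E →ₗ[ℝ] E) (ξ : E),
      proj₂ N = L ξ + flatForm c₂ N.2 N.2 • N ∧
      ∀ X, proj₂ (L X) = L (R X) + prodForm c₁ c₂ (L X) (L ξ) • N := by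
  have hproj : ∀ v ∈ spaceFormTangent c₁ x.1 ×ˢ spaceFormTangent c₂ x.2,
      (proj₂ v : FlatSpace c₁ k × FlatSpace c₂ l) ∈
        spaceFormTangent c₁ x.1 ×ˢ spaceFormTangent c₂ x.2 := fun v hv =>
    ⟨fun _ => by simp [proj₂, flatForm_zero_right], hv.2⟩
  have key : ∀ v ∈ spaceFormTangent c₁ x.1 ×ˢ spaceFormTangent c₂ x.2,
      ∃ X, proj₂ v = L X + flatForm c₂ v.2 N.2 • N := fun v hv => by
    obtain ⟨X, r, hX⟩ := h.exists_eq_add (hproj v hv)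
    refine ⟨X, ?_⟩
    rw [hX, ← prodForm_proj₂_left, hX, prodForm_add_left, prodForm_comm, h.normal,
      prodForm_smul_left, h.unit, zero_add, mul_one]
  obtain ⟨ξ, hξ⟩ := key N h.normal_mem
  have hξ' : ∀ X, prodForm c₁ c₂ (L X) (L ξ) = flatForm c₂ (L X).2 N.2 := fun X => by
    rw [← prodForm_proj₂_right, hξ, prodForm_add_right, prodForm_smul_right,
      prodForm_comm (L X) N, h.normal, mul_zero, add_zero]
  obtain ⟨R, hR⟩ := h.exists_riesz
    ((prodBilin c₁ c₂ k l).compl₁₂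
      (((LinearMap.inr ℝ (FlatSpace c₁ k) (FlatSpace c₂ l)) ∘ₗ LinearMap.snd ℝ _ _) ∘ₗ L) L)
  refine ⟨R, ξ, hξ, fun X => ?_⟩
  obtain ⟨Y, hY⟩ := key _ (h.tangent X)
  have : L (R X) = L Y := by
    refine sub_eq_zero.1 (h.prodForm_self_eq_zero ?_ ?_)
    · rw [← map_sub]; exact h.tangent _
    · rw [prodForm_sub_left, ← map_sub L, hR]
      have : prodForm c₁ c₂ (proj₂ (L X)) (L (R X - Y)) = prodForm c₁ c₂ (L Y) (L (R X - Y)) := by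
        rw [hY, prodForm_add_left, prodForm_smul_left, h.normal, mul_zero, add_zero]
      exact sub_eq_zero.2 this
  rw [this, hξ', hY]

/-- The shape operator commutes with the product tensor if and only if the second component of
the second fundamental form is symmetric. -/
theorem commute_iff (h : IsTangentHyperplane c₁ c₂ x N L)
    {N' : E →ₗ[ℝ] FlatSpace c₁ k × FlatSpace c₂ l} (hN' : ∀ X, prodForm c₁ c₂ (N' X) N = 0)
    (hS : ∀ X Y, prodForm c₁ c₂ (N' X) (L Y) = prodForm c₁ c₂ (N' Y) (L X))
    {A R : E →ₗ[ℝ] E} {θ : E → ℝ}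
    (hA : ∀ X Y, prodForm c₁ c₂ (L (A X)) (L Y) = -prodForm c₁ c₂ (N' X) (L Y))
    (hR : ∀ X, proj₂ (L X) = L (R X) + θ X • N) :
    A ∘ₗ R = R ∘ₗ A ↔
      ∀ X Y, flatForm c₂ (N' X).2 (L Y).2 = flatForm c₂ (N' Y).2 (L X).2 := by
  have hR' : ∀ X, L (R X) = proj₂ (L X) - θ X • N := fun X => by rw [hR, add_sub_cancel_right]
  -- In `e1` the symmetry of the second fundamental form moves R X to the other slot; in `e2`
  -- self-adjointness of π₂ does. The normal parts vanish because ⟨N' X, N⟩ = 0 and ⟨N, L Y⟩ = 0.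
  have e1 : ∀ X Y, prodForm c₁ c₂ (L (A (R X))) (L Y) = -flatForm c₂ (N' Y).2 (L X).2 :=
    fun X Y => by
      rw [hA, hS, hR', prodForm_sub_right, prodForm_proj₂_right, prodForm_smul_right, hN',
        mul_zero, sub_zero]
  have e2 : ∀ X Y, prodForm c₁ c₂ (L (R (A X))) (L Y) = -flatForm c₂ (N' X).2 (L Y).2 :=
    fun X Y => by
      rw [hR', prodForm_sub_left, prodForm_smul_left, h.normal, prodForm_proj₂_left,
        ← prodForm_proj₂_right, hR, prodForm_add_right, hA, prodForm_smul_right,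
        prodForm_comm (L (A X)) N, h.normal, hR', prodForm_sub_right, prodForm_smul_right, hN',
        prodForm_proj₂_right]
      ring
  constructor
  · intro hc X Y
    have := e2 X Y
    rw [← LinearMap.comp_apply R A, ← hc, LinearMap.comp_apply, e1] at this
    linarith
  · intro hs
    ext X
    refine h.inj (sub_eq_zero.1 (h.prodForm_self_eq_zero ?_ ?_))
    · rw [← map_sub]; exact h.tangent _
    · rw [← map_sub L, map_sub, prodForm_sub_left, LinearMap.comp_apply, LinearMap.comp_apply,
        ← map_sub, e1, e2, hs, sub_self]

end IsTangentHyperplane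

/-! ### Calculus -/

section Calculus

variable {E : Type*} [NormedAddCommGroup E] [NormedSpace ℝ E]
variable {c : ℝ} {m : ℕ}

theorem hasFDerivAt_flatForm {u v : E → FlatSpace c m} {u' v' : E →L[ℝ] FlatSpace c m} {y : E}
    (hu : HasFDerivAt u u' y) (hv : HasFDerivAt v v' y) :
    ∃ D : E →L[ℝ] ℝ, HasFDerivAt (fun z => flatForm c (u z) (v z)) D y ∧
      ∀ X, D X = flatForm c (u' X) (v y) + flatForm c (u y) (v' X) :=
  ⟨_, (flatBilin c m).hasFDerivAt_of_bilinear hu hv, fun X => by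
    simp [ContinuousLinearMap.precompR, flatBilin_apply, add_comm]⟩

theorem flatForm_deriv_add_eq_zero {u v : E → FlatSpace c m} {u' v' : E →L[ℝ] FlatSpace c m}
    {y : E} (hu : HasFDerivAt u u' y) (hv : HasFDerivAt v v' y) {r : ℝ}
    (h : ∀ᶠ z in nhds y, flatForm c (u z) (v z) = r) (X : E) :
    flatForm c (u' X) (v y) + flatForm c (u y) (v' X) = 0 := by
  obtain ⟨D, hD, hDX⟩ := hasFDerivAt_flatForm hu hv
  have h0 : HasFDerivAt (fun z => flatForm c (u z) (v z)) (0 : E →L[ℝ] ℝ) y :=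
    (hasFDerivAt_const r y).congr_of_eventuallyEq h
  rw [← hDX, hD.unique h0]
  rfl

theorem flatForm_deriv_self_eq_zero {u : E → FlatSpace c m} {u' : E →L[ℝ] FlatSpace c m}
    {y : E} (hu : HasFDerivAt u u' y) {r : ℝ}
    (h : ∀ᶠ z in nhds y, flatForm c (u z) (u z) = r) (X : E) :
    flatForm c (u y) (u' X) = 0 := by
  have := flatForm_deriv_add_eq_zero hu hu h X
  rw [flatForm_comm (u' X)] at this
  linarith

theorem contDiffOn_flatForm {u v : E → FlatSpace c m} {s : Set E} (hu : ContDiffOn ℝ ∞ u s)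
    (hv : ContDiffOn ℝ ∞ v s) : ContDiffOn ℝ ∞ (fun z => flatForm c (u z) (v z)) s :=
  ((flatBilin c m).contDiff.comp_contDiffOn hu).clm_apply hv

/-- The 1-form `X ↦ ⟨n, f_* X⟩`. -/
noncomputable def pullForm (c : ℝ) {m : ℕ} (n f : E → FlatSpace c m) (z : E) : E →L[ℝ] ℝ :=
  (flatBilin c m (n z)).comp (fderiv ℝ f z)

theorem pullForm_apply (n f : E → FlatSpace c m) (z X : E) :
    pullForm c n f z X = flatForm c (n z) (fderiv ℝ f z X) := rfl

theorem contDiffOn_pullForm {n f : E → FlatSpace c m} {s : Set E} (hs : IsOpen s)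
    (hn : ContDiffOn ℝ ∞ n s) (hf : ContDiffOn ℝ ∞ f s) : ContDiffOn ℝ ∞ (pullForm c n f) s :=
  ((flatBilin c m).contDiff.comp_contDiffOn hn).clm_comp
    (hf.fderiv_of_isOpen hs (by simp))

theorem fderiv_pullForm_apply {n f : E → FlatSpace c m} {y : E} (hn : DifferentiableAt ℝ n y)
    (hf : ContDiffAt ℝ ∞ f y) (X Y : E) :
    fderiv ℝ (pullForm c n f) y X Y =
      flatForm c (fderiv ℝ n y X) (fderiv ℝ f y Y) +
        flatForm c (n y) (fderiv ℝ (fderiv ℝ f) y X Y) := by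
  have h1 : HasFDerivAt (fun z => flatBilin c m (n z)) _ y :=
    (flatBilin c m).hasFDerivAt.comp y hn.hasFDerivAt
  have h2 : HasFDerivAt (fderiv ℝ f) (fderiv ℝ (fderiv ℝ f) y) y :=
    ((hf.fderiv_right (m := 1) (by norm_cast)).differentiableAt (by simp)).hasFDerivAt
  have := h1.clm_comp h2
  rw [show pullForm c n f = fun z => (flatBilin c m (n z)).comp (fderiv ℝ f z) from rfl,
    this.fderiv]
  simp [flatBilin_apply, add_comm]

theorem fderiv_fderiv_symm {V : Type*} [NormedAddCommGroup V] [NormedSpace ℝ V] {f : E → V} {y : E}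
    (hf : ContDiffAt ℝ ∞ f y) (X Y : E) :
    fderiv ℝ (fderiv ℝ f) y X Y = fderiv ℝ (fderiv ℝ f) y Y X :=
  (hf.isSymmSndFDerivAt (by
    rw [minSmoothness_of_isRCLikeNormedField]; exact WithTop.coe_le_coe.2 le_top)).eq X Y

/-- The form `⟨n, df⟩` is closed at `y` if and only if `⟨dn, df⟩` is symmetric. -/
theorem pullForm_closed_iff {n f : E → FlatSpace c m} {y : E} (hn : DifferentiableAt ℝ n y)
    (hf : ContDiffAt ℝ ∞ f y) (X Y : E) :
    fderiv ℝ (pullForm c n f) y X Y = fderiv ℝ (pullForm c n f) y Y X ↔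
      flatForm c (fderiv ℝ n y X) (fderiv ℝ f y Y) =
        flatForm c (fderiv ℝ n y Y) (fderiv ℝ f y X) := by
  rw [fderiv_pullForm_apply hn hf, fderiv_pullForm_apply hn hf, fderiv_fderiv_symm hf X Y,
    add_left_inj]

/-- The differential of a function times a closed 1-form is closed if the differential of the
function is a multiple of the form; hence such a product has a primitive. -/
theorem exists_primitive_smul {Ω : Set E} (hΩ : IsOpen Ω) (hconv : Convex ℝ Ω) {y₀ : E}
    {β : E → E →L[ℝ] ℝ} (hβ : ContDiffOn ℝ ∞ β Ω)
    (hsymm : ∀ y ∈ Ω, ∀ X Y, fderiv ℝ β y X Y = fderiv ℝ β y Y X)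
    {φ : E → ℝ} (hφ : ContDiffOn ℝ ∞ φ Ω) (hφβ : ∀ y ∈ Ω, ∃ r : ℝ, fderiv ℝ φ y = r • β y) :
    ∃ u : E → ℝ, ContDiffOn ℝ ∞ u Ω ∧ u y₀ = 0 ∧
      ∀ y ∈ Ω, HasFDerivAt u (φ y • β y) y := by
  have hsm : ContDiffOn ℝ ∞ (fun y => φ y • β y) Ω := hφ.smul hβ
  obtain ⟨u, hu⟩ := hconv.exists_forall_hasFDerivAt_of_fderiv_symmetric hΩ
    (hsm.differentiableOn (by simp)) (fun y hy X Y => by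
      have h1 := ((hφ.contDiffAt (hΩ.mem_nhds hy)).differentiableAt (by simp)).hasFDerivAt
      have h2 := ((hβ.contDiffAt (hΩ.mem_nhds hy)).differentiableAt (by simp)).hasFDerivAt
      obtain ⟨r, hr⟩ := hφβ y hy
      -- The extra term of the product rule is r β(X) β(Y), which is symmetric.
      rw [(h1.fun_smul h2).fderiv, hr]
      simp [hsymm y hy X Y, mul_comm, mul_left_comm])
  refine ⟨fun y => u y - u y₀, ?_, sub_self _, fun y hy => (hu y hy).sub_const _⟩
  rw [contDiffOn_infty_iff_fderiv_of_isOpen hΩ]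
  refine ⟨fun y hy => ((hu y hy).sub_const _).differentiableAt.differentiableWithinAt,
    hsm.congr fun y hy => ((hu y hy).sub_const _).fderiv⟩

/-- Only the derivative in the direction of the segment matters. Applied on a product of balls, this
turns the vanishing of partial derivatives into independence of the corresponding coordinates. -/
theorem eq_of_fderiv_apply_eq_zero {V : Type*} [NormedAddCommGroup V] [NormedSpace ℝ V]
    {B : Set E} (hB : IsOpen B) (hconv : Convex ℝ B) {G : E → V} (hG : DifferentiableOn ℝ G B)
    {z z' : E} (hz : z ∈ B) (hz' : z' ∈ B) (h : ∀ w ∈ B, fderiv ℝ G w (z' - z) = 0) :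
    G z = G z' := by
  have hmem : ∀ τ ∈ Icc (0 : ℝ) 1, z + τ • (z' - z) ∈ B := fun τ hτ =>
    hconv.add_smul_sub_mem hz hz' hτ
  have hd : ∀ τ ∈ Icc (0 : ℝ) 1,
      HasDerivWithinAt (fun τ : ℝ => G (z + τ • (z' - z))) 0 (Icc 0 1) τ := fun τ hτ => by
    have h1 : HasDerivAt (fun τ : ℝ => z + τ • (z' - z)) (z' - z) τ := by
      simpa using ((hasDerivAt_id τ).smul_const (z' - z)).const_add z
    have h2 := (hG.differentiableAt (hB.mem_nhds (hmem τ hτ))).hasFDerivAt.comp_hasDerivAt τ h1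
    rw [h _ (hmem τ hτ)] at h2
    exact h2.hasDerivWithinAt
  have := constant_of_has_deriv_right_zero (fun τ hτ => (hd τ hτ).continuousWithinAt)
    (fun τ hτ => ((hd τ (Ico_subset_Icc_self hτ)).mono_of_mem_nhdsWithin
      (Icc_mem_nhdsGE_of_mem hτ))) 1 (by simp)
  simpa using this.symm

end Calculus

/-- The inverse function theorem, with a ball as the domain of the inverse. -/
theorem exists_local_inverse_on_ball {E F : Type*} [NormedAddCommGroup E] [NormedSpace ℝ E]
    [FiniteDimensional ℝ E] [NormedAddCommGroup F] [NormedSpace ℝ F] [FiniteDimensional ℝ F]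
    (hdim : Module.finrank ℝ E = Module.finrank ℝ F) {Ω : Set E} (hΩ : IsOpen Ω) {Ψ : E → F}
    (hΨ : ContDiffOn ℝ ∞ Ψ Ω) {y₀ : E} (hy₀ : y₀ ∈ Ω)
    (hinj : Function.Injective (fderiv ℝ Ψ y₀)) :
    ∃ r > 0, ∃ Φ : OpenPartialHomeomorph F E,
      Φ.source = Metric.ball (Ψ y₀) r ∧ y₀ ∈ Φ.target ∧ Φ.target ⊆ Ω ∧
      ContDiffOn ℝ ∞ Φ Φ.source ∧ ContDiffOn ℝ ∞ Φ.symm Φ.target ∧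
      (∀ y ∈ Φ.target, Φ.symm y = Ψ y) ∧ Φ (Ψ y₀) = y₀ ∧
      ∀ z ∈ Φ.source, Function.Injective (fderiv ℝ Ψ (Φ z)) ∧
        ∀ v, fderiv ℝ Ψ (Φ z) (fderiv ℝ Φ z v) = v := by
  have : CompleteSpace E := FiniteDimensional.complete ℝ E
  have hinjequiv : ∀ L : E →L[ℝ] F, Function.Injective L →
      ∃ e : E ≃L[ℝ] F, (e : E →L[ℝ] F) = L := fun L hL =>
    ⟨(LinearEquiv.ofInjectiveOfFinrankEq L.toLinearMap hL hdim).toContinuousLinearEquiv, by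
      ext; rfl⟩
  obtain ⟨e₀, he₀⟩ := hinjequiv _ hinj
  have hat : ∀ y ∈ Ω, ContDiffAt ℝ ∞ Ψ y := fun y hy => hΨ.contDiffAt (hΩ.mem_nhds hy)
  have hder : ∀ y ∈ Ω, HasFDerivAt Ψ (fderiv ℝ Ψ y) y := fun y hy =>
    ((hat y hy).differentiableAt (by simp)).hasFDerivAt
  have hcont : ContinuousOn (fderiv ℝ Ψ) Ω := hΨ.continuousOn_fderiv_of_isOpen hΩ (by simp)
  -- Shrinking to the open set of points with invertible differential makes the inverse smooth on
  -- the whole ball, not only near its centre.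
  let Ω' := Ω ∩ fderiv ℝ Ψ ⁻¹' range ((↑) : (E ≃L[ℝ] F) → E →L[ℝ] F)
  have hΩ' : IsOpen Ω' := hcont.isOpen_inter_preimage hΩ ContinuousLinearEquiv.isOpen
  have hd₀ : HasFDerivAt Ψ (e₀ : E →L[ℝ] F) y₀ := he₀ ▸ hder y₀ hy₀
  let H := ((hat y₀ hy₀).toOpenPartialHomeomorph Ψ hd₀ (by simp)).restrOpen Ω' hΩ'
  have hHc : ∀ y, H y = Ψ y := fun y => rfl
  have hHs : H.source ⊆ Ω' := fun y hy => hy.2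
  have hy₀H : y₀ ∈ H.source :=
    ⟨(hat y₀ hy₀).mem_toOpenPartialHomeomorph_source hd₀ (by simp), hy₀, e₀, he₀⟩
  obtain ⟨r, hr, hball⟩ := Metric.isOpen_iff.1 H.open_target (Ψ y₀) (H.map_source hy₀H)
  let Φ := H.symm.restrOpen (Metric.ball (Ψ y₀) r) Metric.isOpen_ball
  have hΦs : Φ.source = Metric.ball (Ψ y₀) r := inter_eq_right.2 hball
  have hΦ : ∀ z, Φ z = H.symm z := fun z => rfl
  have hsub : ∀ z ∈ Φ.source, Φ z ∈ H.source := fun z hz => H.map_target (hball (hΦs ▸ hz))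
  have htsub : Φ.target ⊆ H.source := fun y hy => by
    rw [← Φ.right_inv hy]; exact hsub _ (Φ.map_target hy)
  have hΦΨ : ∀ z ∈ Φ.source, Ψ (Φ z) = z := fun z hz => H.right_inv (hball (hΦs ▸ hz))
  have hsm : ∀ z ∈ Φ.source, ContDiffAt ℝ ∞ Φ z := fun z hz => by
    obtain ⟨hzΩ, e, he⟩ := hHs (hsub z hz)
    exact H.contDiffAt_symm (hball (hΦs ▸ hz)) (he ▸ hder _ hzΩ) (hat _ hzΩ)
  have hΦy₀ : Φ (Ψ y₀) = y₀ := H.left_inv hy₀H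
  have hmem₀ : Ψ y₀ ∈ Φ.source := hΦs ▸ Metric.mem_ball_self hr
  refine ⟨r, hr, Φ, hΦs, ?_, fun y hy => (hHs (htsub hy)).1,
    fun z hz => (hsm z hz).contDiffWithinAt, ?_, fun y hy => rfl, hΦy₀, fun z hz => ?_⟩
  · have := Φ.map_source hmem₀
    rwa [hΦy₀] at this
  · exact hΨ.mono fun y hy => (hHs (htsub hy)).1
  · obtain ⟨hzΩ, e, he⟩ := hHs (hsub z hz)
    refine ⟨?_, fun v => ?_⟩
    · rw [← he]; exact e.injective
    · have h1 := (hder _ hzΩ).comp z ((hsm z hz).differentiableAt (by simp)).hasFDerivAt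
      have h2 : HasFDerivAt (Ψ ∘ Φ) (ContinuousLinearMap.id ℝ F) z :=
        (hasFDerivAt_id z).congr_of_eventuallyEq
          (Filter.eventuallyEq_of_mem (Φ.open_source.mem_nhds hz) hΦΨ)
      exact congrArg (fun L : F →L[ℝ] F => L v) (h1.unique h2)

/-! ### Hypersurfaces in coordinates -/

/-- A hypersurface of the product of two space forms with a unit normal field, defined on an open
subset of a vector space. -/
structure IsHypersurfaceOn (c₁ c₂ : ℝ) {k l : ℕ} {E : Type*} [NormedAddCommGroup E]
    [NormedSpace ℝ E] (Ω : Set E) (f N : E → FlatSpace c₁ k × FlatSpace c₂ l) : Prop where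
  isOpen : IsOpen Ω
  smooth : ContDiffOn ℝ ∞ f Ω
  smooth_normal : ContDiffOn ℝ ∞ N Ω
  hyperplane : ∀ y ∈ Ω, IsTangentHyperplane c₁ c₂ (f y) (N y) (fderiv ℝ f y).toLinearMap

namespace IsHypersurfaceOn

variable {c₁ c₂ : ℝ} {k l : ℕ} {E : Type*} [NormedAddCommGroup E] [NormedSpace ℝ E]
  {Ω : Set E} {f N : E → FlatSpace c₁ k × FlatSpace c₂ l}

theorem mono (h : IsHypersurfaceOn c₁ c₂ Ω f N) {Ω' : Set E} (hΩ' : IsOpen Ω') (hs : Ω' ⊆ Ω) :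
    IsHypersurfaceOn c₁ c₂ Ω' f N :=
  ⟨hΩ', h.smooth.mono hs, h.smooth_normal.mono hs, fun y hy => h.hyperplane y (hs hy)⟩

theorem contDiffAt (h : IsHypersurfaceOn c₁ c₂ Ω f N) {y : E} (hy : y ∈ Ω) : ContDiffAt ℝ ∞ f y :=
  h.smooth.contDiffAt (h.isOpen.mem_nhds hy)

theorem contDiffAt_normal (h : IsHypersurfaceOn c₁ c₂ Ω f N) {y : E} (hy : y ∈ Ω) :
    ContDiffAt ℝ ∞ N y :=
  h.smooth_normal.contDiffAt (h.isOpen.mem_nhds hy)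

theorem hasFDerivAt (h : IsHypersurfaceOn c₁ c₂ Ω f N) {y : E} (hy : y ∈ Ω) :
    HasFDerivAt f (fderiv ℝ f y) y :=
  ((h.contDiffAt hy).differentiableAt (by simp)).hasFDerivAt

theorem hasFDerivAt_normal (h : IsHypersurfaceOn c₁ c₂ Ω f N) {y : E} (hy : y ∈ Ω) :
    HasFDerivAt N (fderiv ℝ N y) y :=
  ((h.contDiffAt_normal hy).differentiableAt (by simp)).hasFDerivAt

theorem fderiv_fst (h : IsHypersurfaceOn c₁ c₂ Ω f N) {y : E} (hy : y ∈ Ω) (X : E) :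
    fderiv ℝ (fun z => (f z).1) y X = (fderiv ℝ f y X).1 := by
  rw [(h.hasFDerivAt hy).fst.fderiv]; rfl

theorem fderiv_snd (h : IsHypersurfaceOn c₁ c₂ Ω f N) {y : E} (hy : y ∈ Ω) (X : E) :
    fderiv ℝ (fun z => (f z).2) y X = (fderiv ℝ f y X).2 := by
  rw [(h.hasFDerivAt hy).snd.fderiv]; rfl

theorem fderiv_normal_fst (h : IsHypersurfaceOn c₁ c₂ Ω f N) {y : E} (hy : y ∈ Ω) (X : E) :
    fderiv ℝ (fun z => (N z).1) y X = (fderiv ℝ N y X).1 := by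
  rw [(h.hasFDerivAt_normal hy).fst.fderiv]; rfl

theorem fderiv_normal_snd (h : IsHypersurfaceOn c₁ c₂ Ω f N) {y : E} (hy : y ∈ Ω) (X : E) :
    fderiv ℝ (fun z => (N z).2) y X = (fderiv ℝ N y X).2 := by
  rw [(h.hasFDerivAt_normal hy).snd.fderiv]; rfl

theorem prodForm_fderiv_normal (h : IsHypersurfaceOn c₁ c₂ Ω f N) {y : E} (hy : y ∈ Ω) (X : E) :
    prodForm c₁ c₂ (fderiv ℝ N y X) (N y) = 0 := by
  obtain ⟨D₁, hD₁, hX₁⟩ := hasFDerivAt_flatForm (h.hasFDerivAt_normal hy).fst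
    (h.hasFDerivAt_normal hy).fst
  obtain ⟨D₂, hD₂, hX₂⟩ := hasFDerivAt_flatForm (h.hasFDerivAt_normal hy).snd
    (h.hasFDerivAt_normal hy).snd
  have h0 : HasFDerivAt (fun z => flatForm c₁ (N z).1 (N z).1 + flatForm c₂ (N z).2 (N z).2)
      (0 : E →L[ℝ] ℝ) y :=
    (hasFDerivAt_const 1 y).congr_of_eventuallyEq
      (Filter.eventuallyEq_of_mem (h.isOpen.mem_nhds hy) fun z hz => (h.hyperplane z hz).unit)
  have h1 := congrArg (fun L : E →L[ℝ] ℝ => L X) ((hD₁.add hD₂).unique h0)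
  simp only [add_apply, hX₁, hX₂, zero_apply, ContinuousLinearMap.comp_apply,
    ContinuousLinearMap.coe_fst', ContinuousLinearMap.coe_snd'] at h1
  rw [prodForm]
  linarith [flatForm_comm (c := c₁) (N y).1 (fderiv ℝ N y X).1,
    flatForm_comm (c := c₂) (N y).2 (fderiv ℝ N y X).2]

/-- The second fundamental form is symmetric. -/
theorem prodForm_fderiv_symm (h : IsHypersurfaceOn c₁ c₂ Ω f N) {y : E} (hy : y ∈ Ω) (X Y : E) :
    prodForm c₁ c₂ (fderiv ℝ N y X) (fderiv ℝ f y Y) =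
      prodForm c₁ c₂ (fderiv ℝ N y Y) (fderiv ℝ f y X) := by
  have hd := h.hasFDerivAt_normal hy
  have hn₁ : DifferentiableAt ℝ (fun z => (N z).1) y := hd.fst.differentiableAt
  have hn₂ : DifferentiableAt ℝ (fun z => (N z).2) y := hd.snd.differentiableAt
  have hf₁ : ContDiffAt ℝ ∞ (fun z => (f z).1) y := (h.contDiffAt hy).fst
  have hf₂ : ContDiffAt ℝ ∞ (fun z => (f z).2) y := (h.contDiffAt hy).snd
  -- Normality says that the forms of the two factors add up to zero near y. Differentiating
  -- expresses the second fundamental form through second derivatives of f, which are symmetric.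
  have hsum : ∀ᶠ z in nhds y, pullForm c₁ (fun z => (N z).1) (fun z => (f z).1) z +
      pullForm c₂ (fun z => (N z).2) (fun z => (f z).2) z = 0 := by
    filter_upwards [h.isOpen.mem_nhds hy] with z hz
    ext X
    simp only [add_apply, pullForm_apply, h.fderiv_fst hz, h.fderiv_snd hz]
    exact (h.hyperplane z hz).normal X
  have hopen := h.isOpen.mem_nhds hy
  have d₁ := ((contDiffOn_pullForm (c := c₁) h.isOpen (contDiff_fst.comp_contDiffOn h.smooth_normal)
    (contDiff_fst.comp_contDiffOn h.smooth)).contDiffAt hopen).differentiableAt (by simp)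
  have d₂ := ((contDiffOn_pullForm (c := c₂) h.isOpen (contDiff_snd.comp_contDiffOn h.smooth_normal)
    (contDiff_snd.comp_contDiffOn h.smooth)).contDiffAt hopen).differentiableAt (by simp)
  have h0 := (d₁.hasFDerivAt.add d₂.hasFDerivAt).unique
    ((hasFDerivAt_const (0 : E →L[ℝ] ℝ) y).congr_of_eventuallyEq hsum)
  have e : ∀ X Y, prodForm c₁ c₂ (fderiv ℝ N y X) (fderiv ℝ f y Y) =
      -(flatForm c₁ (N y).1 (fderiv ℝ (fderiv ℝ fun z => (f z).1) y X Y) +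
        flatForm c₂ (N y).2 (fderiv ℝ (fderiv ℝ fun z => (f z).2) y X Y)) := fun X Y => by
    have := congrArg (fun L : E →L[ℝ] E →L[ℝ] ℝ => L X Y) h0
    simp only [add_apply, zero_apply] at this
    erw [fderiv_pullForm_apply hn₁ hf₁, fderiv_pullForm_apply hn₂ hf₂] at this
    rw [h.fderiv_fst hy, h.fderiv_snd hy, h.fderiv_normal_fst hy, h.fderiv_normal_snd hy] at this
    rw [prodForm]
    linarith
  rw [e, e, fderiv_fderiv_symm hf₁ X Y, fderiv_fderiv_symm hf₂ X Y]

end IsHypersurfaceOn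

/-! ### Passing to a chart -/

section Chart

variable {E : Type*} [NormedAddCommGroup E] [NormedSpace ℝ E] {H : Type*} [TopologicalSpace H]
  (I : ModelWithCorners ℝ E H) {M : Type*} [TopologicalSpace M] [ChartedSpace H M]
  {V : Type*} [NormedAddCommGroup V] [NormedSpace ℝ V]

/-- The image of `W` in the extended chart at `x`. -/
def chartDomain (x : M) (W : Set M) : Set E :=
  (extChartAt I x).target ∩ (extChartAt I x).symm ⁻¹' W

variable {I}

theorem isOpen_chartDomain [I.Boundaryless] (x : M) {W : Set M} (hW : IsOpen W) :
    IsOpen (chartDomain I x W) :=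
  (continuousOn_extChartAt_symm x).isOpen_inter_preimage (isOpen_extChartAt_target x) hW

theorem mem_chartDomain {x : M} {W : Set M} (hx : x ∈ W) : extChartAt I x x ∈ chartDomain I x W :=
  ⟨mem_extChartAt_target x, by simpa using hx⟩

theorem pushforward_eq_fderiv [I.Boundaryless] {f : M → V} {x : M}
    (hf : MDifferentiableAt I 𝓘(ℝ, V) f x) (X : E) :
    pushforward I f x X = fderiv ℝ (f ∘ (extChartAt I x).symm) (extChartAt I x x) X := by
  rw [pushforward, hf.mfderiv, I.range_eq_univ, fderivWithin_univ]
  rfl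

theorem contDiffOn_chartDomain [IsManifold I ∞ M] {f : M → V} {W : Set M}
    (hf : ContMDiffOn I 𝓘(ℝ, V) ∞ f W) (x : M) :
    ContDiffOn ℝ ∞ (f ∘ (extChartAt I x).symm) (chartDomain I x W) := by
  rw [← contMDiffOn_iff_contDiffOn]
  exact hf.comp ((contMDiffOn_extChartAt_symm x).mono inter_subset_left) fun y hy => hy.2

/-- Away from the centre of the chart the differential of the inverse chart enters. It is
invertible, so injectivity passes between f and its coordinate expression, and identities in
arbitrary tangent vectors carry over to coordinates. -/
theorem fderiv_comp_extChartAt_symm [I.Boundaryless] [IsManifold I 1 M] {f : M → V} {x : M} {y : E}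
    (hy : y ∈ (extChartAt I x).target)
    (hf : MDifferentiableAt I 𝓘(ℝ, V) f ((extChartAt I x).symm y)) (X : E) :
    fderiv ℝ (f ∘ (extChartAt I x).symm) y X =
      pushforward I f ((extChartAt I x).symm y)
        (mfderivWithin 𝓘(ℝ, E) I (extChartAt I x).symm (range I) y X) := by
  have hu : UniqueMDiffWithinAt 𝓘(ℝ, E) (range I) y := by
    rw [I.range_eq_univ]; exact uniqueMDiffWithinAt_univ _
  have h1 := mfderiv_comp_mfderivWithin y hf (mdifferentiableWithinAt_extChartAt_symm hy) hu
  have h2 : mfderivWithin 𝓘(ℝ, E) 𝓘(ℝ, V) (f ∘ (extChartAt I x).symm) (range I) y =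
      fderiv ℝ (f ∘ (extChartAt I x).symm) y := by
    rw [I.range_eq_univ, mfderivWithin_univ, mfderiv_eq_fderiv]
  rw [← h2, h1]
  rfl

variable {c₁ c₂ : ℝ} {k l : ℕ}

theorem isHypersurfaceOn_chartDomain [I.Boundaryless] [IsManifold I ∞ M]
    (hdim : Module.finrank ℝ E + 1 = k + l)
    {f N : M → FlatSpace c₁ k × FlatSpace c₂ l} {W : Set M} (hW : IsOpen W)
    (hf : IsImmersionOn I (spaceForm c₁ k ×ˢ spaceForm c₂ l) W f)
    (hN : IsUnitNormalOn I (prodForm c₁ c₂)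
      (fun y => spaceFormTangent c₁ y.1 ×ˢ spaceFormTangent c₂ y.2) W f N) (x : M) :
    IsHypersurfaceOn c₁ c₂ (chartDomain I x W) (f ∘ (extChartAt I x).symm)
      (N ∘ (extChartAt I x).symm) where
  isOpen := isOpen_chartDomain x hW
  smooth := contDiffOn_chartDomain hf.smooth x
  smooth_normal := contDiffOn_chartDomain hN.smooth x
  hyperplane y hy := by
    have : IsManifold I 1 M := IsManifold.of_le (n := ∞) (by exact_mod_cast le_top)
    have hopen := (isOpen_chartDomain (I := I) x hW).mem_nhds hy
    have hsm := (contDiffOn_chartDomain hf.smooth x).contDiffAt hopen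
    have hd := (hsm.differentiableAt (by simp)).hasFDerivAt
    have hmd := (hf.smooth.contMDiffAt (hW.mem_nhds hy.2)).mdifferentiableAt (by simp)
    have hfd := fderiv_comp_extChartAt_symm hy.1 hmd
    refine ⟨hf.mapsTo hy.2, fun X => ⟨fun hc => ?_, fun hc => ?_⟩, ?_, hN.tangent _ hy.2,
      hN.unit _ hy.2, fun X => ?_, hdim⟩
    · refine flatForm_deriv_self_eq_zero hd.fst (r := 1 / c₁) ?_ X
      filter_upwards [hopen] with z hz using ((hf.mapsTo hz.2).1 hc).1
    · refine flatForm_deriv_self_eq_zero hd.snd (r := 1 / c₂) ?_ X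
      filter_upwards [hopen] with z hz using ((hf.mapsTo hz.2).2 hc).1
    · have hinv : Function.Injective
          (mfderivWithin 𝓘(ℝ, E) I (extChartAt I x).symm (range I) y) :=
        (isInvertible_mfderivWithin_extChartAt_symm hy.1).injective
      intro X Y hXY
      refine hinv (hf.immersion _ hy.2 ?_)
      rw [← hfd, ← hfd]
      exact hXY
    · have := hN.normal _ hy.2 (mfderivWithin 𝓘(ℝ, E) I (extChartAt I x).symm (range I) y X)
      rw [← hfd] at this
      exact this

end Chart

/-! ### Class `𝒜` in terms of the second fundamental form -/

section ClassA

variable {c₁ c₂ : ℝ} {k l : ℕ}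

/-- Two unit normal fields of a hypersurface agree locally up to sign. -/
theorem IsHypersurfaceOn.exists_eventuallyEq_smul {E : Type*} [NormedAddCommGroup E]
    [NormedSpace ℝ E] [FiniteDimensional ℝ E] {Ω : Set E}
    {f N N' : E → FlatSpace c₁ k × FlatSpace c₂ l} (h : IsHypersurfaceOn c₁ c₂ Ω f N)
    (h' : IsHypersurfaceOn c₁ c₂ Ω f N') {y : E} (hy : y ∈ Ω) :
    ∃ r : ℝ, r ≠ 0 ∧ N' =ᶠ[nhds y] fun z => r • N z := by
  let r : E → ℝ := fun z => prodForm c₁ c₂ (N' z) (N z)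
  have hr : ∀ z ∈ Ω, N' z = r z • N z := fun z hz => by
    have H := h.hyperplane z hz
    have H' := h'.hyperplane z hz
    refine sub_eq_zero.1 (H.eq_zero ⟨fun hc => ?_, fun hc => ?_⟩ (fun X => ?_) ?_)
    · rw [Prod.fst_sub, Prod.smul_fst, flatForm_sub_right, flatForm_smul_right,
        H'.normal_mem.1 hc, H.normal_mem.1 hc, mul_zero, sub_zero]
    · rw [Prod.snd_sub, Prod.smul_snd, flatForm_sub_right, flatForm_smul_right,
        H'.normal_mem.2 hc, H.normal_mem.2 hc, mul_zero, sub_zero]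
    · rw [prodForm_sub_left, prodForm_smul_left, H'.normal, H.normal, mul_zero, sub_zero]
    · rw [prodForm_sub_left, prodForm_smul_left, H.unit, mul_one, sub_self]
  have hr2 : ∀ z ∈ Ω, r z * r z = 1 := fun z hz => by
    have := (h'.hyperplane z hz).unit
    rw [hr z hz, prodForm_smul_left, prodForm_smul_right, (h.hyperplane z hz).unit] at this
    linarith
  have hcont : ContinuousOn r Ω :=
    ((contDiffOn_flatForm (contDiff_fst.comp_contDiffOn h'.smooth_normal)
      (contDiff_fst.comp_contDiffOn h.smooth_normal)).add
      (contDiffOn_flatForm (contDiff_snd.comp_contDiffOn h'.smooth_normal)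
      (contDiff_snd.comp_contDiffOn h.smooth_normal))).continuousOn
  -- A continuous r with r² = 1 keeps its sign near y, hence is constant there.
  have hpos : ∀ᶠ z in nhds y, 0 < r z * r y :=
    ((hcont.continuousAt (h.isOpen.mem_nhds hy)).mul continuousAt_const).eventually_const_lt
      (show 0 < r y * r y by rw [hr2 y hy]; exact one_pos)
  refine ⟨r y, fun h0 => by simpa [h0] using hr2 y hy, ?_⟩
  filter_upwards [hpos, h.isOpen.mem_nhds hy] with z hz hzΩ
  have : r z = r y := by
    have h1 := hr2 z hzΩ
    have h2 := hr2 y hy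
    rcases mul_self_eq_mul_self_iff.1 (h1.trans h2.symm) with h3 | h3
    · exact h3
    · rw [h3] at hz; linarith
  rw [hr z hzΩ, this]

variable {E : Type*} [NormedAddCommGroup E] [NormedSpace ℝ E] {H : Type*} [TopologicalSpace H]
  {I : ModelWithCorners ℝ E H} [I.Boundaryless] {M : Type*} [TopologicalSpace M] [ChartedSpace H M]
  [IsManifold I ∞ M] {f N : M → FlatSpace c₁ k × FlatSpace c₂ l} {W : Set M}

/-- A hypersurface with unit normal field is in class `𝒜` at `x` if and only if the second
component of its second fundamental form is symmetric at `x`. -/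
theorem comp_comm_iff_of_isUnitNormalOn (hdim : Module.finrank ℝ E + 1 = k + l) (hW : IsOpen W)
    (hf : IsImmersionOn I (spaceForm c₁ k ×ˢ spaceForm c₂ l) W f)
    (hN : IsUnitNormalOn I (prodForm c₁ c₂)
      (fun y => spaceFormTangent c₁ y.1 ×ˢ spaceFormTangent c₂ y.2) W f N) {x : M} (hx : x ∈ W)
    {A R : TangentSpace I x →ₗ[ℝ] TangentSpace I x}
    (hA : IsShapeOperatorAt I (prodForm c₁ c₂) f N x A) (hR : IsProductTensorAt I c₁ c₂ f N x R) :
    A ∘ₗ R = R ∘ₗ A ↔ ∀ X Y : E,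
      flatForm c₂ (fderiv ℝ (N ∘ (extChartAt I x).symm) (extChartAt I x x) X).2
        (fderiv ℝ (f ∘ (extChartAt I x).symm) (extChartAt I x x) Y).2 =
      flatForm c₂ (fderiv ℝ (N ∘ (extChartAt I x).symm) (extChartAt I x x) Y).2
        (fderiv ℝ (f ∘ (extChartAt I x).symm) (extChartAt I x x) X).2 := by
  have hH := isHypersurfaceOn_chartDomain hdim hW hf hN x
  have hy := mem_chartDomain (I := I) hx
  have hfX := pushforward_eq_fderiv
    ((hf.smooth.contMDiffAt (hW.mem_nhds hx)).mdifferentiableAt (by simp))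
  have hNX := pushforward_eq_fderiv
    ((hN.smooth.contMDiffAt (hW.mem_nhds hx)).mdifferentiableAt (by simp))
  obtain ⟨ξ, t, -, hRX⟩ := hR
  refine (hH.hyperplane _ hy).commute_iff (θ := fun X => prodForm c₁ c₂ (pushforward I f x X)
    (pushforward I f x ξ)) (N' := (fderiv ℝ (N ∘ (extChartAt I x).symm)
    (extChartAt I x x)).toLinearMap) (A := A) (R := R) (hH.prodForm_fderiv_normal hy)
    (hH.prodForm_fderiv_symm hy) (fun X Y => ?_) (fun X => ?_)
  · have := hA X Y
    rw [hfX, hNX] at this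
    erw [hfX] at this
    exact this
  · have := hRX X
    change proj₂ (fderiv ℝ _ _ X) = fderiv ℝ _ _ (R X) +
      _ • N ((extChartAt I x).symm (extChartAt I x x))
    rw [extChartAt_to_inv, ← hfX]
    exact this.trans (congrArg (· + _) (hfX (R X)))

/-- Existence of the shape operator and of the product tensor of a hypersurface. -/
theorem exists_shapeOperator_productTensor [FiniteDimensional ℝ E]
    (hdim : Module.finrank ℝ E + 1 = k + l) (hW : IsOpen W)
    (hf : IsImmersionOn I (spaceForm c₁ k ×ˢ spaceForm c₂ l) W f)
    (hN : IsUnitNormalOn I (prodForm c₁ c₂)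
      (fun y => spaceFormTangent c₁ y.1 ×ˢ spaceFormTangent c₂ y.2) W f N) {x : M} (hx : x ∈ W) :
    ∃ A R : TangentSpace I x →ₗ[ℝ] TangentSpace I x,
      IsShapeOperatorAt I (prodForm c₁ c₂) f N x A ∧ IsProductTensorAt I c₁ c₂ f N x R := by
  have hH := (isHypersurfaceOn_chartDomain hdim hW hf hN x).hyperplane _
    (mem_chartDomain (I := I) hx)
  have hfX := pushforward_eq_fderiv
    ((hf.smooth.contMDiffAt (hW.mem_nhds hx)).mdifferentiableAt (by simp))
  have hNx : (N ∘ (extChartAt I x).symm) (extChartAt I x x) = N x := by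
    rw [Function.comp_apply, extChartAt_to_inv]
  obtain ⟨A, hA⟩ := hH.exists_riesz (-(prodBilin c₁ c₂ k l).compl₁₂
    (pushforward I N x : E →L[ℝ] FlatSpace c₁ k × FlatSpace c₂ l).toLinearMap
    (fderiv ℝ (f ∘ (extChartAt I x).symm) (extChartAt I x x)).toLinearMap)
  obtain ⟨R, ξ, hξ, hR⟩ := hH.exists_productTensor
  rw [hNx] at hξ
  refine ⟨A, R, fun X Y => ?_, ξ, flatForm c₂ (N x).2 (N x).2, ?_, fun X => ?_⟩
  · erw [hfX, hfX]
    exact hA X Y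
  · rw [hfX]
    exact hξ
  · have := hR X
    rw [hNx] at this
    erw [hfX, hfX, hfX]
    exact this

/-- In class `𝒜`, the second component of the second fundamental form is symmetric with respect to
every unit normal field. -/
theorem InClassAOn.flatForm_fderiv_symm [FiniteDimensional ℝ E]
    (hdim : Module.finrank ℝ E + 1 = k + l) (hW : IsOpen W)
    (hf : IsImmersionOn I (spaceForm c₁ k ×ˢ spaceForm c₂ l) W f)
    (hN : IsUnitNormalOn I (prodForm c₁ c₂)
      (fun y => spaceFormTangent c₁ y.1 ×ˢ spaceFormTangent c₂ y.2) W f N)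
    (hA : InClassAOn I c₁ c₂ W f) (x : M) {y : E} (hy : y ∈ chartDomain I x W) (X Y : E) :
      flatForm c₂ (fderiv ℝ (N ∘ (extChartAt I x).symm) y X).2
        (fderiv ℝ (f ∘ (extChartAt I x).symm) y Y).2 =
      flatForm c₂ (fderiv ℝ (N ∘ (extChartAt I x).symm) y Y).2
        (fderiv ℝ (f ∘ (extChartAt I x).symm) y X).2 := by
  have hone : IsManifold I 1 M := IsManifold.of_le (n := ∞) (by exact_mod_cast le_top)
  have hmf := (hf.smooth.contMDiffAt (hW.mem_nhds hy.2)).mdifferentiableAt (by simp)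
  have hmN := (hN.smooth.contMDiffAt (hW.mem_nhds hy.2)).mdifferentiableAt (by simp)
  have hfX := fderiv_comp_extChartAt_symm hy.1 hmf
  have hNX := fderiv_comp_extChartAt_symm hy.1 hmN
  rw [hfX, hfX, hNX, hNX]
  generalize mfderivWithin 𝓘(ℝ, E) I (extChartAt I x).symm (range I) y X = X'
  generalize mfderivWithin 𝓘(ℝ, E) I (extChartAt I x).symm (range I) y Y = Y'
  have hmem : (extChartAt I x).symm y ∈ W := hy.2
  generalize (extChartAt I x).symm y = p at *
  obtain ⟨W', N', A, R, hW', hp, hsub, hN', hA', hR', hcomm⟩ := hA p hmem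
  have hf' : IsImmersionOn I (spaceForm c₁ k ×ˢ spaceForm c₂ l) W' f :=
    ⟨hf.smooth.mono hsub, hf.mapsTo.mono_left hsub, fun z hz => hf.immersion z (hsub hz)⟩
  have hNr : IsUnitNormalOn I (prodForm c₁ c₂)
      (fun y => spaceFormTangent c₁ y.1 ×ˢ spaceFormTangent c₂ y.2) W' f N :=
    ⟨hN.smooth.mono hsub, fun z hz => hN.tangent z (hsub hz), fun z hz => hN.unit z (hsub hz),
      fun z hz => hN.normal z (hsub hz)⟩
  have hs := (comp_comm_iff_of_isUnitNormalOn hdim hW' hf' hN' hp hA' hR').1 hcomm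
  -- Class 𝒜 supplies a normal field N' depending on the point p. Near p it is a constant multiple
  -- of N, so the derivatives are proportional and the symmetry passes to N.
  obtain ⟨r, hr, hE⟩ := (isHypersurfaceOn_chartDomain hdim hW' hf' hNr p).exists_eventuallyEq_smul
    (isHypersurfaceOn_chartDomain hdim hW' hf' hN' p) (mem_chartDomain (I := I) hp)
  have hd := ((isHypersurfaceOn_chartDomain hdim hW' hf' hNr p).hasFDerivAt_normal
    (mem_chartDomain (I := I) hp)).const_smul r
  have hfd : ∀ X, fderiv ℝ (N' ∘ (extChartAt I p).symm) (extChartAt I p p) X =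
      r • fderiv ℝ (N ∘ (extChartAt I p).symm) (extChartAt I p p) X := fun X => by
    rw [(hd.congr_of_eventuallyEq hE).fderiv]; rfl
  simp only [hfd, Prod.smul_snd, flatForm_smul_left, ← pushforward_eq_fderiv hmf,
    ← pushforward_eq_fderiv hmN] at hs
  exact mul_left_cancel₀ hr (hs X' Y')

end ClassA

/-! ### Moving along normal geodesics -/

/-- The end points of the geodesics with initial points `h` and unit velocities `n` at the
times `α`. -/
noncomputable def geodesicPoint (c : ℝ) {m : ℕ} {M : Type*} (h n : M → FlatSpace c m) (α : M → ℝ)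
    (z : M) : FlatSpace c m :=
  cosC c (α z) • h z + sinC c (α z) • n z

/-- The velocities of the geodesics with initial points `h` and unit velocities `n` at the
times `α`. -/
noncomputable def geodesicVelocity (c : ℝ) {m : ℕ} {M : Type*} (h n : M → FlatSpace c m)
    (α : M → ℝ) (z : M) : FlatSpace c m :=
  (-c * sinC c (α z)) • h z + cosC c (α z) • n z

section Geodesics

variable {c : ℝ} {m : ℕ} {E : Type*} [NormedAddCommGroup E] [NormedSpace ℝ E]
  {h n : E → FlatSpace c m} {α : E → ℝ}

theorem hasFDerivAt_geodesicPoint {h' n' : E →L[ℝ] FlatSpace c m} {α' : E →L[ℝ] ℝ} {y : E}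
    (hh : HasFDerivAt h h' y) (hn : HasFDerivAt n n' y) (hα : HasFDerivAt α α' y) :
    ∃ D : E →L[ℝ] FlatSpace c m, HasFDerivAt (geodesicPoint c h n α) D y ∧
      ∀ X, D X = α' X • geodesicVelocity c h n α y + cosC c (α y) • h' X + sinC c (α y) • n' X := by
  refine ⟨_, (((hasDerivAt_cosC c (α y)).comp_hasFDerivAt y hα).smul hh).add
    (((hasDerivAt_sinC c (α y)).comp_hasFDerivAt y hα).smul hn), fun X => ?_⟩
  simp [geodesicVelocity, smul_smul]
  module

theorem hasFDerivAt_geodesicVelocity {h' n' : E →L[ℝ] FlatSpace c m} {α' : E →L[ℝ] ℝ} {y : E}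
    (hh : HasFDerivAt h h' y) (hn : HasFDerivAt n n' y) (hα : HasFDerivAt α α' y) :
    ∃ D : E →L[ℝ] FlatSpace c m, HasFDerivAt (geodesicVelocity c h n α) D y ∧
      ∀ X, D X = (-c * α' X) • geodesicPoint c h n α y +
        (-c * sinC c (α y)) • h' X + cosC c (α y) • n' X := by
  refine ⟨_, ((((hasDerivAt_sinC c (α y)).comp_hasFDerivAt y hα).const_mul (-c)).smul hh).add
    (((hasDerivAt_cosC c (α y)).comp_hasFDerivAt y hα).smul hn), fun X => ?_⟩
  simp [geodesicPoint, smul_smul]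
  module

theorem contDiffOn_geodesicPoint {s : Set E} (hh : ContDiffOn ℝ ∞ h s) (hn : ContDiffOn ℝ ∞ n s)
    (hα : ContDiffOn ℝ ∞ α s) : ContDiffOn ℝ ∞ (geodesicPoint c h n α) s :=
  (((contDiff_cosC c).comp_contDiffOn hα).smul hh).add
    (((contDiff_sinC c).comp_contDiffOn hα).smul hn)

theorem contDiffOn_geodesicVelocity {s : Set E} (hh : ContDiffOn ℝ ∞ h s)
    (hn : ContDiffOn ℝ ∞ n s) (hα : ContDiffOn ℝ ∞ α s) :
    ContDiffOn ℝ ∞ (geodesicVelocity c h n α) s :=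
  ((contDiffOn_const.mul ((contDiff_sinC c).comp_contDiffOn hα)).smul hh).add
    (((contDiff_cosC c).comp_contDiffOn hα).smul hn)

/-- `n` is a unit vector field tangent to the space form along `h`. -/
structure IsUnitFieldAlong (c : ℝ) {m : ℕ} {M : Type*} (Ω : Set M) (h n : M → FlatSpace c m) :
    Prop where
  mem : ∀ z ∈ Ω, h z ∈ spaceForm c m
  tangent : ∀ z ∈ Ω, n z ∈ spaceFormTangent c (h z)
  unit : ∀ z ∈ Ω, flatForm c (n z) (n z) = 1

theorem IsUnitFieldAlong.geodesic {M : Type*} {Ω : Set M} {h n : M → FlatSpace c m}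
    (H : IsUnitFieldAlong c Ω h n) (α : M → ℝ) :
    IsUnitFieldAlong c Ω (geodesicPoint c h n α) (geodesicVelocity c h n α) :=
  ⟨fun z hz => geodesic_mem (H.mem z hz) (H.tangent z hz) (H.unit z hz) _,
    fun z hz => geodesic_velocity_mem (H.mem z hz) (H.tangent z hz) (H.unit z hz) _,
    fun z hz => geodesic_velocity_unit (H.mem z hz) (H.tangent z hz) (H.unit z hz) _⟩

/-- First variation: the velocity pairs with the differential of the end point. -/
theorem IsUnitFieldAlong.flatForm_geodesicVelocity {Ω : Set E} (H : IsUnitFieldAlong c Ω h n)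
    (hΩ : IsOpen Ω) {y : E} (hy : y ∈ Ω) (hh : DifferentiableAt ℝ h y)
    (hn : DifferentiableAt ℝ n y) (hα : DifferentiableAt ℝ α y) (X : E) :
    flatForm c (geodesicVelocity c h n α y) (fderiv ℝ (geodesicPoint c h n α) y X) =
      fderiv ℝ α y X + flatForm c (n y) (fderiv ℝ h y X) := by
  obtain ⟨D, hD, hDX⟩ := hasFDerivAt_geodesicPoint hh.hasFDerivAt hn.hasFDerivAt hα.hasFDerivAt
  have hmem := hΩ.mem_nhds hy
  have h1 : flatForm c (n y) (fderiv ℝ n y X) = 0 :=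
    flatForm_deriv_self_eq_zero hn.hasFDerivAt (r := 1)
      (by filter_upwards [hmem] with z hz using H.unit z hz) X
  -- The factor c makes this and the next relation hold also for c = 0, where h is unconstrained;
  -- they enter the final identity only with this factor.
  have h2 : c * flatForm c (h y) (fderiv ℝ h y X) = 0 := by
    rcases eq_or_ne c 0 with rfl | hc
    · rw [zero_mul]
    rw [flatForm_deriv_self_eq_zero hh.hasFDerivAt (r := 1 / c)
      (by filter_upwards [hmem] with z hz using (H.mem z hz hc).1) X, mul_zero]
  have h3 : c * (flatForm c (n y) (fderiv ℝ h y X) + flatForm c (h y) (fderiv ℝ n y X)) = 0 := by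
    rcases eq_or_ne c 0 with rfl | hc
    · rw [zero_mul]
    have := flatForm_deriv_add_eq_zero hh.hasFDerivAt hn.hasFDerivAt (r := 0)
      (by filter_upwards [hmem] with z hz using H.tangent z hz hc) X
    rw [flatForm_comm (n y), this, mul_zero]
  have h4 := (H.geodesic α).unit y hy
  rw [hD.fderiv, hDX, flatForm_add_right, flatForm_add_right, flatForm_smul_right, h4]
  simp only [geodesicVelocity, flatForm_add_left, flatForm_smul_left, flatForm_smul_right]
  have h5 := cosC_sq_add c (α y)
  rw [h1]
  linear_combination (-sinC c (α y) * cosC c (α y)) * h2 - sinC c (α y) ^ 2 * h3 +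
    flatForm c (n y) (fderiv ℝ h y X) * h5

end Geodesics

/-! ### The construction yields hypersurfaces in class `𝒜` -/

section Construction

variable {c₁ c₂ : ℝ} {k l : ℕ}

/-- The hypersurface obtained from two families of geodesics. -/
noncomputable def geodesicProduct (c₁ c₂ : ℝ) {k l : ℕ} {M : Type*} (h₁ n₁ : M → FlatSpace c₁ k)
    (h₂ n₂ : M → FlatSpace c₂ l) (a b : ℝ → ℝ) (s : M → ℝ) (z : M) :
    FlatSpace c₁ k × FlatSpace c₂ l :=
  (geodesicPoint c₁ h₁ n₁ (fun z => a (s z)) z, geodesicPoint c₂ h₂ n₂ (fun z => b (s z)) z)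

/-- The unit normal of `geodesicProduct`. -/
noncomputable def geodesicProductNormal (c₁ c₂ : ℝ) {k l : ℕ} {M : Type*}
    (h₁ n₁ : M → FlatSpace c₁ k) (h₂ n₂ : M → FlatSpace c₂ l) (a b : ℝ → ℝ) (s : M → ℝ) (z : M) :
    FlatSpace c₁ k × FlatSpace c₂ l :=
  (deriv b (s z) • geodesicVelocity c₁ h₁ n₁ (fun z => a (s z)) z,
    -deriv a (s z) • geodesicVelocity c₂ h₂ n₂ (fun z => b (s z)) z)

theorem IsAdmissiblePair.contDiffOn_deriv_a {δ : ℝ} {a b : ℝ → ℝ} (h : IsAdmissiblePair δ a b) :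
    ContDiffOn ℝ ∞ (deriv a) (Ioo (-δ) δ) :=
  ((contDiffOn_infty_iff_deriv_of_isOpen isOpen_Ioo).1 h.smooth_a).2

theorem IsAdmissiblePair.contDiffOn_deriv_b {δ : ℝ} {a b : ℝ → ℝ} (h : IsAdmissiblePair δ a b) :
    ContDiffOn ℝ ∞ (deriv b) (Ioo (-δ) δ) :=
  ((contDiffOn_infty_iff_deriv_of_isOpen isOpen_Ioo).1 h.smooth_b).2

theorem smul_mem_spaceFormTangent {c : ℝ} {m : ℕ} {x v : FlatSpace c m} (r : ℝ)
    (hv : v ∈ spaceFormTangent c x) : r • v ∈ spaceFormTangent c x := fun hc => by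
  rw [flatForm_smul_right, hv hc, mul_zero]

theorem geodesicProduct_mem {M : Type*} {Ω : Set M} {h₁ n₁ : M → FlatSpace c₁ k}
    {h₂ n₂ : M → FlatSpace c₂ l} (H₁ : IsUnitFieldAlong c₁ Ω h₁ n₁)
    (H₂ : IsUnitFieldAlong c₂ Ω h₂ n₂) (a b : ℝ → ℝ) (s : M → ℝ) {z : M} (hz : z ∈ Ω) :
    geodesicProduct c₁ c₂ h₁ n₁ h₂ n₂ a b s z ∈ spaceForm c₁ k ×ˢ spaceForm c₂ l :=
  Set.mk_mem_prod ((H₁.geodesic fun z => a (s z)).mem z hz)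
    ((H₂.geodesic fun z => b (s z)).mem z hz)

theorem geodesicProductNormal_mem {M : Type*} {Ω : Set M} {h₁ n₁ : M → FlatSpace c₁ k}
    {h₂ n₂ : M → FlatSpace c₂ l} (H₁ : IsUnitFieldAlong c₁ Ω h₁ n₁)
    (H₂ : IsUnitFieldAlong c₂ Ω h₂ n₂) (a b : ℝ → ℝ) (s : M → ℝ) {z : M} (hz : z ∈ Ω) :
    geodesicProductNormal c₁ c₂ h₁ n₁ h₂ n₂ a b s z ∈
      spaceFormTangent c₁ (geodesicProduct c₁ c₂ h₁ n₁ h₂ n₂ a b s z).1 ×ˢ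
        spaceFormTangent c₂ (geodesicProduct c₁ c₂ h₁ n₁ h₂ n₂ a b s z).2 :=
  Set.mk_mem_prod (smul_mem_spaceFormTangent _ ((H₁.geodesic fun z => a (s z)).tangent z hz))
    (smul_mem_spaceFormTangent _ ((H₂.geodesic fun z => b (s z)).tangent z hz))

theorem geodesicProductNormal_unit {M : Type*} {Ω : Set M} {h₁ n₁ : M → FlatSpace c₁ k}
    {h₂ n₂ : M → FlatSpace c₂ l} (H₁ : IsUnitFieldAlong c₁ Ω h₁ n₁)
    (H₂ : IsUnitFieldAlong c₂ Ω h₂ n₂) {δ : ℝ} {a b : ℝ → ℝ} (hab : IsAdmissiblePair δ a b)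
    {s : M → ℝ} {z : M} (hz : z ∈ Ω) (hs : s z ∈ Ioo (-δ) δ) :
    prodForm c₁ c₂ (geodesicProductNormal c₁ c₂ h₁ n₁ h₂ n₂ a b s z)
      (geodesicProductNormal c₁ c₂ h₁ n₁ h₂ n₂ a b s z) = 1 := by
  simp only [prodForm, geodesicProductNormal, flatForm_smul_left, flatForm_smul_right,
    (H₁.geodesic _).unit z hz, (H₂.geodesic _).unit z hz]
  linear_combination hab.sq_add_sq _ hs

variable {E : Type*} [NormedAddCommGroup E] [NormedSpace ℝ E] {Ω : Set E}
  {h₁ n₁ : E → FlatSpace c₁ k} {h₂ n₂ : E → FlatSpace c₂ l} {δ : ℝ} {a b : ℝ → ℝ} {s : E → ℝ}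

/-- First variation with time a ∘ s: the boundary term ⟨n, dh⟩ vanishes because n is normal to h,
leaving d(a ∘ s). -/
theorem flatForm_geodesicVelocity_comp {c : ℝ} {m : ℕ} {h n : E → FlatSpace c m} {a : ℝ → ℝ}
    (hΩ : IsOpen Ω) (ha : ContDiffOn ℝ ∞ a (Ioo (-δ) δ))
    (H : IsUnitFieldAlong c Ω h n) (hh : ContDiffOn ℝ ∞ h Ω)
    (hn : ContDiffOn ℝ ∞ n Ω) (hs : ContDiffOn ℝ ∞ s Ω) (hsδ : MapsTo s Ω (Ioo (-δ) δ))
    (hω : ∀ y ∈ Ω, ∀ X, flatForm c (n y) (fderiv ℝ h y X) = 0) {y : E} (hy : y ∈ Ω) (X : E) :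
    flatForm c (geodesicVelocity c h n (fun z => a (s z)) y)
      (fderiv ℝ (geodesicPoint c h n (fun z => a (s z))) y X) = deriv a (s y) * fderiv ℝ s y X := by
  have hmem := hΩ.mem_nhds hy
  have hd : ∀ {V : Type} [NormedAddCommGroup V] [NormedSpace ℝ V] {u : E → V},
      ContDiffOn ℝ ∞ u Ω → DifferentiableAt ℝ u y := fun hu =>
    (hu.contDiffAt hmem).differentiableAt (by simp)
  have hda : DifferentiableAt ℝ a (s y) :=
    (ha.contDiffAt (isOpen_Ioo.mem_nhds (hsδ hy))).differentiableAt (by simp)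
  have hc : HasFDerivAt (fun z => a (s z)) (deriv a (s y) • fderiv ℝ s y) y :=
    hda.hasDerivAt.comp_hasFDerivAt y (hd hs).hasFDerivAt
  rw [H.flatForm_geodesicVelocity hΩ hy (hd hh) (hd hn) hc.differentiableAt, hω y hy, add_zero,
    hc.fderiv]
  simp

/-- The two factors contribute b' · a' ds and -a' · b' ds, which cancel. -/
theorem prodForm_geodesicProductNormal (hΩ : IsOpen Ω) (hab : IsAdmissiblePair δ a b)
    (H₁ : IsUnitFieldAlong c₁ Ω h₁ n₁) (H₂ : IsUnitFieldAlong c₂ Ω h₂ n₂)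
    (hh₁ : ContDiffOn ℝ ∞ h₁ Ω) (hn₁ : ContDiffOn ℝ ∞ n₁ Ω)
    (hh₂ : ContDiffOn ℝ ∞ h₂ Ω) (hn₂ : ContDiffOn ℝ ∞ n₂ Ω)
    (hs : ContDiffOn ℝ ∞ s Ω) (hsδ : MapsTo s Ω (Ioo (-δ) δ))
    (hω₁ : ∀ y ∈ Ω, ∀ X, flatForm c₁ (n₁ y) (fderiv ℝ h₁ y X) = 0)
    (hω₂ : ∀ y ∈ Ω, ∀ X, flatForm c₂ (n₂ y) (fderiv ℝ h₂ y X) = 0) {y : E} (hy : y ∈ Ω) (X : E) :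
    prodForm c₁ c₂ (geodesicProductNormal c₁ c₂ h₁ n₁ h₂ n₂ a b s y)
      (fderiv ℝ (geodesicProduct c₁ c₂ h₁ n₁ h₂ n₂ a b s) y X) = 0 := by
  have hmem := hΩ.mem_nhds hy
  have ha := hab.smooth_a.comp hs hsδ
  have hb := hab.smooth_b.comp hs hsδ
  have e₁ := flatForm_geodesicVelocity_comp hΩ hab.smooth_a H₁ hh₁ hn₁ hs hsδ hω₁ hy X
  have e₂ := flatForm_geodesicVelocity_comp hΩ hab.smooth_b H₂ hh₂ hn₂ hs hsδ hω₂ hy X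
  have d₁ := ((contDiffOn_geodesicPoint hh₁ hn₁ ha).contDiffAt hmem).differentiableAt (by simp)
  have d₂ := ((contDiffOn_geodesicPoint hh₂ hn₂ hb).contDiffAt hmem).differentiableAt (by simp)
  have hd : HasFDerivAt (geodesicProduct c₁ c₂ h₁ n₁ h₂ n₂ a b s) _ y :=
    d₁.hasFDerivAt.prodMk d₂.hasFDerivAt
  rw [hd.fderiv]
  simp only [prodForm, geodesicProductNormal, flatForm_smul_left]
  erw [e₁, e₂]
  ring

/-- The second component of the second fundamental form of `geodesicProduct` is symmetric. -/
theorem flatForm_fderiv_geodesicProductNormal_symm (hΩ : IsOpen Ω) (hab : IsAdmissiblePair δ a b)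
    (H₂ : IsUnitFieldAlong c₂ Ω h₂ n₂)
    (hh₁ : ContDiffOn ℝ ∞ h₁ Ω) (hn₁ : ContDiffOn ℝ ∞ n₁ Ω)
    (hh₂ : ContDiffOn ℝ ∞ h₂ Ω) (hn₂ : ContDiffOn ℝ ∞ n₂ Ω)
    (hs : ContDiffOn ℝ ∞ s Ω) (hsδ : MapsTo s Ω (Ioo (-δ) δ))
    (hω₂ : ∀ y ∈ Ω, ∀ X, flatForm c₂ (n₂ y) (fderiv ℝ h₂ y X) = 0) {y : E} (hy : y ∈ Ω) (X Y : E) :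
    flatForm c₂ (fderiv ℝ (geodesicProductNormal c₁ c₂ h₁ n₁ h₂ n₂ a b s) y X).2
      (fderiv ℝ (geodesicProduct c₁ c₂ h₁ n₁ h₂ n₂ a b s) y Y).2 =
    flatForm c₂ (fderiv ℝ (geodesicProductNormal c₁ c₂ h₁ n₁ h₂ n₂ a b s) y Y).2
      (fderiv ℝ (geodesicProduct c₁ c₂ h₁ n₁ h₂ n₂ a b s) y X).2 := by
  have hmem := hΩ.mem_nhds hy
  have hd : ∀ {V : Type} [NormedAddCommGroup V] [NormedSpace ℝ V] {u : E → V},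
      ContDiffOn ℝ ∞ u Ω → DifferentiableAt ℝ u y := fun hu =>
    (hu.contDiffAt hmem).differentiableAt (by simp)
  have ha := hab.smooth_a.comp hs hsδ
  have hb := hab.smooth_b.comp hs hsδ
  have ha' := hab.contDiffOn_deriv_a.comp hs hsδ
  have hb' := hab.contDiffOn_deriv_b.comp hs hsδ
  have hF₁ := contDiffOn_geodesicPoint hh₁ hn₁ ha
  have hF₂ := contDiffOn_geodesicPoint hh₂ hn₂ hb
  have hN₁ := hb'.smul (contDiffOn_geodesicVelocity hh₁ hn₁ ha)
  have hN₂ := ha'.neg.smul (contDiffOn_geodesicVelocity hh₂ hn₂ hb)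
  have hFd : HasFDerivAt (geodesicProduct c₁ c₂ h₁ n₁ h₂ n₂ a b s) _ y :=
    (hd hF₁).hasFDerivAt.prodMk (hd hF₂).hasFDerivAt
  have hNd : HasFDerivAt (geodesicProductNormal c₁ c₂ h₁ n₁ h₂ n₂ a b s) _ y :=
    (hd hN₁).hasFDerivAt.prodMk (hd hN₂).hasFDerivAt
  rw [hFd.fderiv, hNd.fderiv]
  refine (pullForm_closed_iff (hd hN₂) (hF₂.contDiffAt hmem) X Y).1 ?_
  have hφ : ContDiffOn ℝ ∞ (fun z => -(deriv a (s z) * deriv b (s z))) Ω := (ha'.mul hb').neg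
  -- Here β is a function of s times ds, so the derivative of the coefficient contributes only a
  -- multiple of ds ⊗ ds.
  have hE : pullForm c₂ (fun z => -deriv a (s z) • geodesicVelocity c₂ h₂ n₂ (fun z => b (s z)) z)
      (geodesicPoint c₂ h₂ n₂ fun z => b (s z)) =ᶠ[nhds y]
      fun z => (-(deriv a (s z) * deriv b (s z))) • fderiv ℝ s z := by
    filter_upwards [hmem] with z hz
    ext X
    rw [pullForm_apply, flatForm_smul_left,
      flatForm_geodesicVelocity_comp hΩ hab.smooth_b H₂ hh₂ hn₂ hs hsδ hω₂ hz X]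
    simp [mul_assoc]
  have hds : HasFDerivAt (fderiv ℝ s) (fderiv ℝ (fderiv ℝ s) y) y :=
    (((hs.contDiffAt hmem).fderiv_right (m := 1) (by norm_cast)).differentiableAt
      (by simp)).hasFDerivAt
  have hda := ((hab.contDiffOn_deriv_a.contDiffAt (isOpen_Ioo.mem_nhds (hsδ hy))).differentiableAt
    (by simp)).hasDerivAt
  have hdb := ((hab.contDiffOn_deriv_b.contDiffAt (isOpen_Ioo.mem_nhds (hsδ hy))).differentiableAt
    (by simp)).hasDerivAt
  have hφd := (hda.mul hdb).neg.comp_hasFDerivAt y (hd hs).hasFDerivAt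
  have := ((hφd.smul hds).congr_of_eventuallyEq hE).fderiv
  erw [this]
  simp [fderiv_fderiv_symm (hs.contDiffAt hmem) X Y]
  ring

end Construction

/-! ### Smoothness of the construction on a manifold -/

section SmoothProduct

variable {E : Type*} [NormedAddCommGroup E] [NormedSpace ℝ E] {H : Type*} [TopologicalSpace H]
  {I : ModelWithCorners ℝ E H} {M : Type*} [TopologicalSpace M] [ChartedSpace H M]
  {c₁ c₂ : ℝ} {k l : ℕ} {Ω : Set M}
  {h₁ n₁ : M → FlatSpace c₁ k} {h₂ n₂ : M → FlatSpace c₂ l} {δ : ℝ} {a b : ℝ → ℝ} {s : M → ℝ}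

theorem contMDiffOn_geodesicProduct (hab : IsAdmissiblePair δ a b)
    (hh₁ : ContMDiffOn I 𝓘(ℝ, FlatSpace c₁ k) ∞ h₁ Ω)
    (hn₁ : ContMDiffOn I 𝓘(ℝ, FlatSpace c₁ k) ∞ n₁ Ω)
    (hh₂ : ContMDiffOn I 𝓘(ℝ, FlatSpace c₂ l) ∞ h₂ Ω)
    (hn₂ : ContMDiffOn I 𝓘(ℝ, FlatSpace c₂ l) ∞ n₂ Ω)
    (hs : ContMDiffOn I 𝓘(ℝ, ℝ) ∞ s Ω) (hsδ : MapsTo s Ω (Ioo (-δ) δ)) :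
    ContMDiffOn I 𝓘(ℝ, FlatSpace c₁ k × FlatSpace c₂ l) ∞
      (geodesicProduct c₁ c₂ h₁ n₁ h₂ n₂ a b s) Ω := by
  have ha := hab.smooth_a.contMDiffOn.comp hs hsδ
  have hb := hab.smooth_b.contMDiffOn.comp hs hsδ
  exact ((((contDiff_cosC c₁).contMDiff.comp_contMDiffOn ha).smul hh₁).add
    (((contDiff_sinC c₁).contMDiff.comp_contMDiffOn ha).smul hn₁)).prodMk_space
    ((((contDiff_cosC c₂).contMDiff.comp_contMDiffOn hb).smul hh₂).add
    (((contDiff_sinC c₂).contMDiff.comp_contMDiffOn hb).smul hn₂))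

theorem contMDiffOn_geodesicProductNormal (hab : IsAdmissiblePair δ a b)
    (hh₁ : ContMDiffOn I 𝓘(ℝ, FlatSpace c₁ k) ∞ h₁ Ω)
    (hn₁ : ContMDiffOn I 𝓘(ℝ, FlatSpace c₁ k) ∞ n₁ Ω)
    (hh₂ : ContMDiffOn I 𝓘(ℝ, FlatSpace c₂ l) ∞ h₂ Ω)
    (hn₂ : ContMDiffOn I 𝓘(ℝ, FlatSpace c₂ l) ∞ n₂ Ω)
    (hs : ContMDiffOn I 𝓘(ℝ, ℝ) ∞ s Ω) (hsδ : MapsTo s Ω (Ioo (-δ) δ)) :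
    ContMDiffOn I 𝓘(ℝ, FlatSpace c₁ k × FlatSpace c₂ l) ∞
      (geodesicProductNormal c₁ c₂ h₁ n₁ h₂ n₂ a b s) Ω := by
  have ha := hab.smooth_a.contMDiffOn.comp hs hsδ
  have hb := hab.smooth_b.contMDiffOn.comp hs hsδ
  have ha' := hab.contDiffOn_deriv_a.neg.contMDiffOn.comp hs hsδ
  have hb' := hab.contDiffOn_deriv_b.contMDiffOn.comp hs hsδ
  exact (hb'.smul ((((contDiff_const.mul (contDiff_sinC c₁)).contMDiff.comp_contMDiffOn ha).smul
    hh₁).add (((contDiff_cosC c₁).contMDiff.comp_contMDiffOn ha).smul hn₁))).prodMk_space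
    (ha'.smul ((((contDiff_const.mul (contDiff_sinC c₂)).contMDiff.comp_contMDiffOn hb).smul
    hh₂).add (((contDiff_cosC c₂).contMDiff.comp_contMDiffOn hb).smul hn₂)))

end SmoothProduct

/-! ### Regular points and class 𝒜 for the construction on a manifold -/

section RegularPoints

variable {E : Type*} [NormedAddCommGroup E] [NormedSpace ℝ E] {H : Type*} [TopologicalSpace H]
  {I : ModelWithCorners ℝ E H} [I.Boundaryless] {M : Type*} [TopologicalSpace M] [ChartedSpace H M]
  [IsManifold I ∞ M]

/-- Injective linear maps from a finite-dimensional space form an open set, and in a fixed chart the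
differential depends continuously on the point. -/
theorem isOpen_setOf_injective_pushforward [FiniteDimensional ℝ E] {V : Type*}
    [NormedAddCommGroup V] [NormedSpace ℝ V] {f : M → V} {Ω : Set M} (hΩ : IsOpen Ω)
    (hf : ContMDiffOn I 𝓘(ℝ, V) ∞ f Ω) :
    IsOpen {x | x ∈ Ω ∧ Function.Injective (pushforward I f x)} := by
  have hone : IsManifold I 1 M := IsManifold.of_le (n := ∞) (by exact_mod_cast le_top)
  rw [isOpen_iff_mem_nhds]
  rintro x ⟨hx, hinj⟩
  have hmd : ∀ z ∈ Ω, MDifferentiableAt I 𝓘(ℝ, V) f z := fun z hz =>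
    (hf.contMDiffAt (hΩ.mem_nhds hz)).mdifferentiableAt (by simp)
  have hcont : ContinuousOn (fderiv ℝ (f ∘ (extChartAt I x).symm)) (chartDomain I x Ω) :=
    (contDiffOn_chartDomain hf x).continuousOn_fderiv_of_isOpen (isOpen_chartDomain x hΩ) (by simp)
  have hopen := hcont.isOpen_inter_preimage (isOpen_chartDomain x hΩ)
    ContinuousLinearMap.isOpen_injective
  have hmem : extChartAt I x x ∈ chartDomain I x Ω ∩ fderiv ℝ (f ∘ (extChartAt I x).symm) ⁻¹'
      {L | Function.Injective L} := by
    refine ⟨mem_chartDomain hx, fun X Y hXY => hinj ?_⟩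
    rw [pushforward_eq_fderiv (hmd x hx)]
    erw [pushforward_eq_fderiv (hmd x hx)]
    exact hXY
  filter_upwards [(continuousAt_extChartAt x).preimage_mem_nhds (hopen.mem_nhds hmem),
    extChartAt_source_mem_nhds (I := I) x, hΩ.mem_nhds hx] with z hz hzs hzΩ
  refine ⟨hzΩ, ?_⟩
  have hleft := (extChartAt I x).left_inv hzs
  have hinv := isInvertible_mfderivWithin_extChartAt_symm (I := I) ((extChartAt I x).map_source hzs)
  have h1 := fderiv_comp_extChartAt_symm ((extChartAt I x).map_source hzs)
    (by rw [hleft]; exact hmd z hzΩ)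
  have h2 := hz.2
  rw [← hleft]
  intro X Y hXY
  obtain ⟨X', rfl⟩ := hinv.bijective.surjective X
  obtain ⟨Y', rfl⟩ := hinv.bijective.surjective Y
  exact congrArg _ (h2 ((h1 X').trans (hXY.trans (h1 Y').symm)))

variable {c₁ c₂ : ℝ} {k l : ℕ} {Ω : Set M}
  {h₁ n₁ : M → FlatSpace c₁ k} {h₂ n₂ : M → FlatSpace c₂ l} {δ : ℝ} {a b : ℝ → ℝ} {s : M → ℝ}

/-- All data, including s, are functions on one manifold, so the vector space computation applies in
any chart of it and no product structure of the chart is needed. -/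
theorem geodesicProduct_inClassAOn [FiniteDimensional ℝ E]
    (hdim : Module.finrank ℝ E + 1 = k + l) (hΩ : IsOpen Ω) (hab : IsAdmissiblePair δ a b)
    (H₁ : IsUnitFieldAlong c₁ Ω h₁ n₁) (H₂ : IsUnitFieldAlong c₂ Ω h₂ n₂)
    (hh₁ : ContMDiffOn I 𝓘(ℝ, FlatSpace c₁ k) ∞ h₁ Ω)
    (hn₁ : ContMDiffOn I 𝓘(ℝ, FlatSpace c₁ k) ∞ n₁ Ω)
    (hh₂ : ContMDiffOn I 𝓘(ℝ, FlatSpace c₂ l) ∞ h₂ Ω)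
    (hn₂ : ContMDiffOn I 𝓘(ℝ, FlatSpace c₂ l) ∞ n₂ Ω)
    (hs : ContMDiffOn I 𝓘(ℝ, ℝ) ∞ s Ω) (hsδ : MapsTo s Ω (Ioo (-δ) δ))
    (hω₁ : ∀ x ∈ Ω, ∀ X : TangentSpace I x, flatForm c₁ (n₁ x) (pushforward I h₁ x X) = 0)
    (hω₂ : ∀ x ∈ Ω, ∀ X : TangentSpace I x, flatForm c₂ (n₂ x) (pushforward I h₂ x X) = 0)
    {W : Set M} (hW : IsOpen W) (hWΩ : W ⊆ Ω)
    (hinj : ∀ x ∈ W,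
      Function.Injective (pushforward I (geodesicProduct c₁ c₂ h₁ n₁ h₂ n₂ a b s) x)) :
    IsImmersionOn I (spaceForm c₁ k ×ˢ spaceForm c₂ l) W
        (geodesicProduct c₁ c₂ h₁ n₁ h₂ n₂ a b s) ∧
      InClassAOn I c₁ c₂ W (geodesicProduct c₁ c₂ h₁ n₁ h₂ n₂ a b s) := by
  have hone : IsManifold I 1 M := IsManifold.of_le (n := ∞) (by exact_mod_cast le_top)
  have hF := contMDiffOn_geodesicProduct hab hh₁ hn₁ hh₂ hn₂ hs hsδ
  have hN := contMDiffOn_geodesicProductNormal hab hh₁ hn₁ hh₂ hn₂ hs hsδ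
  have hchart : ∀ {c : ℝ} {m : ℕ} {h n : M → FlatSpace c m},
      ContMDiffOn I 𝓘(ℝ, FlatSpace c m) ∞ h Ω →
      (∀ x ∈ Ω, ∀ X : TangentSpace I x, flatForm c (n x) (pushforward I h x X) = 0) →
      ∀ x, ∀ y ∈ chartDomain I x Ω, ∀ X : E, flatForm c ((n ∘ (extChartAt I x).symm) y)
        (fderiv ℝ (h ∘ (extChartAt I x).symm) y X) = 0 := fun hh hω x y hy X => by
    rw [fderiv_comp_extChartAt_symm hy.1
      ((hh.contMDiffAt (hΩ.mem_nhds hy.2)).mdifferentiableAt (by simp))]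
    exact hω _ hy.2 _
  have hunit : ∀ {c : ℝ} {m : ℕ} {h n : M → FlatSpace c m}, IsUnitFieldAlong c Ω h n → ∀ x,
      IsUnitFieldAlong c (chartDomain I x Ω) (h ∘ (extChartAt I x).symm)
        (n ∘ (extChartAt I x).symm) := fun H x =>
    ⟨fun y hy => H.mem _ hy.2, fun y hy => H.tangent _ hy.2, fun y hy => H.unit _ hy.2⟩
  have hsc : ∀ x, MapsTo (s ∘ (extChartAt I x).symm) (chartDomain I x Ω) (Ioo (-δ) δ) :=
    fun x y hy => hsδ hy.2
  have himm : IsImmersionOn I (spaceForm c₁ k ×ˢ spaceForm c₂ l) W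
      (geodesicProduct c₁ c₂ h₁ n₁ h₂ n₂ a b s) :=
    ⟨hF.mono hWΩ, fun x hx => geodesicProduct_mem H₁ H₂ a b s (hWΩ hx), hinj⟩
  have hnor : IsUnitNormalOn I (prodForm c₁ c₂)
      (fun y => spaceFormTangent c₁ y.1 ×ˢ spaceFormTangent c₂ y.2) W
      (geodesicProduct c₁ c₂ h₁ n₁ h₂ n₂ a b s)
      (geodesicProductNormal c₁ c₂ h₁ n₁ h₂ n₂ a b s) := by
    refine ⟨hN.mono hWΩ, fun x hx => geodesicProductNormal_mem H₁ H₂ a b s (hWΩ hx),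
      fun x hx => geodesicProductNormal_unit H₁ H₂ hab (hWΩ hx) (hsδ (hWΩ hx)), fun x hx X => ?_⟩
    have hxΩ := hWΩ hx
    have := prodForm_geodesicProductNormal (isOpen_chartDomain x hΩ) hab (hunit H₁ x) (hunit H₂ x)
      (contDiffOn_chartDomain hh₁ x) (contDiffOn_chartDomain hn₁ x) (contDiffOn_chartDomain hh₂ x)
      (contDiffOn_chartDomain hn₂ x) (contDiffOn_chartDomain hs x) (hsc x) (hchart hh₁ hω₁ x)
      (hchart hh₂ hω₂ x) (mem_chartDomain hxΩ) X
    erw [pushforward_eq_fderiv ((hF.contMDiffAt (hΩ.mem_nhds hxΩ)).mdifferentiableAt (by simp))]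
    have hx' : (geodesicProductNormal c₁ c₂ h₁ n₁ h₂ n₂ a b s) x =
        (geodesicProductNormal c₁ c₂ h₁ n₁ h₂ n₂ a b s)
          ((extChartAt I x).symm (extChartAt I x x)) := by
      rw [extChartAt_to_inv]
    rw [hx']
    exact this
  refine ⟨himm, fun x hx => ?_⟩
  obtain ⟨A, R, hA, hR⟩ := exists_shapeOperator_productTensor hdim hW himm hnor hx
  refine ⟨W, _, A, R, hW, hx, Subset.rfl, hnor, hA, hR, ?_⟩
  rw [comp_comm_iff_of_isUnitNormalOn hdim hW himm hnor hx hA hR]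
  exact flatForm_fderiv_geodesicProductNormal_symm (isOpen_chartDomain x hΩ) hab (hunit H₂ x)
      (contDiffOn_chartDomain hh₁ x) (contDiffOn_chartDomain hn₁ x) (contDiffOn_chartDomain hh₂ x)
      (contDiffOn_chartDomain hn₂ x) (contDiffOn_chartDomain hs x) (hsc x)
      (hchart hh₂ hω₂ x) (mem_chartDomain (hWΩ hx))

end RegularPoints

theorem IsHypersurfaceWithNormalOn.isUnitFieldAlong {E : Type*} [NormedAddCommGroup E]
    [NormedSpace ℝ E] {H : Type*} [TopologicalSpace H] {I : ModelWithCorners ℝ E H} {M : Type*}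
    [TopologicalSpace M] [ChartedSpace H M] {c : ℝ} {m : ℕ} {U : Set M} {h N : M → FlatSpace c m}
    (hh : IsHypersurfaceWithNormalOn I c U h N) : IsUnitFieldAlong c U h N :=
  ⟨hh.1.mapsTo, hh.2.tangent, hh.2.unit⟩

theorem cylinderMap_inClassAOn {d₁ d₂ k l : ℕ} (hdim : 1 + (d₁ + d₂) + 1 = k + l) {c₁ c₂ : ℝ}
    {M₁ : Type u} [TopologicalSpace M₁] [ChartedSpace (EuclideanSpace ℝ (Fin d₁)) M₁]
    [IsManifold (𝓡 d₁) ∞ M₁]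
    {M₂ : Type v} [TopologicalSpace M₂] [ChartedSpace (EuclideanSpace ℝ (Fin d₂)) M₂]
    [IsManifold (𝓡 d₂) ∞ M₂]
    {h Nh : M₁ → FlatSpace c₁ k} {g Ng : M₂ → FlatSpace c₂ l} {δ : ℝ} {a b : ℝ → ℝ}
    (hh : IsHypersurfaceWithNormalOn (𝓡 d₁) c₁ Set.univ h Nh)
    (hg : IsHypersurfaceWithNormalOn (𝓡 d₂) c₂ Set.univ g Ng) (hab : IsAdmissiblePair δ a b) :
    IsOpen (regularPoints (d₁ := d₁) (d₂ := d₂) δ (cylinderMap c₁ c₂ h Nh g Ng a b)) ∧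
      IsImmersionOn (𝓘(ℝ, ℝ).prod ((𝓡 d₁).prod (𝓡 d₂)))
        (spaceForm c₁ k ×ˢ spaceForm c₂ l)
        (regularPoints (d₁ := d₁) (d₂ := d₂) δ (cylinderMap c₁ c₂ h Nh g Ng a b))
        (cylinderMap c₁ c₂ h Nh g Ng a b) ∧
      InClassAOn (𝓘(ℝ, ℝ).prod ((𝓡 d₁).prod (𝓡 d₂))) c₁ c₂
        (regularPoints (d₁ := d₁) (d₂ := d₂) δ (cylinderMap c₁ c₂ h Nh g Ng a b))
        (cylinderMap c₁ c₂ h Nh g Ng a b) := by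
  let I := 𝓘(ℝ, ℝ).prod ((𝓡 d₁).prod (𝓡 d₂))
  let Ω : Set (ℝ × (M₁ × M₂)) := Prod.fst ⁻¹' Ioo (-δ) δ
  have hΩ : IsOpen Ω := isOpen_Ioo.preimage continuous_fst
  -- The cylinder is the case where the geodesic data are pulled back from M₁ and M₂ and s is the
  -- first coordinate; normality of the pulled-back fields is then the chain rule.
  have e : cylinderMap c₁ c₂ h Nh g Ng a b = geodesicProduct c₁ c₂ (fun z => h z.2.1)
      (fun z => Nh z.2.1) (fun z => g z.2.2) (fun z => Ng z.2.2) a b Prod.fst := rfl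
  have p₁ : ContMDiff I (𝓡 d₁) ∞ (fun z : ℝ × (M₁ × M₂) => z.2.1) :=
    contMDiff_fst.comp contMDiff_snd
  have p₂ : ContMDiff I (𝓡 d₂) ∞ (fun z : ℝ × (M₁ × M₂) => z.2.2) :=
    contMDiff_snd.comp contMDiff_snd
  have hs : ContMDiffOn I 𝓘(ℝ, ℝ) ∞ (Prod.fst : ℝ × (M₁ × M₂) → ℝ) Ω := contMDiff_fst.contMDiffOn
  have hh₁ : ContMDiffOn I 𝓘(ℝ, FlatSpace c₁ k) ∞ (fun z : ℝ × (M₁ × M₂) => h z.2.1) Ω :=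
    (hh.1.smooth.comp_contMDiff p₁ fun _ => mem_univ _).contMDiffOn
  have hn₁ : ContMDiffOn I 𝓘(ℝ, FlatSpace c₁ k) ∞ (fun z : ℝ × (M₁ × M₂) => Nh z.2.1) Ω :=
    (hh.2.smooth.comp_contMDiff p₁ fun _ => mem_univ _).contMDiffOn
  have hh₂ : ContMDiffOn I 𝓘(ℝ, FlatSpace c₂ l) ∞ (fun z : ℝ × (M₁ × M₂) => g z.2.2) Ω :=
    (hg.1.smooth.comp_contMDiff p₂ fun _ => mem_univ _).contMDiffOn
  have hn₂ : ContMDiffOn I 𝓘(ℝ, FlatSpace c₂ l) ∞ (fun z : ℝ × (M₁ × M₂) => Ng z.2.2) Ω :=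
    (hg.2.smooth.comp_contMDiff p₂ fun _ => mem_univ _).contMDiffOn
  have H₁ := hh.isUnitFieldAlong
  have H₂ := hg.isUnitFieldAlong
  have hF := contMDiffOn_geodesicProduct hab hh₁ hn₁ hh₂ hn₂ hs fun z hz => hz
  have hopen : IsOpen (regularPoints (d₁ := d₁) (d₂ := d₂) δ (cylinderMap c₁ c₂ h Nh g Ng a b)) :=
    isOpen_setOf_injective_pushforward hΩ hF
  refine ⟨hopen, geodesicProduct_inClassAOn (I := I) ?_ hΩ hab
    ⟨fun z _ => H₁.mem _ (mem_univ _), fun z _ => H₁.tangent _ (mem_univ _),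
      fun z _ => H₁.unit _ (mem_univ _)⟩
    ⟨fun z _ => H₂.mem _ (mem_univ _), fun z _ => H₂.tangent _ (mem_univ _),
      fun z _ => H₂.unit _ (mem_univ _)⟩
    hh₁ hn₁ hh₂ hn₂ hs (fun z hz => hz) (fun z hz X => ?_) (fun z hz X => ?_) hopen
    (fun z hz => hz.1) fun z hz => hz.2⟩
  · simpa [Module.finrank_prod] using hdim
  · have := mfderiv_comp z ((hh.1.smooth.contMDiffAt Filter.univ_mem).mdifferentiableAt (by simp))
      (p₁.mdifferentiableAt (by simp))
    rw [pushforward]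
    erw [this]
    exact hh.2.normal z.2.1 (mem_univ _) _
  · have := mfderiv_comp z ((hg.1.smooth.contMDiffAt Filter.univ_mem).mdifferentiableAt (by simp))
      (p₂.mdifferentiableAt (by simp))
    rw [pushforward]
    erw [this]
    exact hg.2.normal z.2.2 (mem_univ _) _

/-! ### The angle function and the splitting of the tangent space -/

namespace IsTangentHyperplane

variable {c₁ c₂ : ℝ} {k l : ℕ} {E : Type*} [AddCommGroup E] [Module ℝ E]
  {x N : FlatSpace c₁ k × FlatSpace c₂ l} {L : E →ₗ[ℝ] FlatSpace c₁ k × FlatSpace c₂ l}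

/-- Both factors carry the same 1-form up to sign, so a primitive of a multiple of β serves f₁ and
f₂ at once. -/
theorem flatForm_fst_add_snd (h : IsTangentHyperplane c₁ c₂ x N L) (X : E) :
    flatForm c₁ N.1 (L X).1 = -flatForm c₂ N.2 (L X).2 := by
  have := h.normal X
  rw [prodForm] at this
  linarith

theorem flatForm_fst_self (h : IsTangentHyperplane c₁ c₂ x N L) :
    flatForm c₁ N.1 N.1 = 1 - flatForm c₂ N.2 N.2 := by
  have := h.unit
  rw [prodForm] at this
  linarith

theorem angle_nonneg (h : IsTangentHyperplane c₁ c₂ x N L) : 0 ≤ flatForm c₂ N.2 N.2 :=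
  flatForm_self_nonneg h.mem.2 h.normal_mem.2

theorem angle_le_one (h : IsTangentHyperplane c₁ c₂ x N L) : flatForm c₂ N.2 N.2 ≤ 1 := by
  have := flatForm_self_nonneg h.mem.1 h.normal_mem.1
  rw [h.flatForm_fst_self] at this
  linarith

/-- The vector `ξ` and, for every tangent vector, the components of `R X`. -/
theorem exists_gradient [FiniteDimensional ℝ E] (h : IsTangentHyperplane c₁ c₂ x N L) :
    ∃ ξ : E, (L ξ).1 = -flatForm c₂ N.2 N.2 • N.1 ∧
      (L ξ).2 = (1 - flatForm c₂ N.2 N.2) • N.2 ∧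
      ∀ X, ∃ Y, (L Y).1 = -flatForm c₂ N.2 (L X).2 • N.1 ∧
        (L Y).2 = (L X).2 - flatForm c₂ N.2 (L X).2 • N.2 := by
  obtain ⟨R, ξ, hξ, hR⟩ := h.exists_productTensor
  have h1 : (0 : FlatSpace c₁ k) = (L ξ).1 + flatForm c₂ N.2 N.2 • N.1 := congrArg Prod.fst hξ
  have h2 : N.2 = (L ξ).2 + flatForm c₂ N.2 N.2 • N.2 := congrArg Prod.snd hξ
  have e1 : (L ξ).1 = -flatForm c₂ N.2 N.2 • N.1 := by
    rw [neg_smul]; exact eq_neg_of_add_eq_zero_left h1.symm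
  have e2 : (L ξ).2 = (1 - flatForm c₂ N.2 N.2) • N.2 := by
    rw [sub_smul, one_smul]; exact eq_sub_of_add_eq h2.symm
  refine ⟨ξ, e1, e2, fun X => ⟨R X, ?_⟩⟩
  have hβ : prodForm c₁ c₂ (L X) (L ξ) = flatForm c₂ N.2 (L X).2 := by
    rw [prodForm, e1, e2, flatForm_smul_right, flatForm_smul_right, flatForm_comm (L X).1,
      h.flatForm_fst_add_snd, flatForm_comm (L X).2]
    ring
  have h3 := hR X
  rw [hβ] at h3
  have h4 : (0 : FlatSpace c₁ k) = (L (R X)).1 + flatForm c₂ N.2 (L X).2 • N.1 :=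
    congrArg Prod.fst h3
  have h5 : (L X).2 = (L (R X)).2 + flatForm c₂ N.2 (L X).2 • N.2 := congrArg Prod.snd h3
  refine ⟨?_, eq_sub_of_add_eq h5.symm⟩
  rw [neg_smul]; exact eq_neg_of_add_eq_zero_left h4.symm

/-- Vectors orthogonal to `ξ` are sums of vectors tangent to the two factors. -/
theorem exists_split [FiniteDimensional ℝ E] (h : IsTangentHyperplane c₁ c₂ x N L) {X : E}
    (hX : flatForm c₂ N.2 (L X).2 = 0) :
    ∃ X₀ X₁ : E, X = X₀ + X₁ ∧ (L X₀).2 = 0 ∧ (L X₁).1 = 0 := by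
  obtain ⟨ξ, -, -, hR⟩ := h.exists_gradient
  obtain ⟨Y, h1, h2⟩ := hR X
  rw [hX] at h1 h2
  -- For X orthogonal to ξ the projection π₂ f_* X is tangent to the hypersurface, so it equals f_*
  -- Y, and X - Y has no second component.
  refine ⟨X - Y, Y, (sub_add_cancel X Y).symm, ?_, ?_⟩
  · rw [map_sub, Prod.snd_sub, h2, zero_smul, sub_zero, sub_self]
  · rw [h1, neg_zero, zero_smul]

/-- For t ≠ 0 the tangent hyperplane projects onto the tangent space of the first factor: that space
is spanned by the projection and N₁, and N₁ is itself a multiple of the projection -t N₁ of ξ. -/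
theorem eq_zero_of_flatForm_fst [FiniteDimensional ℝ E] (h : IsTangentHyperplane c₁ c₂ x N L)
    (ht : flatForm c₂ N.2 N.2 ≠ 0) {w : FlatSpace c₁ k}
    (hw : ∀ X, flatForm c₁ w (L X).1 = 0) (hwx : c₁ ≠ 0 → flatForm c₁ x.1 w = 0) : w = 0 := by
  obtain ⟨ξ, hξ, -, -⟩ := h.exists_gradient
  obtain ⟨X, r, hX⟩ := h.exists_eq_add (w := (w, 0))
    ⟨hwx, fun _ => by rw [flatForm_zero_right]⟩
  have h1 : w = (L X).1 + r • N.1 := congrArg Prod.fst hX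
  have h2 : flatForm c₁ w N.1 = 0 := by
    have := hw ξ
    rw [hξ, flatForm_smul_right] at this
    exact (mul_eq_zero.1 this).resolve_left (neg_ne_zero.2 ht)
  refine eq_zero_of_flatForm_self h.mem.1 hwx ?_
  nth_rewrite 2 [h1]
  rw [flatForm_add_right, flatForm_smul_right, hw, h2, mul_zero, add_zero]

/-- The same for the second factor, where ξ projects to (1 - t) N₂ and the condition becomes t ≠ 1.
-/
theorem eq_zero_of_flatForm_snd [FiniteDimensional ℝ E] (h : IsTangentHyperplane c₁ c₂ x N L)
    (ht : flatForm c₂ N.2 N.2 ≠ 1) {w : FlatSpace c₂ l}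
    (hw : ∀ X, flatForm c₂ w (L X).2 = 0) (hwx : c₂ ≠ 0 → flatForm c₂ x.2 w = 0) : w = 0 := by
  obtain ⟨ξ, -, hξ, -⟩ := h.exists_gradient
  obtain ⟨X, r, hX⟩ := h.exists_eq_add (w := (0, w))
    ⟨fun _ => by rw [flatForm_zero_right], hwx⟩
  have h1 : w = (L X).2 + r • N.2 := congrArg Prod.snd hX
  have h2 : flatForm c₂ w N.2 = 0 := by
    have := hw ξ
    rw [hξ, flatForm_smul_right] at this
    exact (mul_eq_zero.1 this).resolve_left (sub_ne_zero.2 (Ne.symm ht))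
  refine eq_zero_of_flatForm_self h.mem.2 hwx ?_
  nth_rewrite 2 [h1]
  rw [flatForm_add_right, flatForm_smul_right, hw, h2, mul_zero, add_zero]

end IsTangentHyperplane

/-! ### One factor of the hypersurface -/

section Factor

variable {c : ℝ} {m : ℕ} {E : Type*} [NormedAddCommGroup E] [NormedSpace ℝ E]

/-- No nonzero tangent vector of the space form is orthogonal to the image of the differential. -/
def IsNondegenerateAt (c : ℝ) {m : ℕ} (f : E → FlatSpace c m) (y : E) : Prop :=
  ∀ w, (∀ X, flatForm c w (fderiv ℝ f y X) = 0) → (c ≠ 0 → flatForm c (f y) w = 0) → w = 0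

/-- By symmetry ⟨dN X, df Y⟩ = ⟨dN Y, df X⟩ = 0, and differentiating ⟨f, N⟩ = 0 shows that dN X is
tangent; nondegeneracy leaves only zero. -/
theorem IsNondegenerateAt.fderiv_eq_zero {f N : E → FlatSpace c m} {y : E}
    (h : IsNondegenerateAt c f y) (hf : DifferentiableAt ℝ f y) (hN : DifferentiableAt ℝ N y)
    (htan : c ≠ 0 → ∀ᶠ z in nhds y, flatForm c (f z) (N z) = 0)
    (hsymm : ∀ X Y, flatForm c (fderiv ℝ N y X) (fderiv ℝ f y Y) =
      flatForm c (fderiv ℝ N y Y) (fderiv ℝ f y X)) {X : E} (hX : fderiv ℝ f y X = 0) :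
    fderiv ℝ N y X = 0 := by
  refine h _ (fun Y => by rw [hsymm, hX, flatForm_zero_right]) fun hc => ?_
  have := flatForm_deriv_add_eq_zero hf.hasFDerivAt hN.hasFDerivAt (htan hc) X
  rwa [hX, flatForm_zero_left, zero_add] at this

/-- `f` is a submersion to the space form and `n` is the gradient along `f` of a function with
pull-back `σ`. -/
structure IsGradientFactor (c : ℝ) {m : ℕ} (Ω : Set E) (f n : E → FlatSpace c m) (σ : E → ℝ) :
    Prop where
  isOpen : IsOpen Ω
  unitField : IsUnitFieldAlong c Ω f n
  smooth : ContDiffOn ℝ ∞ f Ω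
  smooth_field : ContDiffOn ℝ ∞ n Ω
  smooth_fun : ContDiffOn ℝ ∞ σ Ω
  fderiv_fun : ∀ y ∈ Ω, ∀ X, fderiv ℝ σ y X = flatForm c (n y) (fderiv ℝ f y X)
  nondegenerate : ∀ y ∈ Ω, IsNondegenerateAt c f y

/-- The foot point on the zero level of `σ`. -/
noncomputable def footPoint (c : ℝ) {m : ℕ} {M : Type*} (f n : M → FlatSpace c m) (σ : M → ℝ) :
    M → FlatSpace c m :=
  geodesicPoint c f n (fun z => -σ z)

/-- The unit normal of the zero level of `σ` at the foot point. -/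
noncomputable def footNormal (c : ℝ) {m : ℕ} {M : Type*} (f n : M → FlatSpace c m) (σ : M → ℝ) :
    M → FlatSpace c m :=
  geodesicVelocity c f n (fun z => -σ z)

/-- Foot point and foot normal come from the geodesic flow at time -σ, and the flow at time σ undoes
it; the identity behind this is `cosC_sq_add`. -/
theorem eq_geodesicPoint_foot {M : Type*} (f n : M → FlatSpace c m) (σ : M → ℝ) (z : M) :
    cosC c (σ z) • footPoint c f n σ z + sinC c (σ z) • footNormal c f n σ z = f z := by
  simp only [footPoint, footNormal, geodesicPoint, geodesicVelocity, cosC_neg, sinC_neg, smul_add,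
    smul_smul]
  have h := cosC_sq_add c (σ z)
  calc _ = (cosC c (σ z) ^ 2 + c * sinC c (σ z) ^ 2) • f z := by module
    _ = f z := by rw [h, one_smul]

namespace IsGradientFactor

variable {Ω : Set E} {f n : E → FlatSpace c m} {σ : E → ℝ} {y : E}

theorem differentiableAt (h : IsGradientFactor c Ω f n σ) (hy : y ∈ Ω) : DifferentiableAt ℝ f y :=
  (h.smooth.contDiffAt (h.isOpen.mem_nhds hy)).differentiableAt (by simp)

theorem differentiableAt_field (h : IsGradientFactor c Ω f n σ) (hy : y ∈ Ω) :
    DifferentiableAt ℝ n y :=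
  (h.smooth_field.contDiffAt (h.isOpen.mem_nhds hy)).differentiableAt (by simp)

theorem differentiableAt_fun (h : IsGradientFactor c Ω f n σ) (hy : y ∈ Ω) :
    DifferentiableAt ℝ σ y :=
  (h.smooth_fun.contDiffAt (h.isOpen.mem_nhds hy)).differentiableAt (by simp)

theorem contDiffOn_footPoint (h : IsGradientFactor c Ω f n σ) :
    ContDiffOn ℝ ∞ (footPoint c f n σ) Ω :=
  contDiffOn_geodesicPoint h.smooth h.smooth_field h.smooth_fun.neg

theorem contDiffOn_footNormal (h : IsGradientFactor c Ω f n σ) :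
    ContDiffOn ℝ ∞ (footNormal c f n σ) Ω :=
  contDiffOn_geodesicVelocity h.smooth h.smooth_field h.smooth_fun.neg

theorem isUnitFieldAlong_foot (h : IsGradientFactor c Ω f n σ) :
    IsUnitFieldAlong c Ω (footPoint c f n σ) (footNormal c f n σ) :=
  h.unitField.geodesic _

/-- The form ⟨n, df⟩ is the differential of σ, hence closed. -/
theorem symm (h : IsGradientFactor c Ω f n σ) (hy : y ∈ Ω) (X Y : E) :
    flatForm c (fderiv ℝ n y X) (fderiv ℝ f y Y) =
      flatForm c (fderiv ℝ n y Y) (fderiv ℝ f y X) := by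
  have hmem := h.isOpen.mem_nhds hy
  rw [← pullForm_closed_iff (h.differentiableAt_field hy) (h.smooth.contDiffAt hmem)]
  have hE : pullForm c n f =ᶠ[nhds y] fderiv ℝ σ := by
    filter_upwards [hmem] with z hz
    ext X
    rw [pullForm_apply, h.fderiv_fun z hz]
  rw [hE.fderiv_eq, fderiv_fderiv_symm (h.smooth_fun.contDiffAt hmem)]

theorem tangent_eventually (h : IsGradientFactor c Ω f n σ) (hy : y ∈ Ω) (hc : c ≠ 0) :
    ∀ᶠ z in nhds y, flatForm c (f z) (n z) = 0 := by
  filter_upwards [h.isOpen.mem_nhds hy] with z hz using h.unitField.tangent z hz hc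

/-- The integral curves of the gradient are geodesics. -/
theorem fderiv_field (h : IsGradientFactor c Ω f n σ) (hy : y ∈ Ω) {T : E} {p : ℝ}
    (hT : fderiv ℝ f y T = p • n y) : fderiv ℝ n y T = -(c * p) • f y := by
  have hmem := h.isOpen.mem_nhds hy
  -- The vector dn(T) + c p f vanishes by nondegeneracy. It is orthogonal to the image of df, as ⟨dn
  -- T, df Y⟩ = p ⟨dn Y, n⟩ = 0 and c ⟨f, df Y⟩ = 0; it is tangent because ⟨f, dn T⟩ = -p and ⟨f, f⟩
  -- = 1 / c.
  refine eq_neg_of_add_eq_zero_left (h.nondegenerate y hy _ (fun Y => ?_) fun hc => ?_) |>.trans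
    (neg_smul _ _).symm
  · have h1 : flatForm c (n y) (fderiv ℝ n y Y) = 0 :=
      flatForm_deriv_self_eq_zero (h.differentiableAt_field hy).hasFDerivAt (r := 1)
        (by filter_upwards [hmem] with z hz using h.unitField.unit z hz) Y
    have h2 : c * flatForm c (f y) (fderiv ℝ f y Y) = 0 := by
      rcases eq_or_ne c 0 with rfl | hc
      · rw [zero_mul]
      rw [flatForm_deriv_self_eq_zero (h.differentiableAt hy).hasFDerivAt (r := 1 / c)
        (by filter_upwards [hmem] with z hz using (h.unitField.mem z hz hc).1) Y, mul_zero]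
    rw [flatForm_add_left, h.symm hy, hT, flatForm_smul_right, flatForm_smul_left, flatForm_comm,
      h1]
    linear_combination p * h2
  · have h1 := flatForm_deriv_add_eq_zero (h.differentiableAt hy).hasFDerivAt
      (h.differentiableAt_field hy).hasFDerivAt (h.tangent_eventually hy hc) T
    rw [hT, flatForm_smul_left, h.unitField.unit y hy] at h1
    have h2 := (h.unitField.mem y hy hc).1
    rw [flatForm_add_right, flatForm_smul_right, h2]
    field_simp
    linarith

/-- A direction in which f does not move moves neither n nor σ, so the foot data of one factor
ignore motions tangent to the other. -/
theorem fderiv_foot_eq_zero_of_fderiv_eq_zero (h : IsGradientFactor c Ω f n σ) (hy : y ∈ Ω) {X : E}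
    (hX : fderiv ℝ f y X = 0) :
    fderiv ℝ (footPoint c f n σ) y X = 0 ∧ fderiv ℝ (footNormal c f n σ) y X = 0 := by
  have hn := (h.nondegenerate y hy).fderiv_eq_zero (h.differentiableAt hy)
    (h.differentiableAt_field hy) (h.tangent_eventually hy) (h.symm hy) hX
  have hσ : fderiv ℝ σ y X = 0 := by rw [h.fderiv_fun y hy, hX, flatForm_zero_right]
  obtain ⟨D, hD, hDX⟩ := hasFDerivAt_geodesicPoint (h.differentiableAt hy).hasFDerivAt
    (h.differentiableAt_field hy).hasFDerivAt (h.differentiableAt_fun hy).hasFDerivAt.fun_neg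
  obtain ⟨D', hD', hDX'⟩ := hasFDerivAt_geodesicVelocity (h.differentiableAt hy).hasFDerivAt
    (h.differentiableAt_field hy).hasFDerivAt (h.differentiableAt_fun hy).hasFDerivAt.fun_neg
  rw [footPoint, footNormal, hD.fderiv, hD'.fderiv, hDX, hDX']
  simp [hX, hn, hσ]

/-- Along the gradient f travels on its geodesic at the rate p, and σ grows at the same rate; the
two effects cancel in the foot data. -/
theorem fderiv_foot_gradient (h : IsGradientFactor c Ω f n σ) (hy : y ∈ Ω) {T : E} {p : ℝ}
    (hT : fderiv ℝ f y T = p • n y) :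
    fderiv ℝ (footPoint c f n σ) y T = 0 ∧ fderiv ℝ (footNormal c f n σ) y T = 0 := by
  have hn := h.fderiv_field hy hT
  have hσ : fderiv ℝ σ y T = p := by
    rw [h.fderiv_fun y hy, hT, flatForm_smul_right, h.unitField.unit y hy, mul_one]
  obtain ⟨D, hD, hDX⟩ := hasFDerivAt_geodesicPoint (h.differentiableAt hy).hasFDerivAt
    (h.differentiableAt_field hy).hasFDerivAt (h.differentiableAt_fun hy).hasFDerivAt.fun_neg
  obtain ⟨D', hD', hDX'⟩ := hasFDerivAt_geodesicVelocity (h.differentiableAt hy).hasFDerivAt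
    (h.differentiableAt_field hy).hasFDerivAt (h.differentiableAt_fun hy).hasFDerivAt.fun_neg
  rw [footPoint, footNormal, hD.fderiv, hD'.fderiv, hDX, hDX', hT, hn, neg_apply, hσ]
  simp only [geodesicPoint, geodesicVelocity]
  constructor <;> module

/-- The foot normal is normal to the foot points. -/
theorem flatForm_footNormal (h : IsGradientFactor c Ω f n σ) (hy : y ∈ Ω) (X : E) :
    flatForm c (footNormal c f n σ y) (fderiv ℝ (footPoint c f n σ) y X) = 0 := by
  rw [footPoint, footNormal, h.unitField.flatForm_geodesicVelocity h.isOpen hy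
    (h.differentiableAt hy) (h.differentiableAt_field hy) (h.differentiableAt_fun hy).fun_neg,
    fderiv_fun_neg, neg_apply, h.fderiv_fun y hy, neg_add_cancel]

/-- At a zero of `σ`, the differential of the foot point is the projection to the complement of
the gradient. -/
theorem fderiv_footPoint_of_eq_zero (h : IsGradientFactor c Ω f n σ) (hy : y ∈ Ω) (h0 : σ y = 0)
    {X : E} (hX : fderiv ℝ σ y X = 0) :
    fderiv ℝ (footPoint c f n σ) y X = fderiv ℝ f y X := by
  obtain ⟨D, hD, hDX⟩ := hasFDerivAt_geodesicPoint (h.differentiableAt hy).hasFDerivAt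
    (h.differentiableAt_field hy).hasFDerivAt (h.differentiableAt_fun hy).hasFDerivAt.fun_neg
  rw [footPoint, hD.fderiv, hDX, neg_apply, hX, h0]
  simp [cosC_zero, sinC_zero]

end IsGradientFactor

end Factor

/-! ### Coordinates adapted to two gradient factors -/

theorem isHypersurfaceWithNormalOn_of_fderiv {c : ℝ} {m d : ℕ}
    {O : Set (EuclideanSpace ℝ (Fin d))} {h n : EuclideanSpace ℝ (Fin d) → FlatSpace c m}
    (hh : ContDiffOn ℝ ∞ h O) (hn : ContDiffOn ℝ ∞ n O) (H : IsUnitFieldAlong c O h n)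
    (hinj : ∀ x ∈ O, Function.Injective (fderiv ℝ h x))
    (hnor : ∀ x ∈ O, ∀ X, flatForm c (n x) (fderiv ℝ h x X) = 0) :
    IsHypersurfaceWithNormalOn (𝓡 d) c O h n :=
  ⟨⟨hh.contMDiffOn, H.mem, fun x hx => by rw [pushforward, mfderiv_eq_fderiv]; exact hinj x hx⟩,
    ⟨hn.contMDiffOn, H.tangent, H.unit, fun x hx X => by
      rw [pushforward, mfderiv_eq_fderiv]; exact hnor x hx X⟩⟩

/-- A vector killed by the `i`-th coordinates is killed by everything that vanishes on the
transversal directions. -/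
theorem apply_eq_zero_of_transversal {E E₁ E₂ W : Type*} [AddCommGroup E] [Module ℝ E]
    [AddCommGroup E₁] [Module ℝ E₁] [AddCommGroup E₂] [Module ℝ E₂] [AddCommGroup W] [Module ℝ W]
    {σ : E →ₗ[ℝ] ℝ} {u₁ : E →ₗ[ℝ] E₁} {u₂ : E →ₗ[ℝ] E₂} {G : E →ₗ[ℝ] W} {T : E}
    (hinj : ∀ X, σ X = 0 → u₁ X = 0 → u₂ X = 0 → X = 0) (hσT : σ T = 1) (huT : u₁ T = 0)
    (hGT : G T = 0)
    (hsplit : ∀ X, σ X = 0 → ∃ X₀ X₁, X = X₀ + X₁ ∧ σ X₀ = 0 ∧ u₂ X₀ = 0 ∧ u₁ X₁ = 0 ∧ G X₁ = 0)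
    {X : E} (hX : u₁ X = 0) : G X = 0 := by
  -- Remove the component along T, which G kills. In the rest G kills X₁, while X₀ has all its
  -- coordinates zero and so vanishes.
  obtain ⟨X₀, X₁, h, h0, h1, h2, h3⟩ := hsplit (X - σ X • T) (by simp [hσT])
  have h4 : u₁ X₀ = 0 := by
    have := congrArg u₁ h
    simpa [hX, huT, h2] using this.symm
  have h5 := hinj X₀ h0 h4 h1
  have := congrArg G h
  simpa [hGT, h5, h3, sub_eq_zero] using this

/-- A section of the foot point map is a hypersurface of the space form. -/
theorem IsGradientFactor.isHypersurfaceWithNormalOn {c : ℝ} {m d : ℕ} {E F : Type*}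
    [NormedAddCommGroup E] [NormedSpace ℝ E] [NormedAddCommGroup F] [NormedSpace ℝ F] {Ω : Set E}
    {f n : E → FlatSpace c m} {σ : E → ℝ} (H : IsGradientFactor c Ω f n σ) {B : Set F}
    {Φ : F → E} (hΦ : ContDiffOn ℝ ∞ Φ B) (hΦΩ : MapsTo Φ B Ω)
    {O : Set (EuclideanSpace ℝ (Fin d))} (hO : IsOpen O) {ι : EuclideanSpace ℝ (Fin d) → F}
    (hι : ContDiff ℝ ∞ ι) (hιB : MapsTo ι O B) (pr : FlatSpace c m →L[ℝ] EuclideanSpace ℝ (Fin d))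
    (hpr : ∀ x ∈ O, pr (footPoint c f n σ (Φ (ι x))) = x) :
    IsHypersurfaceWithNormalOn (𝓡 d) c O (fun x => footPoint c f n σ (Φ (ι x)))
      (fun x => footNormal c f n σ (Φ (ι x))) := by
  have hΦι : ContDiffOn ℝ ∞ (fun x => Φ (ι x)) O := hΦ.comp hι.contDiffOn hιB
  have hm : MapsTo (fun x => Φ (ι x)) O Ω := fun x hx => hΦΩ (hιB hx)
  have hd : ∀ x ∈ O, HasFDerivAt (fun x => footPoint c f n σ (Φ (ι x)))
      ((fderiv ℝ (footPoint c f n σ) (Φ (ι x))).comp (fderiv ℝ (fun x => Φ (ι x)) x)) x :=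
    fun x hx => HasFDerivAt.comp x (((H.contDiffOn_footPoint.contDiffAt
        (H.isOpen.mem_nhds (hm hx))).differentiableAt (by simp)).hasFDerivAt)
      ((hΦι.contDiffAt (hO.mem_nhds hx)).differentiableAt (by simp)).hasFDerivAt
  have HU := H.isUnitFieldAlong_foot
  refine isHypersurfaceWithNormalOn_of_fderiv (H.contDiffOn_footPoint.comp hΦι hm)
    (H.contDiffOn_footNormal.comp hΦι hm)
    ⟨fun x hx => HU.mem _ (hm hx), fun x hx => HU.tangent _ (hm hx),
      fun x hx => HU.unit _ (hm hx)⟩ (fun x hx => ?_) (fun x hx X => ?_)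
  · have h1 := pr.hasFDerivAt.comp x (hd x hx)
    have h2 : HasFDerivAt (pr ∘ fun x => footPoint c f n σ (Φ (ι x)))
        (ContinuousLinearMap.id ℝ _) x :=
      (hasFDerivAt_id x).congr_of_eventuallyEq (Filter.eventuallyEq_of_mem (hO.mem_nhds hx) hpr)
    rw [(hd x hx).fderiv]
    refine Function.LeftInverse.injective (g := pr) fun X => ?_
    exact congrArg (fun L : EuclideanSpace ℝ (Fin d) →L[ℝ] EuclideanSpace ℝ (Fin d) => L X)
      (h1.unique h2)
  · rw [(hd x hx).fderiv]
    exact H.flatForm_footNormal (hm hx) _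

section Box

variable {c₁ c₂ : ℝ} {k l d₁ d₂ : ℕ} {E : Type*} [NormedAddCommGroup E] [NormedSpace ℝ E]
  [FiniteDimensional ℝ E] {Ω : Set E} {f₁ n₁ : E → FlatSpace c₁ k} {f₂ n₂ : E → FlatSpace c₂ l}
  {σ₁ σ₂ s p q : E → ℝ}

/-- Coordinates are s together with linear coordinates of the two foot points. The foot data of one
factor are constant along the gradient and along vectors tangent to the other factor, and each σᵢ is
a function of s, so the geodesic representation of f₁, f₂ separates. -/
theorem exists_cylinder_coordinates (hk : k = d₁ + 1) (hl : l = d₂ + 1)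
    (hdim : Module.finrank ℝ E = 1 + (d₁ + d₂))
    (H₁ : IsGradientFactor c₁ Ω f₁ n₁ σ₁) (H₂ : IsGradientFactor c₂ Ω f₂ n₂ σ₂)
    (hs : ContDiffOn ℝ ∞ s Ω)
    (hp : ∀ y ∈ Ω, 0 < p y ∧ p y < 1) (hq : ∀ y ∈ Ω, 0 < q y ∧ q y < 1)
    (hpq : ∀ y ∈ Ω, p y ^ 2 + q y ^ 2 = 1)
    (hσ₁ : ∀ y ∈ Ω, fderiv ℝ σ₁ y = p y • fderiv ℝ s y)
    (hσ₂ : ∀ y ∈ Ω, fderiv ℝ σ₂ y = q y • fderiv ℝ s y)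
    (hT : ∀ y ∈ Ω, ∃ T, fderiv ℝ s y T = 1 ∧ fderiv ℝ f₁ y T = p y • n₁ y ∧
      fderiv ℝ f₂ y T = q y • n₂ y)
    (hsplit : ∀ y ∈ Ω, ∀ X, fderiv ℝ s y X = 0 → ∃ X₀ X₁, X = X₀ + X₁ ∧
      fderiv ℝ f₂ y X₀ = 0 ∧ fderiv ℝ f₁ y X₁ = 0 ∧ fderiv ℝ s y X₀ = 0 ∧ fderiv ℝ s y X₁ = 0)
    (hinj : ∀ y ∈ Ω, ∀ X, fderiv ℝ f₁ y X = 0 → fderiv ℝ f₂ y X = 0 → X = 0)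
    {y₀ : E} (hy₀ : y₀ ∈ Ω) (hs₀ : s y₀ = 0) (hσ₁₀ : σ₁ y₀ = 0) (hσ₂₀ : σ₂ y₀ = 0) :
    ∃ (O₁ : Set (EuclideanSpace ℝ (Fin d₁))) (O₂ : Set (EuclideanSpace ℝ (Fin d₂)))
      (h Nh : EuclideanSpace ℝ (Fin d₁) → FlatSpace c₁ k)
      (g Ng : EuclideanSpace ℝ (Fin d₂) → FlatSpace c₂ l)
      (δ : ℝ) (a b : ℝ → ℝ)
      (Φ : OpenPartialHomeomorph
        (ℝ × (EuclideanSpace ℝ (Fin d₁) × EuclideanSpace ℝ (Fin d₂))) E),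
      IsOpen O₁ ∧ IsOpen O₂ ∧
      IsHypersurfaceWithNormalOn (𝓡 d₁) c₁ O₁ h Nh ∧
      IsHypersurfaceWithNormalOn (𝓡 d₂) c₂ O₂ g Ng ∧
      IsAdmissiblePair δ a b ∧
      Φ.source = Set.Ioo (-δ) δ ×ˢ (O₁ ×ˢ O₂) ∧ y₀ ∈ Φ.target ∧ Φ.target ⊆ Ω ∧
      ContDiffOn ℝ ∞ Φ Φ.source ∧ ContDiffOn ℝ ∞ Φ.symm Φ.target ∧
      ∀ z ∈ Set.Ioo (-δ) δ ×ˢ (O₁ ×ˢ O₂),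
        (f₁ (Φ z), f₂ (Φ z)) = cylinderMap c₁ c₂ h Nh g Ng a b z := by
  have hΩ := H₁.isOpen
  have hn0 : ∀ {c : ℝ} {m : ℕ} {f n : E → FlatSpace c m} {σ : E → ℝ},
      IsGradientFactor c Ω f n σ → n y₀ ≠ 0 := fun H h0 => by
    have := H.unitField.unit y₀ hy₀
    rw [h0, flatForm_zero_left] at this
    exact zero_ne_one this
  -- On ker ds at y₀ the differential of the foot point takes its values in the complement of n₁, of
  -- dimension less than k, so d₁ = k - 1 linear coordinates detect it.
  obtain ⟨p₁, hp₁⟩ := exists_injOn_clm (normalComplement c₁ (f₁ y₀) (n₁ y₀)) (d := d₁) (by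
    have := finrank_normalComplement_lt (H₁.unitField.mem y₀ hy₀) (H₁.unitField.tangent y₀ hy₀)
      (hn0 H₁)
    omega)
  obtain ⟨p₂, hp₂⟩ := exists_injOn_clm (normalComplement c₂ (f₂ y₀) (n₂ y₀)) (d := d₂) (by
    have := finrank_normalComplement_lt (H₂.unitField.mem y₀ hy₀) (H₂.unitField.tangent y₀ hy₀)
      (hn0 H₂)
    omega)
  set P₁ := footPoint c₁ f₁ n₁ σ₁ with hP₁
  set Q₁ := footNormal c₁ f₁ n₁ σ₁ with hQ₁
  set P₂ := footPoint c₂ f₂ n₂ σ₂ with hP₂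
  set Q₂ := footNormal c₂ f₂ n₂ σ₂ with hQ₂
  let Ψ : E → ℝ × (EuclideanSpace ℝ (Fin d₁) × EuclideanSpace ℝ (Fin d₂)) :=
    fun y => (s y, (p₁ (P₁ y), p₂ (P₂ y)))
  have hΨ : ContDiffOn ℝ ∞ Ψ Ω := hs.prodMk
    ((p₁.contDiff.comp_contDiffOn H₁.contDiffOn_footPoint).prodMk
      (p₂.contDiff.comp_contDiffOn H₂.contDiffOn_footPoint))
  have hder : ∀ {V : Type} [NormedAddCommGroup V] [NormedSpace ℝ V] {u : E → V},
      ContDiffOn ℝ ∞ u Ω → ∀ y ∈ Ω, HasFDerivAt u (fderiv ℝ u y) y := fun hu y hy =>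
    ((hu.contDiffAt (hΩ.mem_nhds hy)).differentiableAt (by simp)).hasFDerivAt
  have dP₁ := hder H₁.contDiffOn_footPoint
  have dP₂ := hder H₂.contDiffOn_footPoint
  have dQ₁ := hder H₁.contDiffOn_footNormal
  have dQ₂ := hder H₂.contDiffOn_footNormal
  have hΨd : ∀ y ∈ Ω, ∀ X, fderiv ℝ Ψ y X =
      (fderiv ℝ s y X, (p₁ (fderiv ℝ P₁ y X), p₂ (fderiv ℝ P₂ y X))) := fun y hy X => by
    have : HasFDerivAt Ψ _ y := (hder hs y hy).prodMk
      ((p₁.hasFDerivAt.comp y (dP₁ y hy)).prodMk (p₂.hasFDerivAt.comp y (dP₂ y hy)))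
    rw [this.fderiv]; rfl
  have htan : ∀ {c : ℝ} {m : ℕ} {f n : E → FlatSpace c m} {σ : E → ℝ} {r : ℝ},
      IsGradientFactor c Ω f n σ → fderiv ℝ σ y₀ = r • fderiv ℝ s y₀ → σ y₀ = 0 → ∀ X,
      fderiv ℝ s y₀ X = 0 → fderiv ℝ (footPoint c f n σ) y₀ X = fderiv ℝ f y₀ X ∧
        fderiv ℝ f y₀ X ∈ normalComplement c (f y₀) (n y₀) := fun H hr h0 X hX => by
    have hσX := congrArg (fun L : E →L[ℝ] ℝ => L X) hr
    simp only [smul_apply, hX, smul_zero] at hσX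
    refine ⟨H.fderiv_footPoint_of_eq_zero hy₀ h0 hσX, mem_normalComplement.2 ⟨fun hc => ?_, ?_⟩⟩
    · exact flatForm_deriv_self_eq_zero (H.differentiableAt hy₀).hasFDerivAt
        (by filter_upwards [hΩ.mem_nhds hy₀] with z hz using (H.unitField.mem z hz hc).1) X
    · rw [← H.fderiv_fun y₀ hy₀, hσX]
  -- Since σ₁ and σ₂ vanish at y₀, the foot points have there the same derivatives as f₁ and f₂
  -- along ker ds, and f₁, f₂ together form an immersion.
  have hinj₀ : Function.Injective (fderiv ℝ Ψ y₀) := by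
    rw [injective_iff_map_eq_zero]
    intro X hX
    rw [hΨd y₀ hy₀] at hX
    obtain ⟨hX0, hX1, hX2⟩ : fderiv ℝ s y₀ X = 0 ∧ p₁ (fderiv ℝ P₁ y₀ X) = 0 ∧
        p₂ (fderiv ℝ P₂ y₀ X) = 0 := by simpa [Prod.ext_iff] using hX
    obtain ⟨e1, m1⟩ := htan H₁ (hσ₁ y₀ hy₀) hσ₁₀ X hX0
    obtain ⟨e2, m2⟩ := htan H₂ (hσ₂ y₀ hy₀) hσ₂₀ X hX0
    rw [hP₁, e1] at hX1
    rw [hP₂, e2] at hX2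
    exact hinj y₀ hy₀ X (hp₁ _ m1 hX1) (hp₂ _ m2 hX2)
  obtain ⟨r, hr, Φ, hΦs, hy₀Φ, hΦΩ, hΦsm, hΦsm', hΦΨ, hΦ₀, hΦd⟩ :=
    exists_local_inverse_on_ball (by simp [hdim, Module.finrank_prod]) hΩ hΨ hy₀ hinj₀
  set u₁ := p₁ (P₁ y₀) with hu₁
  set u₂ := p₂ (P₂ y₀) with hu₂
  have hΨ₀ : Ψ y₀ = (0, (u₁, u₂)) := by simp only [Ψ, hs₀, hu₁, hu₂]
  -- In the sup norm a ball of the product is a product of balls; it is centred at s = 0 because s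
  -- vanishes at y₀.
  have hB : Φ.source = Ioo (-r) r ×ˢ (Metric.ball u₁ r ×ˢ Metric.ball u₂ r) := by
    rw [hΦs, hΨ₀, ← ball_prod_same, ← ball_prod_same, Real.ball_eq_Ioo, zero_sub, zero_add]
  have hBopen := Φ.open_source
  have hBconv : Convex ℝ Φ.source := hΦs ▸ convex_ball _ _
  have hmap : MapsTo Φ Φ.source Ω := fun z hz => hΦΩ (Φ.map_source hz)
  have hr0 : (0 : ℝ) ∈ Ioo (-r) r := ⟨by linarith, hr⟩
  have hu₁m : u₁ ∈ Metric.ball u₁ r := Metric.mem_ball_self hr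
  have hu₂m : u₂ ∈ Metric.ball u₂ r := Metric.mem_ball_self hr
  have hΨΦ : ∀ z ∈ Φ.source, Ψ (Φ z) = z := fun z hz => by
    rw [← hΦΨ _ (Φ.map_source hz), Φ.left_inv hz]
  have dΦ : ∀ z ∈ Φ.source, HasFDerivAt Φ (fderiv ℝ Φ z) z := fun z hz =>
    ((hΦsm.contDiffAt (hBopen.mem_nhds hz)).differentiableAt (by simp)).hasFDerivAt
  have hcomp : ∀ {V : Type} [NormedAddCommGroup V] [NormedSpace ℝ V] {u : E → V},
      ContDiffOn ℝ ∞ u Ω → ∀ z ∈ Φ.source,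
      HasFDerivAt (fun z => u (Φ z)) ((fderiv ℝ u (Φ z)).comp (fderiv ℝ Φ z)) z :=
    fun hu z hz => (hder hu (Φ z) (hmap hz)).comp z (dΦ z hz)
  have hconst : ∀ {V : Type} [NormedAddCommGroup V] [NormedSpace ℝ V] {u : E → V},
      ContDiffOn ℝ ∞ u Ω → ∀ z ∈ Φ.source, ∀ z' ∈ Φ.source,
      (∀ w ∈ Φ.source, fderiv ℝ u (Φ w) (fderiv ℝ Φ w (z' - z)) = 0) → u (Φ z) = u (Φ z') :=
    fun hu z hz z' hz' h => eq_of_fderiv_apply_eq_zero (G := fun z => _) hBopen hBconv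
      (fun w hw => (hcomp hu w hw).differentiableAt.differentiableWithinAt) hz hz' fun w hw => by
        rw [(hcomp hu w hw).fderiv]; exact h w hw
  have hcoord : ∀ w ∈ Φ.source, ∀ v, fderiv ℝ s (Φ w) (fderiv ℝ Φ w v) = v.1 ∧
      p₁ (fderiv ℝ P₁ (Φ w) (fderiv ℝ Φ w v)) = v.2.1 ∧
      p₂ (fderiv ℝ P₂ (Φ w) (fderiv ℝ Φ w v)) = v.2.2 := fun w hw v => by
    have := (hΦd w hw).2 v
    rw [hΨd _ (hmap hw)] at this
    exact ⟨congrArg (fun v => v.1) this, congrArg (fun v => v.2.1) this,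
      congrArg (fun v => v.2.2) this⟩
  have hinjw : ∀ w ∈ Φ.source, ∀ X, fderiv ℝ s (Φ w) X = 0 → p₁ (fderiv ℝ P₁ (Φ w) X) = 0 →
      p₂ (fderiv ℝ P₂ (Φ w) X) = 0 → X = 0 := fun w hw X h0 h1 h2 => by
    refine (injective_iff_map_eq_zero _).1 (hΦd w hw).1 X ?_
    rw [hΨd _ (hmap hw), h0, h1, h2]; rfl
  have kill₁ : ∀ w ∈ Φ.source, ∀ v, v.2.1 = 0 → fderiv ℝ P₁ (Φ w) (fderiv ℝ Φ w v) = 0 ∧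
      fderiv ℝ Q₁ (Φ w) (fderiv ℝ Φ w v) = 0 := fun w hw v hv => by
    have hy := hmap hw
    obtain ⟨T, hT0, hT1, hT2⟩ := hT _ hy
    have hTP := H₁.fderiv_foot_gradient hy hT1
    have := apply_eq_zero_of_transversal (σ := (fderiv ℝ s (Φ w)).toLinearMap)
      (u₁ := (p₁.comp (fderiv ℝ P₁ (Φ w))).toLinearMap)
      (u₂ := (p₂.comp (fderiv ℝ P₂ (Φ w))).toLinearMap)
      (G := ((fderiv ℝ P₁ (Φ w)).prod (fderiv ℝ Q₁ (Φ w))).toLinearMap) (T := T)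
      (X := fderiv ℝ Φ w v) (hinjw w hw) hT0 ((congrArg p₁ hTP.1).trans (map_zero p₁))
      (Prod.ext hTP.1 hTP.2) (fun X hX => by
        obtain ⟨X₀, X₁, hX, h0, h1, h2, -⟩ := hsplit _ hy X hX
        have e0 := H₂.fderiv_foot_eq_zero_of_fderiv_eq_zero hy h0
        have e1 := H₁.fderiv_foot_eq_zero_of_fderiv_eq_zero hy h1
        exact ⟨X₀, X₁, hX, h2, (congrArg p₂ e0.1).trans (map_zero p₂),
          (congrArg p₁ e1.1).trans (map_zero p₁), Prod.ext e1.1 e1.2⟩)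
      ((hcoord w hw v).2.1.trans hv)
    exact ⟨congrArg Prod.fst this, congrArg Prod.snd this⟩
  have kill₂ : ∀ w ∈ Φ.source, ∀ v, v.2.2 = 0 → fderiv ℝ P₂ (Φ w) (fderiv ℝ Φ w v) = 0 ∧
      fderiv ℝ Q₂ (Φ w) (fderiv ℝ Φ w v) = 0 := fun w hw v hv => by
    have hy := hmap hw
    obtain ⟨T, hT0, hT1, hT2⟩ := hT _ hy
    have hTP := H₂.fderiv_foot_gradient hy hT2
    have := apply_eq_zero_of_transversal (σ := (fderiv ℝ s (Φ w)).toLinearMap)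
      (u₁ := (p₂.comp (fderiv ℝ P₂ (Φ w))).toLinearMap)
      (u₂ := (p₁.comp (fderiv ℝ P₁ (Φ w))).toLinearMap)
      (G := ((fderiv ℝ P₂ (Φ w)).prod (fderiv ℝ Q₂ (Φ w))).toLinearMap) (T := T)
      (X := fderiv ℝ Φ w v) (fun X h0 h1 h2 => hinjw w hw X h0 h2 h1) hT0
      ((congrArg p₂ hTP.1).trans (map_zero p₂))
      (Prod.ext hTP.1 hTP.2) (fun X hX => by
        obtain ⟨X₀, X₁, hX, h0, h1, -, h2⟩ := hsplit _ hy X hX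
        have e0 := H₂.fderiv_foot_eq_zero_of_fderiv_eq_zero hy h0
        have e1 := H₁.fderiv_foot_eq_zero_of_fderiv_eq_zero hy h1
        exact ⟨X₁, X₀, hX.trans (add_comm _ _), h2, (congrArg p₁ e1.1).trans (map_zero p₁),
          (congrArg p₂ e0.1).trans (map_zero p₂), Prod.ext e0.1 e0.2⟩)
      ((hcoord w hw v).2.2.trans hv)
    exact ⟨congrArg Prod.fst this, congrArg Prod.snd this⟩
  have killσ₁ : ∀ w ∈ Φ.source, ∀ v,
      fderiv ℝ σ₁ (Φ w) (fderiv ℝ Φ w v) = p (Φ w) * v.1 := fun w hw v => by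
    rw [hσ₁ _ (hmap hw), smul_apply, (hcoord w hw v).1, smul_eq_mul]
  have killσ₂ : ∀ w ∈ Φ.source, ∀ v,
      fderiv ℝ σ₂ (Φ w) (fderiv ℝ Φ w v) = q (Φ w) * v.1 := fun w hw v => by
    rw [hσ₂ _ (hmap hw), smul_apply, (hcoord w hw v).1, smul_eq_mul]
  -- The coordinate slices through y₀: a and b are σ₁ and σ₂ along the s-line, while h and g are the
  -- foot points along the two blocks at s = 0.
  let ι₀ : ℝ → ℝ × (EuclideanSpace ℝ (Fin d₁) × EuclideanSpace ℝ (Fin d₂)) :=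
    fun τ => (τ, (u₁, u₂))
  let ι₁ : EuclideanSpace ℝ (Fin d₁) →
      ℝ × (EuclideanSpace ℝ (Fin d₁) × EuclideanSpace ℝ (Fin d₂)) :=
    fun x => (0, (x, u₂))
  let ι₂ : EuclideanSpace ℝ (Fin d₂) →
      ℝ × (EuclideanSpace ℝ (Fin d₁) × EuclideanSpace ℝ (Fin d₂)) :=
    fun x => (0, (u₁, x))
  have hι₀ : MapsTo ι₀ (Ioo (-r) r) Φ.source := fun τ hτ => hB ▸ ⟨hτ, hu₁m, hu₂m⟩
  have hι₁ : MapsTo ι₁ (Metric.ball u₁ r) Φ.source := fun x hx => hB ▸ ⟨hr0, hx, hu₂m⟩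
  have hι₂ : MapsTo ι₂ (Metric.ball u₂ r) Φ.source := fun x hx => hB ▸ ⟨hr0, hu₁m, hx⟩
  have hι₀s : ContDiff ℝ ∞ ι₀ := contDiff_id.prodMk contDiff_const
  have hι₁s : ContDiff ℝ ∞ ι₁ := contDiff_const.prodMk (contDiff_id.prodMk contDiff_const)
  have hι₂s : ContDiff ℝ ∞ ι₂ := contDiff_const.prodMk (contDiff_const.prodMk contDiff_id)
  have hderiv : ∀ {u : E → ℝ}, ContDiffOn ℝ ∞ u Ω → ∀ τ ∈ Ioo (-r) r,
      deriv (fun τ => u (Φ (ι₀ τ))) τ = fderiv ℝ u (Φ (ι₀ τ)) (fderiv ℝ Φ (ι₀ τ) (1, 0)) :=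
    fun hu τ hτ => by
      have h1 : HasDerivAt ι₀ (1, 0) τ := (hasDerivAt_id τ).prodMk (hasDerivAt_const τ (u₁, u₂))
      exact ((hcomp hu (ι₀ τ) (hι₀ hτ)).comp_hasDerivAt τ h1).deriv
  have hda : ∀ τ ∈ Ioo (-r) r, deriv (fun τ => σ₁ (Φ (ι₀ τ))) τ = p (Φ (ι₀ τ)) := fun τ hτ => by
    rw [hderiv H₁.smooth_fun τ hτ, killσ₁ _ (hι₀ hτ), mul_one]
  have hdb : ∀ τ ∈ Ioo (-r) r, deriv (fun τ => σ₂ (Φ (ι₀ τ))) τ = q (Φ (ι₀ τ)) := fun τ hτ => by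
    rw [hderiv H₂.smooth_fun τ hτ, killσ₂ _ (hι₀ hτ), mul_one]
  have hΦι₀ : Φ (ι₀ 0) = y₀ := by rw [← hΦ₀, hΨ₀]
  refine ⟨Metric.ball u₁ r, Metric.ball u₂ r, fun x => P₁ (Φ (ι₁ x)), fun x => Q₁ (Φ (ι₁ x)),
    fun x => P₂ (Φ (ι₂ x)), fun x => Q₂ (Φ (ι₂ x)), r, fun τ => σ₁ (Φ (ι₀ τ)),
    fun τ => σ₂ (Φ (ι₀ τ)), Φ, Metric.isOpen_ball, Metric.isOpen_ball,
    H₁.isHypersurfaceWithNormalOn hΦsm hmap Metric.isOpen_ball hι₁s hι₁ p₁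
      (fun x hx => congrArg (fun v => v.2.1) (hΨΦ _ (hι₁ hx))),
    H₂.isHypersurfaceWithNormalOn hΦsm hmap Metric.isOpen_ball hι₂s hι₂ p₂
      (fun x hx => congrArg (fun v => v.2.2) (hΨΦ _ (hι₂ hx))),
    ⟨hr, H₁.smooth_fun.comp (hΦsm.comp hι₀s.contDiffOn hι₀) fun τ hτ => hmap (hι₀ hτ),
      H₂.smooth_fun.comp (hΦsm.comp hι₀s.contDiffOn hι₀) fun τ hτ => hmap (hι₀ hτ),
      by rw [hΦι₀, hσ₁₀], by rw [hΦι₀, hσ₂₀], fun τ hτ => ?_, fun τ hτ => ?_, fun τ hτ => ?_⟩,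
    hB, hy₀Φ, hΦΩ, hΦsm, hΦsm', fun z hz => ?_⟩
  · rw [hda τ hτ]; exact hp _ (hmap (hι₀ hτ))
  · rw [hdb τ hτ]; exact hq _ (hmap (hι₀ hτ))
  · rw [hda τ hτ, hdb τ hτ]; exact hpq _ (hmap (hι₀ hτ))
  · have hzB : z ∈ Φ.source := hB ▸ hz
    have h0 := hι₀ hz.1
    have h1 := hι₁ hz.2.1
    have h2 := hι₂ hz.2.2
    -- Each of the six quantities is moved to its own slice along a segment on which its coordinate
    -- block is fixed.
    have eσ₁ : σ₁ (Φ z) = σ₁ (Φ (ι₀ z.1)) := hconst H₁.smooth_fun z hzB _ h0 fun w hw => by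
      rw [killσ₁ w hw]; simp [ι₀]
    have eσ₂ : σ₂ (Φ z) = σ₂ (Φ (ι₀ z.1)) := hconst H₂.smooth_fun z hzB _ h0 fun w hw => by
      rw [killσ₂ w hw]; simp [ι₀]
    have eP₁ : P₁ (Φ z) = P₁ (Φ (ι₁ z.2.1)) := hconst H₁.contDiffOn_footPoint z hzB _ h1
      fun w hw => (kill₁ w hw _ (by simp [ι₁])).1
    have eQ₁ : Q₁ (Φ z) = Q₁ (Φ (ι₁ z.2.1)) := hconst H₁.contDiffOn_footNormal z hzB _ h1
      fun w hw => (kill₁ w hw _ (by simp [ι₁])).2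
    have eP₂ : P₂ (Φ z) = P₂ (Φ (ι₂ z.2.2)) := hconst H₂.contDiffOn_footPoint z hzB _ h2
      fun w hw => (kill₂ w hw _ (by simp [ι₂])).1
    have eQ₂ : Q₂ (Φ z) = Q₂ (Φ (ι₂ z.2.2)) := hconst H₂.contDiffOn_footNormal z hzB _ h2
      fun w hw => (kill₂ w hw _ (by simp [ι₂])).2
    have e₁ := eq_geodesicPoint_foot f₁ n₁ σ₁ (Φ z)
    have e₂ := eq_geodesicPoint_foot f₂ n₂ σ₂ (Φ z)
    rw [← hP₁, ← hQ₁, eσ₁, eP₁, eQ₁] at e₁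
    rw [← hP₂, ← hQ₂, eσ₂, eP₂, eQ₂] at e₂
    exact Prod.ext e₁.symm e₂.symm

end Box

/-! ### Hypersurfaces in class `𝒜` with nowhere vanishing `ξ` -/

namespace IsHypersurfaceOn

variable {c₁ c₂ : ℝ} {k l : ℕ} {E : Type*} [NormedAddCommGroup E] [NormedSpace ℝ E]
  {Ω : Set E} {f N : E → FlatSpace c₁ k × FlatSpace c₂ l}

theorem contDiffOn_angle (h : IsHypersurfaceOn c₁ c₂ Ω f N) :
    ContDiffOn ℝ ∞ (fun z => flatForm c₂ (N z).2 (N z).2) Ω :=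
  contDiffOn_flatForm (contDiff_snd.comp_contDiffOn h.smooth_normal)
    (contDiff_snd.comp_contDiffOn h.smooth_normal)

theorem isNondegenerateAt_fst [FiniteDimensional ℝ E] (h : IsHypersurfaceOn c₁ c₂ Ω f N) {y : E}
    (hy : y ∈ Ω) (ht : flatForm c₂ (N y).2 (N y).2 ≠ 0) :
    IsNondegenerateAt c₁ (fun z => (f z).1) y := fun w hw hwf =>
  (h.hyperplane y hy).eq_zero_of_flatForm_fst ht (fun X => by rw [← hw X, h.fderiv_fst hy]; rfl) hwf

theorem isNondegenerateAt_snd [FiniteDimensional ℝ E] (h : IsHypersurfaceOn c₁ c₂ Ω f N) {y : E}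
    (hy : y ∈ Ω) (ht : flatForm c₂ (N y).2 (N y).2 ≠ 1) :
    IsNondegenerateAt c₂ (fun z => (f z).2) y := fun w hw hwf =>
  (h.hyperplane y hy).eq_zero_of_flatForm_snd ht (fun X => by rw [← hw X, h.fderiv_snd hy]; rfl) hwf

/-- The gradient of the angle function is a multiple of `ξ`. -/
theorem exists_fderiv_angle_eq_smul [FiniteDimensional ℝ E] (h : IsHypersurfaceOn c₁ c₂ Ω f N)
    {y : E} (hy : y ∈ Ω)
    (hsymm : ∀ X Y, flatForm c₂ (fderiv ℝ N y X).2 (fderiv ℝ f y Y).2 =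
      flatForm c₂ (fderiv ℝ N y Y).2 (fderiv ℝ f y X).2)
    (ht : flatForm c₂ (N y).2 (N y).2 ∈ Ioo (0 : ℝ) 1) :
    ∃ r : ℝ, fderiv ℝ (fun z => flatForm c₂ (N z).2 (N z).2) y =
      r • pullForm c₂ (fun z => (N z).2) (fun z => (f z).2) y := by
  have hmem := h.isOpen.mem_nhds hy
  have H := h.hyperplane y hy
  have hsymm₁ : ∀ X Y, flatForm c₁ (fderiv ℝ N y X).1 (fderiv ℝ f y Y).1 =
      flatForm c₁ (fderiv ℝ N y Y).1 (fderiv ℝ f y X).1 := fun X Y => by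
    have := h.prodForm_fderiv_symm hy X Y
    rw [prodForm, prodForm] at this
    linarith [hsymm X Y]
  have hβ : ∀ X, pullForm c₂ (fun z => (N z).2) (fun z => (f z).2) y X =
      flatForm c₂ (N y).2 (fderiv ℝ f y X).2 := fun X => by
    rw [pullForm_apply, h.fderiv_snd hy]
  obtain ⟨D₁, hD₁, hDX₁⟩ := hasFDerivAt_flatForm (h.hasFDerivAt_normal hy).fst
    (h.hasFDerivAt_normal hy).fst
  obtain ⟨D₂, hD₂, hDX₂⟩ := hasFDerivAt_flatForm (h.hasFDerivAt_normal hy).snd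
    (h.hasFDerivAt_normal hy).snd
  -- From |N₁|² + |N₂|² = 1, the derivative of t can be computed in either factor: X₀ is handled in
  -- the second, X₁ in the first.
  have hD : D₂ = -D₁ := by
    refine hD₂.unique ((hD₁.const_sub 1).congr_of_eventuallyEq ?_)
    filter_upwards [hmem] with z hz
    linarith [(h.hyperplane z hz).flatForm_fst_self]
  have hker : ∀ X, flatForm c₂ (N y).2 (fderiv ℝ f y X).2 = 0 → D₂ X = 0 := fun X hX => by
    obtain ⟨X₀, X₁, rfl, h0, h1⟩ := H.exists_split hX
    have e0 : (fderiv ℝ N y X₀).2 = 0 := by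
      rw [← h.fderiv_normal_snd hy]
      refine (h.isNondegenerateAt_snd hy ht.2.ne).fderiv_eq_zero
        (h.hasFDerivAt hy).snd.differentiableAt (h.hasFDerivAt_normal hy).snd.differentiableAt
        (fun hc => ?_) (fun X Y => ?_) ((h.fderiv_snd hy _).trans h0)
      · filter_upwards [hmem] with z hz using (h.hyperplane z hz).normal_mem.2 hc
      · simp only [h.fderiv_snd hy, h.fderiv_normal_snd hy, hsymm X Y]
    have e1 : (fderiv ℝ N y X₁).1 = 0 := by
      rw [← h.fderiv_normal_fst hy]
      refine (h.isNondegenerateAt_fst hy ht.1.ne').fderiv_eq_zero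
        (h.hasFDerivAt hy).fst.differentiableAt (h.hasFDerivAt_normal hy).fst.differentiableAt
        (fun hc => ?_) (fun X Y => ?_) ((h.fderiv_fst hy _).trans h1)
      · filter_upwards [hmem] with z hz using (h.hyperplane z hz).normal_mem.1 hc
      · simp only [h.fderiv_fst hy, h.fderiv_normal_fst hy, hsymm₁ X Y]
    have d0 : D₂ X₀ = 0 := by
      rw [hDX₂]
      change flatForm c₂ (fderiv ℝ N y X₀).2 (N y).2 + flatForm c₂ (N y).2 (fderiv ℝ N y X₀).2 = 0
      rw [e0, flatForm_zero_left, flatForm_zero_right, add_zero]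
    have d1 : D₁ X₁ = 0 := by
      rw [hDX₁]
      change flatForm c₁ (fderiv ℝ N y X₁).1 (N y).1 + flatForm c₁ (N y).1 (fderiv ℝ N y X₁).1 = 0
      rw [e1, flatForm_zero_left, flatForm_zero_right, add_zero]
    rw [map_add, d0, hD, neg_apply, d1, neg_zero, add_zero]
  obtain ⟨ξ, -, hξ, -⟩ := H.exists_gradient
  -- β(ξ) = t (1 - t) is nonzero, so subtracting a multiple of ξ brings any vector into ker β.
  have hβξ : flatForm c₂ (N y).2 (fderiv ℝ f y ξ).2 ≠ 0 := by
    change flatForm c₂ (N y).2 ((fderiv ℝ f y).toLinearMap ξ).2 ≠ 0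
    rw [hξ, flatForm_smul_right]
    exact mul_ne_zero (sub_ne_zero.2 ht.2.ne') ht.1.ne'
  refine ⟨D₂ ξ / flatForm c₂ (N y).2 (fderiv ℝ f y ξ).2, ?_⟩
  rw [hD₂.fderiv]
  ext X
  rw [smul_apply, hβ, smul_eq_mul]
  have := hker (X - (flatForm c₂ (N y).2 (fderiv ℝ f y X).2 /
    flatForm c₂ (N y).2 (fderiv ℝ f y ξ).2) • ξ) (by
      rw [map_sub, map_smul, Prod.snd_sub, Prod.smul_snd, flatForm_sub_right, flatForm_smul_right,
        div_mul_cancel₀ _ hβξ, sub_self])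
  rw [map_sub, map_smul, smul_eq_mul, sub_eq_zero] at this
  rw [this]
  ring

/-- Since dt is a multiple of the closed form β, functions of t are integrating factors. Suitable
ones normalise both factors to gradients of length one and provide the common parameter s. -/
theorem exists_cylinder [FiniteDimensional ℝ E] (h : IsHypersurfaceOn c₁ c₂ Ω f N)
    (hsymm : ∀ y ∈ Ω, ∀ X Y, flatForm c₂ (fderiv ℝ N y X).2 (fderiv ℝ f y Y).2 =
      flatForm c₂ (fderiv ℝ N y Y).2 (fderiv ℝ f y X).2)
    {d₁ d₂ : ℕ} (hk : k = d₁ + 1) (hl : l = d₂ + 1) {y₀ : E} (hy₀ : y₀ ∈ Ω)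
    (ht₀ : flatForm c₂ (N y₀).2 (N y₀).2 ∈ Ioo (0 : ℝ) 1) :
    ∃ (O₁ : Set (EuclideanSpace ℝ (Fin d₁))) (O₂ : Set (EuclideanSpace ℝ (Fin d₂)))
      (h Nh : EuclideanSpace ℝ (Fin d₁) → FlatSpace c₁ k)
      (g Ng : EuclideanSpace ℝ (Fin d₂) → FlatSpace c₂ l)
      (δ : ℝ) (a b : ℝ → ℝ)
      (Φ : OpenPartialHomeomorph
        (ℝ × (EuclideanSpace ℝ (Fin d₁) × EuclideanSpace ℝ (Fin d₂))) E),
      IsOpen O₁ ∧ IsOpen O₂ ∧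
      IsHypersurfaceWithNormalOn (𝓡 d₁) c₁ O₁ h Nh ∧
      IsHypersurfaceWithNormalOn (𝓡 d₂) c₂ O₂ g Ng ∧
      IsAdmissiblePair δ a b ∧
      Φ.source = Set.Ioo (-δ) δ ×ˢ (O₁ ×ˢ O₂) ∧ y₀ ∈ Φ.target ∧ Φ.target ⊆ Ω ∧
      ContDiffOn ℝ ∞ Φ Φ.source ∧ ContDiffOn ℝ ∞ Φ.symm Φ.target ∧
      ∀ z ∈ Set.Ioo (-δ) δ ×ˢ (O₁ ×ˢ O₂), f (Φ z) = cylinderMap c₁ c₂ h Nh g Ng a b z := by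
  set t : E → ℝ := fun z => flatForm c₂ (N z).2 (N z).2 with htdef
  obtain ⟨ρ, hρ, hball⟩ := Metric.isOpen_iff.1
    (h.contDiffOn_angle.continuousOn.isOpen_inter_preimage h.isOpen isOpen_Ioo) y₀ ⟨hy₀, ht₀⟩
  set B := Metric.ball y₀ ρ with hBdef
  have hBo : IsOpen B := Metric.isOpen_ball
  have hBΩ : B ⊆ Ω := fun y hy => (hball hy).1
  have hy₀B : y₀ ∈ B := Metric.mem_ball_self hρ
  have ht : ∀ y ∈ B, t y ∈ Ioo (0 : ℝ) 1 := fun y hy => (hball hy).2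
  have hB := h.mono hBo hBΩ
  have hf₁ : ContDiffOn ℝ ∞ (fun z => (f z).1) B := contDiff_fst.comp_contDiffOn hB.smooth
  have hf₂ : ContDiffOn ℝ ∞ (fun z => (f z).2) B := contDiff_snd.comp_contDiffOn hB.smooth
  have hN₁ : ContDiffOn ℝ ∞ (fun z => (N z).1) B := contDiff_fst.comp_contDiffOn hB.smooth_normal
  have hN₂ : ContDiffOn ℝ ∞ (fun z => (N z).2) B := contDiff_snd.comp_contDiffOn hB.smooth_normal
  have htsm : ContDiffOn ℝ ∞ t B := hB.contDiffOn_angle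
  set β : E → E →L[ℝ] ℝ := pullForm c₂ (fun z => (N z).2) (fun z => (f z).2) with hβdef
  have hβX : ∀ y ∈ B, ∀ X, β y X = flatForm c₂ (N y).2 (fderiv ℝ f y X).2 := fun y hy X => by
    rw [hβdef, pullForm_apply, hB.fderiv_snd hy]
  have hβsm : ContDiffOn ℝ ∞ β B := contDiffOn_pullForm hBo hN₂ hf₂
  have hβc : ∀ y ∈ B, ∀ X Y, fderiv ℝ β y X Y = fderiv ℝ β y Y X := fun y hy X Y => by
    refine (pullForm_closed_iff (hB.hasFDerivAt_normal hy).snd.differentiableAt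
      (hB.contDiffAt hy).snd X Y).2 ?_
    simp only [hB.fderiv_snd hy, hB.fderiv_normal_snd hy, hsymm y (hBΩ hy) X Y]
  have prim : ∀ ψ : ℝ → ℝ, ContDiffOn ℝ ∞ ψ (Ioo 0 1) → ∃ u : E → ℝ, ContDiffOn ℝ ∞ u B ∧
      u y₀ = 0 ∧ ∀ y ∈ B, HasFDerivAt u (ψ (t y) • β y) y := fun ψ hψ => by
    refine exists_primitive_smul (φ := fun y => ψ (t y)) hBo (convex_ball _ _) hβsm hβc
      (hψ.comp htsm ht) fun y hy => ?_
    obtain ⟨r, hr⟩ := hB.exists_fderiv_angle_eq_smul hy (hsymm y (hBΩ hy)) (ht y hy)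
    have h1 := ((hψ.contDiffAt (isOpen_Ioo.mem_nhds (ht y hy))).differentiableAt
      (by simp)).hasDerivAt
    have h2 := ((htsm.contDiffAt (hBo.mem_nhds hy)).differentiableAt (by simp)).hasFDerivAt
    have h3 : HasFDerivAt (fun y => ψ (t y)) _ y := h1.comp_hasFDerivAt y h2
    exact ⟨deriv ψ (t y) * r, by rw [h3.fderiv, hr, smul_smul]⟩
  have hψ₂ : ContDiffOn ℝ ∞ (fun τ : ℝ => (√τ)⁻¹) (Ioo 0 1) :=
    (contDiffOn_id.sqrt fun τ hτ => hτ.1.ne').inv fun τ hτ => (Real.sqrt_pos.2 hτ.1).ne'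
  have hψ₁ : ContDiffOn ℝ ∞ (fun τ : ℝ => (√(1 - τ))⁻¹) (Ioo 0 1) :=
    ((contDiffOn_const.sub contDiffOn_id).sqrt fun τ hτ => (sub_pos.2 hτ.2).ne').inv
      fun τ hτ => (Real.sqrt_pos.2 (sub_pos.2 hτ.2)).ne'
  -- The factors 1/√(1 - t) and 1/√t normalise N₁ and N₂. Their product gives dσ₁ = √t ds and dσ₂ =
  -- √(1 - t) ds, with squared rates adding up to 1.
  obtain ⟨s, hs, hs₀, hsd⟩ := prim _ (hψ₂.mul hψ₁)
  obtain ⟨σ₁, hσ₁, hσ₁₀, hσ₁d⟩ := prim _ hψ₁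
  obtain ⟨σ₂, hσ₂, hσ₂₀, hσ₂d⟩ := prim _ hψ₂
  have hP : ∀ y ∈ B, 0 < √(t y) := fun y hy => Real.sqrt_pos.2 (ht y hy).1
  have hQ : ∀ y ∈ B, 0 < √(1 - t y) := fun y hy => Real.sqrt_pos.2 (sub_pos.2 (ht y hy).2)
  have hP2 : ∀ y ∈ B, √(t y) ^ 2 = t y := fun y hy => Real.sq_sqrt (ht y hy).1.le
  have hQ2 : ∀ y ∈ B, √(1 - t y) ^ 2 = 1 - t y := fun y hy =>
    Real.sq_sqrt (sub_pos.2 (ht y hy).2).le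
  have hsX : ∀ y ∈ B, ∀ X, fderiv ℝ s y X = (√(t y))⁻¹ * (√(1 - t y))⁻¹ * β y X :=
    fun y hy X => by rw [(hsd y hy).fderiv]; rfl
  -- The minus sign compensates ⟨N₁, df₁⟩ = -β, so that both σᵢ increase with s.
  have H₁ : IsGradientFactor c₁ B (fun z => (f z).1) (fun z => -(√(1 - t z))⁻¹ • (N z).1) σ₁ := by
    refine ⟨hBo, ⟨fun y hy => (hB.hyperplane y hy).mem.1,
      fun y hy => smul_mem_spaceFormTangent _ (hB.hyperplane y hy).normal_mem.1, fun y hy => ?_⟩,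
      hf₁, (hψ₁.comp htsm ht).neg.smul hN₁, hσ₁, fun y hy X => ?_,
      fun y hy => hB.isNondegenerateAt_fst hy (ht y hy).1.ne'⟩
    · rw [flatForm_smul_left, flatForm_smul_right, (hB.hyperplane y hy).flatForm_fst_self]
      change -(√(1 - t y))⁻¹ * (-(√(1 - t y))⁻¹ * (1 - t y)) = 1
      have := hQ y hy
      have := hQ2 y hy
      field_simp
      linarith
    · rw [(hσ₁d y hy).fderiv, flatForm_smul_left, hB.fderiv_fst hy, smul_apply, hβX y hy,
        smul_eq_mul]
      have := (hB.hyperplane y hy).flatForm_fst_add_snd X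
      change flatForm c₁ (N y).1 (fderiv ℝ f y X).1 =
        -flatForm c₂ (N y).2 (fderiv ℝ f y X).2 at this
      rw [this]
      ring
  have H₂ : IsGradientFactor c₂ B (fun z => (f z).2) (fun z => (√(t z))⁻¹ • (N z).2) σ₂ := by
    refine ⟨hBo, ⟨fun y hy => (hB.hyperplane y hy).mem.2,
      fun y hy => smul_mem_spaceFormTangent _ (hB.hyperplane y hy).normal_mem.2, fun y hy => ?_⟩,
      hf₂, (hψ₂.comp htsm ht).smul hN₂, hσ₂, fun y hy X => ?_,
      fun y hy => hB.isNondegenerateAt_snd hy (ht y hy).2.ne⟩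
    · rw [flatForm_smul_left, flatForm_smul_right]
      change (√(t y))⁻¹ * ((√(t y))⁻¹ * t y) = 1
      have := hP y hy
      have := hP2 y hy
      field_simp
      linarith
    · rw [(hσ₂d y hy).fderiv, flatForm_smul_left, hB.fderiv_snd hy, smul_apply, hβX y hy,
        smul_eq_mul]
  have hlt : ∀ y ∈ B, √(t y) < 1 ∧ √(1 - t y) < 1 := fun y hy => by
    have := ht y hy
    constructor
    · rw [Real.sqrt_lt' one_pos]; linarith [this.2]
    · rw [Real.sqrt_lt' one_pos]; linarith [this.1]
  obtain ⟨O₁, O₂, h', Nh, g, Ng, δ, a, b, Φ, hO₁, hO₂, hh, hg, hab, hsrc, hmem, htgt, hsm, hsm',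
    heq⟩ := exists_cylinder_coordinates (s := s) (p := fun y => √(t y)) (q := fun y => √(1 - t y))
      hk hl (by
        have := (h.hyperplane y₀ hy₀).finrank_add_one
        omega) H₁ H₂ hs (fun y hy => ⟨hP y hy, (hlt y hy).1⟩) (fun y hy => ⟨hQ y hy, (hlt y hy).2⟩)
      (fun y hy => by rw [hP2 y hy, hQ2 y hy]; ring)
      (fun y hy => by
        rw [(hσ₁d y hy).fderiv, (hsd y hy).fderiv, smul_smul]
        congr 1
        have := hP y hy
        field_simp)
      (fun y hy => by
        rw [(hσ₂d y hy).fderiv, (hsd y hy).fderiv, smul_smul]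
        congr 1
        have := hQ y hy
        field_simp)
      (fun y hy => by
        obtain ⟨ξ, hξ₁, hξ₂, -⟩ := (hB.hyperplane y hy).exists_gradient
        change (fderiv ℝ f y ξ).1 = -t y • (N y).1 at hξ₁
        change (fderiv ℝ f y ξ).2 = (1 - t y) • (N y).2 at hξ₂
        have hP' := hP y hy
        have hQ' := hQ y hy
        have hP2' := hP2 y hy
        have hQ2' := hQ2 y hy
        -- The normalised ξ: its image under df₁ is -t N₁ / √(t (1 - t)) = √t n₁, that under df₂ is
        -- √(1 - t) n₂, and ds takes the value 1 because β(ξ) = t (1 - t).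
        refine ⟨((√(t y))⁻¹ * (√(1 - t y))⁻¹) • ξ, ?_, ?_, ?_⟩
        · rw [map_smul, hsX y hy, hβX y hy, hξ₂, flatForm_smul_right, smul_eq_mul]
          change _ * (_ * ((1 - t y) * t y)) = 1
          field_simp
          linear_combination (-√(1 - t y) ^ 2) * hP2' - t y * hQ2'
        · rw [map_smul, hB.fderiv_fst hy, hξ₁, smul_smul, smul_smul]
          congr 1
          nth_rewrite 3 [← hP2']
          field_simp
        · rw [map_smul, hB.fderiv_snd hy, hξ₂, smul_smul, smul_smul]
          congr 1
          nth_rewrite 2 [← hQ2']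
          field_simp)
      (fun y hy X hX => by
        have hy' := hP y hy
        have hy'' := hQ y hy
        have hβ0 : flatForm c₂ (N y).2 (fderiv ℝ f y X).2 = 0 := by
          rw [hsX y hy, hβX y hy] at hX
          exact (mul_eq_zero.1 hX).resolve_left (by positivity)
        obtain ⟨X₀, X₁, hXX, h0, h1⟩ := (hB.hyperplane y hy).exists_split hβ0
        have hb0 : β y X₀ = 0 := by
          rw [hβX y hy]
          exact (congrArg _ h0).trans (flatForm_zero_right _)
        have hb1 : β y X₁ = 0 := by
          have := (hB.hyperplane y hy).flatForm_fst_add_snd X₁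
          rw [h1, flatForm_zero_right] at this
          rw [hβX y hy]
          exact neg_eq_zero.1 this.symm
        exact ⟨X₀, X₁, hXX, (hB.fderiv_snd hy _).trans h0, (hB.fderiv_fst hy _).trans h1,
          by rw [hsX y hy, hb0, mul_zero], by rw [hsX y hy, hb1, mul_zero]⟩)
      (fun y hy X h1 h2 => by
        rw [hB.fderiv_fst hy] at h1
        rw [hB.fderiv_snd hy] at h2
        exact (injective_iff_map_eq_zero _).1 (hB.hyperplane y hy).inj X (Prod.ext h1 h2))
      hy₀B hs₀ hσ₁₀ hσ₂₀
  exact ⟨O₁, O₂, h', Nh, g, Ng, δ, a, b, Φ, hO₁, hO₂, hh, hg, hab, hsrc, hmem, htgt.trans hBΩ, hsm,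
    hsm', heq⟩

end IsHypersurfaceOn

/-! ### Hypersurfaces with vanishing `ξ` split -/

section Split

variable {c₁ c₂ : ℝ} {k l d₁ d₂ : ℕ} {E : Type*} [NormedAddCommGroup E] [NormedSpace ℝ E]
  [FiniteDimensional ℝ E] {Ω : Set E}

theorem isImmersionOn_of_section {c : ℝ} {m d : ℕ} {O : Set (EuclideanSpace ℝ (Fin d))}
    (hO : IsOpen O) {F : EuclideanSpace ℝ (Fin d) → FlatSpace c m} (hF : ContDiffOn ℝ ∞ F O)
    (hmem : MapsTo F O (spaceForm c m)) (pr : FlatSpace c m →L[ℝ] EuclideanSpace ℝ (Fin d))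
    (hpr : ∀ x ∈ O, pr (F x) = x) : IsImmersionOn (𝓡 d) (spaceForm c m) O F := by
  refine ⟨hF.contMDiffOn, hmem, fun x hx => ?_⟩
  rw [pushforward, mfderiv_eq_fderiv]
  have h1 := pr.hasFDerivAt.comp x
    ((hF.contDiffAt (hO.mem_nhds hx)).differentiableAt (by simp)).hasFDerivAt
  have h2 : HasFDerivAt (pr ∘ F) (ContinuousLinearMap.id ℝ _) x :=
    (hasFDerivAt_id x).congr_of_eventuallyEq (Filter.eventuallyEq_of_mem (hO.mem_nhds hx) hpr)
  refine Function.LeftInverse.injective (g := pr) fun X => ?_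
  exact congrArg (fun L : EuclideanSpace ℝ (Fin d) →L[ℝ] EuclideanSpace ℝ (Fin d) => L X)
    (h1.unique h2)

/-- Linear coordinates of f₁ and f₂ together are local coordinates of the hypersurface. A vector
with zero i-th block lies in ker dfᵢ by the splitting, so each fᵢ depends on its own block only. -/
theorem exists_split_coordinates {f₁ : E → FlatSpace c₁ k} {f₂ : E → FlatSpace c₂ l}
    (hΩ : IsOpen Ω) (hdim : Module.finrank ℝ E = d₁ + d₂)
    (hf₁ : ContDiffOn ℝ ∞ f₁ Ω) (hf₂ : ContDiffOn ℝ ∞ f₂ Ω)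
    (hm₁ : MapsTo f₁ Ω (spaceForm c₁ k)) (hm₂ : MapsTo f₂ Ω (spaceForm c₂ l))
    (hsplit : ∀ y ∈ Ω, ∀ X, ∃ X₀ X₁, X = X₀ + X₁ ∧
      fderiv ℝ f₂ y X₀ = 0 ∧ fderiv ℝ f₁ y X₁ = 0)
    (p₁ : FlatSpace c₁ k →L[ℝ] EuclideanSpace ℝ (Fin d₁))
    (p₂ : FlatSpace c₂ l →L[ℝ] EuclideanSpace ℝ (Fin d₂)) {y₀ : E} (hy₀ : y₀ ∈ Ω)
    (hinj : ∀ X, p₁ (fderiv ℝ f₁ y₀ X) = 0 → p₂ (fderiv ℝ f₂ y₀ X) = 0 → X = 0) :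
    ∃ (O₁ : Set (EuclideanSpace ℝ (Fin d₁))) (O₂ : Set (EuclideanSpace ℝ (Fin d₂)))
      (F₁ : EuclideanSpace ℝ (Fin d₁) → FlatSpace c₁ k)
      (F₂ : EuclideanSpace ℝ (Fin d₂) → FlatSpace c₂ l)
      (Φ : OpenPartialHomeomorph (EuclideanSpace ℝ (Fin d₁) × EuclideanSpace ℝ (Fin d₂)) E),
      IsOpen O₁ ∧ IsOpen O₂ ∧
      IsImmersionOn (𝓡 d₁) (spaceForm c₁ k) O₁ F₁ ∧ InjOn F₁ O₁ ∧
      IsImmersionOn (𝓡 d₂) (spaceForm c₂ l) O₂ F₂ ∧ InjOn F₂ O₂ ∧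
      Φ.source = O₁ ×ˢ O₂ ∧ y₀ ∈ Φ.target ∧ Φ.target ⊆ Ω ∧
      ContDiffOn ℝ ∞ Φ Φ.source ∧ ContDiffOn ℝ ∞ Φ.symm Φ.target ∧
      ∀ z ∈ O₁ ×ˢ O₂, (f₁ (Φ z), f₂ (Φ z)) = (F₁ z.1, F₂ z.2) := by
  let Ψ : E → EuclideanSpace ℝ (Fin d₁) × EuclideanSpace ℝ (Fin d₂) :=
    fun y => (p₁ (f₁ y), p₂ (f₂ y))
  have hΨ : ContDiffOn ℝ ∞ Ψ Ω :=
    (p₁.contDiff.comp_contDiffOn hf₁).prodMk (p₂.contDiff.comp_contDiffOn hf₂)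
  have hder : ∀ {V : Type} [NormedAddCommGroup V] [NormedSpace ℝ V] {u : E → V},
      ContDiffOn ℝ ∞ u Ω → ∀ y ∈ Ω, HasFDerivAt u (fderiv ℝ u y) y := fun hu y hy =>
    ((hu.contDiffAt (hΩ.mem_nhds hy)).differentiableAt (by simp)).hasFDerivAt
  have hΨd : ∀ y ∈ Ω, ∀ X, fderiv ℝ Ψ y X =
      (p₁ (fderiv ℝ f₁ y X), p₂ (fderiv ℝ f₂ y X)) := fun y hy X => by
    have : HasFDerivAt Ψ _ y := (p₁.hasFDerivAt.comp y (hder hf₁ y hy)).prodMk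
      (p₂.hasFDerivAt.comp y (hder hf₂ y hy))
    rw [this.fderiv]; rfl
  have hinj₀ : Function.Injective (fderiv ℝ Ψ y₀) := by
    rw [injective_iff_map_eq_zero]
    intro X hX
    rw [hΨd y₀ hy₀] at hX
    exact hinj X (congrArg Prod.fst hX) (congrArg Prod.snd hX)
  obtain ⟨r, hr, Φ, hΦs, hy₀Φ, hΦΩ, hΦsm, hΦsm', hΦΨ, hΦ₀, hΦd⟩ :=
    exists_local_inverse_on_ball (by simp [hdim, Module.finrank_prod]) hΩ hΨ hy₀ hinj₀
  set u₁ := p₁ (f₁ y₀) with hu₁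
  set u₂ := p₂ (f₂ y₀) with hu₂
  have hB : Φ.source = Metric.ball u₁ r ×ˢ Metric.ball u₂ r := by rw [hΦs, ball_prod_same]
  have hBopen := Φ.open_source
  have hBconv : Convex ℝ Φ.source := hΦs ▸ convex_ball _ _
  have hmap : MapsTo Φ Φ.source Ω := fun z hz => hΦΩ (Φ.map_source hz)
  have hΨΦ : ∀ z ∈ Φ.source, Ψ (Φ z) = z := fun z hz => by
    rw [← hΦΨ _ (Φ.map_source hz), Φ.left_inv hz]
  have dΦ : ∀ z ∈ Φ.source, HasFDerivAt Φ (fderiv ℝ Φ z) z := fun z hz =>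
    ((hΦsm.contDiffAt (hBopen.mem_nhds hz)).differentiableAt (by simp)).hasFDerivAt
  have hconst : ∀ {V : Type} [NormedAddCommGroup V] [NormedSpace ℝ V] {u : E → V},
      ContDiffOn ℝ ∞ u Ω → ∀ z ∈ Φ.source, ∀ z' ∈ Φ.source,
      (∀ w ∈ Φ.source, fderiv ℝ u (Φ w) (fderiv ℝ Φ w (z' - z)) = 0) → u (Φ z) = u (Φ z') :=
    fun {V} _ _ {u} hu z hz z' hz' h => by
      have hcomp : ∀ w ∈ Φ.source,
          HasFDerivAt (fun z => u (Φ z)) ((fderiv ℝ u (Φ w)).comp (fderiv ℝ Φ w)) w :=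
        fun w hw => (hder hu (Φ w) (hmap hw)).comp w (dΦ w hw)
      refine eq_of_fderiv_apply_eq_zero (G := fun z => u (Φ z)) hBopen hBconv
        (fun w hw => (hcomp w hw).differentiableAt.differentiableWithinAt) hz hz' fun w hw => ?_
      rw [(hcomp w hw).fderiv]; exact h w hw
  have hcoord : ∀ w ∈ Φ.source, ∀ v,
      p₁ (fderiv ℝ f₁ (Φ w) (fderiv ℝ Φ w v)) = v.1 ∧
      p₂ (fderiv ℝ f₂ (Φ w) (fderiv ℝ Φ w v)) = v.2 := fun w hw v => by
    have := (hΦd w hw).2 v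
    rw [hΨd _ (hmap hw)] at this
    exact ⟨congrArg Prod.fst this, congrArg Prod.snd this⟩
  have hinjw : ∀ w ∈ Φ.source, ∀ X, p₁ (fderiv ℝ f₁ (Φ w) X) = 0 →
      p₂ (fderiv ℝ f₂ (Φ w) X) = 0 → X = 0 := fun w hw X h1 h2 => by
    refine (injective_iff_map_eq_zero _).1 (hΦd w hw).1 X ?_
    rw [hΨd _ (hmap hw), h1, h2]; rfl
  have kill₁ : ∀ w ∈ Φ.source, ∀ v, v.1 = 0 → fderiv ℝ f₁ (Φ w) (fderiv ℝ Φ w v) = 0 :=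
    fun w hw v hv => by
      obtain ⟨X₀, X₁, hX, h0, h1⟩ := hsplit _ (hmap hw) (fderiv ℝ Φ w v)
      have e := (hcoord w hw v).1
      rw [hX, map_add, h1, add_zero, hv] at e
      rw [hX, map_add, h1, hinjw w hw X₀ e (by rw [h0, map_zero]), map_zero, add_zero]
  have kill₂ : ∀ w ∈ Φ.source, ∀ v, v.2 = 0 → fderiv ℝ f₂ (Φ w) (fderiv ℝ Φ w v) = 0 :=
    fun w hw v hv => by
      obtain ⟨X₀, X₁, hX, h0, h1⟩ := hsplit _ (hmap hw) (fderiv ℝ Φ w v)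
      have e := (hcoord w hw v).2
      rw [hX, map_add, h0, zero_add, hv] at e
      rw [hX, map_add, h0, hinjw w hw X₁ (by rw [h1, map_zero]) e, map_zero, add_zero]
  have hι₁ : MapsTo (fun x => (x, u₂)) (Metric.ball u₁ r) Φ.source := fun x hx =>
    hB ▸ ⟨hx, Metric.mem_ball_self hr⟩
  have hι₂ : MapsTo (fun x => (u₁, x)) (Metric.ball u₂ r) Φ.source := fun x hx =>
    hB ▸ ⟨Metric.mem_ball_self hr, hx⟩
  have hpr₁ : ∀ x ∈ Metric.ball u₁ r, p₁ (f₁ (Φ (x, u₂))) = x := fun x hx =>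
    congrArg Prod.fst (hΨΦ _ (hι₁ hx))
  have hpr₂ : ∀ x ∈ Metric.ball u₂ r, p₂ (f₂ (Φ (u₁, x))) = x := fun x hx =>
    congrArg Prod.snd (hΨΦ _ (hι₂ hx))
  refine ⟨Metric.ball u₁ r, Metric.ball u₂ r, fun x => f₁ (Φ (x, u₂)), fun x => f₂ (Φ (u₁, x)), Φ,
    Metric.isOpen_ball, Metric.isOpen_ball,
    isImmersionOn_of_section Metric.isOpen_ball (hf₁.comp (hΦsm.comp
      (contDiff_id.prodMk contDiff_const).contDiffOn hι₁) fun x hx => hmap (hι₁ hx))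
      (fun x hx => hm₁ (hmap (hι₁ hx))) p₁ hpr₁, fun x hx x' hx' h => ?_,
    isImmersionOn_of_section Metric.isOpen_ball (hf₂.comp (hΦsm.comp
      (contDiff_const.prodMk contDiff_id).contDiffOn hι₂) fun x hx => hmap (hι₂ hx))
      (fun x hx => hm₂ (hmap (hι₂ hx))) p₂ hpr₂, fun x hx x' hx' h => ?_,
    hB, hy₀Φ, hΦΩ, hΦsm, hΦsm', fun z hz => ?_⟩
  · rw [← hpr₁ x hx, ← hpr₁ x' hx']; exact congrArg p₁ h
  · rw [← hpr₂ x hx, ← hpr₂ x' hx']; exact congrArg p₂ h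
  · have hzB : z ∈ Φ.source := hB ▸ hz
    exact Prod.ext (hconst hf₁ z hzB _ (hι₁ hz.1) fun w hw => kill₁ w hw _ (by simp))
      (hconst hf₂ z hzB _ (hι₂ hz.2) fun w hw => kill₂ w hw _ (by simp))

variable {f N : E → FlatSpace c₁ k × FlatSpace c₂ l}

/-- The tangent spaces split where `ξ` vanishes. -/
theorem IsHypersurfaceOn.exists_split_fderiv (h : IsHypersurfaceOn c₁ c₂ Ω f N) {y : E}
    (hy : y ∈ Ω) (h0 : ∀ X, flatForm c₂ (N y).2 (fderiv ℝ f y X).2 = 0) (X : E) :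
    ∃ X₀ X₁, X = X₀ + X₁ ∧ fderiv ℝ (fun z => (f z).2) y X₀ = 0 ∧
      fderiv ℝ (fun z => (f z).1) y X₁ = 0 := by
  obtain ⟨X₀, X₁, hX, e0, e1⟩ := (h.hyperplane y hy).exists_split (h0 X)
  exact ⟨X₀, X₁, hX, (h.fderiv_snd hy _).trans e0, (h.fderiv_fst hy _).trans e1⟩

/-- Here N₂ = 0, so df₁ takes values in the complement of N₁, of dimension less than k, and df₂ in
the full tangent space of the second factor. -/
theorem IsHypersurfaceOn.exists_split_of_angle_eq_zero (h : IsHypersurfaceOn c₁ c₂ Ω f N)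
    (ht : ∀ y ∈ Ω, flatForm c₂ (N y).2 (N y).2 = 0) (hk : k = d₁ + 1) {y₀ : E} (hy₀ : y₀ ∈ Ω) :
    ∃ (O₁ : Set (EuclideanSpace ℝ (Fin d₁))) (O₂ : Set (EuclideanSpace ℝ (Fin l)))
      (F₁ : EuclideanSpace ℝ (Fin d₁) → FlatSpace c₁ k)
      (F₂ : EuclideanSpace ℝ (Fin l) → FlatSpace c₂ l)
      (Φ : OpenPartialHomeomorph (EuclideanSpace ℝ (Fin d₁) × EuclideanSpace ℝ (Fin l)) E),
      IsOpen O₁ ∧ IsOpen O₂ ∧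
      IsImmersionOn (𝓡 d₁) (spaceForm c₁ k) O₁ F₁ ∧ InjOn F₁ O₁ ∧
      IsImmersionOn (𝓡 l) (spaceForm c₂ l) O₂ F₂ ∧ InjOn F₂ O₂ ∧
      Φ.source = O₁ ×ˢ O₂ ∧ y₀ ∈ Φ.target ∧ Φ.target ⊆ Ω ∧
      ContDiffOn ℝ ∞ Φ Φ.source ∧ ContDiffOn ℝ ∞ Φ.symm Φ.target ∧
      ∀ z ∈ O₁ ×ˢ O₂, f (Φ z) = (F₁ z.1, F₂ z.2) := by
  have H := h.hyperplane y₀ hy₀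
  have hN : ∀ y ∈ Ω, (N y).2 = 0 := fun y hy =>
    eq_zero_of_flatForm_self (h.hyperplane y hy).mem.2 (h.hyperplane y hy).normal_mem.2 (ht y hy)
  have hN₁ : (N y₀).1 ≠ 0 := fun h0 => by
    have := H.flatForm_fst_self
    rw [h0, flatForm_zero_left, ht y₀ hy₀] at this
    norm_num at this
  have hβ : ∀ y ∈ Ω, ∀ X, flatForm c₂ (N y).2 (fderiv ℝ f y X).2 = 0 := fun y hy X => by
    rw [hN y hy, flatForm_zero_left]
  obtain ⟨p₁, hp₁⟩ := exists_injOn_clm (normalComplement c₁ (f y₀).1 (N y₀).1) (d := d₁) (by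
    have := finrank_normalComplement_lt H.mem.1 H.normal_mem.1 hN₁
    omega)
  obtain ⟨p₂, hp₂⟩ := exists_injOn_clm (tangentSubmodule c₂ (f y₀).2) (d := l)
    (finrank_tangentSubmodule H.mem.2).le
  refine exists_split_coordinates (f₁ := fun z => (f z).1) (f₂ := fun z => (f z).2)
    h.isOpen (by have := H.finrank_add_one; omega)
    (contDiff_fst.comp_contDiffOn h.smooth) (contDiff_snd.comp_contDiffOn h.smooth)
    (fun y hy => (h.hyperplane y hy).mem.1) (fun y hy => (h.hyperplane y hy).mem.2)
    (fun y hy => h.exists_split_fderiv hy (hβ y hy)) p₁ p₂ hy₀ fun X h1 h2 => ?_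
  rw [h.fderiv_fst hy₀] at h1
  rw [h.fderiv_snd hy₀] at h2
  refine (injective_iff_map_eq_zero _).1 H.inj X (Prod.ext (hp₁ _ ?_ h1) (hp₂ _ ?_ h2))
  · refine mem_normalComplement.2 ⟨(H.tangent X).1, ?_⟩
    exact (H.flatForm_fst_add_snd X).trans (neg_eq_zero.2 (hβ y₀ hy₀ X))
  · exact mem_tangentSubmodule.2 (H.tangent X).2

/-- Here N₁ = 0, and the factors exchange roles. -/
theorem IsHypersurfaceOn.exists_split_of_angle_eq_one (h : IsHypersurfaceOn c₁ c₂ Ω f N)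
    (ht : ∀ y ∈ Ω, flatForm c₂ (N y).2 (N y).2 = 1) (hl : l = d₂ + 1) {y₀ : E} (hy₀ : y₀ ∈ Ω) :
    ∃ (O₁ : Set (EuclideanSpace ℝ (Fin k))) (O₂ : Set (EuclideanSpace ℝ (Fin d₂)))
      (F₁ : EuclideanSpace ℝ (Fin k) → FlatSpace c₁ k)
      (F₂ : EuclideanSpace ℝ (Fin d₂) → FlatSpace c₂ l)
      (Φ : OpenPartialHomeomorph (EuclideanSpace ℝ (Fin k) × EuclideanSpace ℝ (Fin d₂)) E),
      IsOpen O₁ ∧ IsOpen O₂ ∧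
      IsImmersionOn (𝓡 k) (spaceForm c₁ k) O₁ F₁ ∧ InjOn F₁ O₁ ∧
      IsImmersionOn (𝓡 d₂) (spaceForm c₂ l) O₂ F₂ ∧ InjOn F₂ O₂ ∧
      Φ.source = O₁ ×ˢ O₂ ∧ y₀ ∈ Φ.target ∧ Φ.target ⊆ Ω ∧
      ContDiffOn ℝ ∞ Φ Φ.source ∧ ContDiffOn ℝ ∞ Φ.symm Φ.target ∧
      ∀ z ∈ O₁ ×ˢ O₂, f (Φ z) = (F₁ z.1, F₂ z.2) := by
  have H := h.hyperplane y₀ hy₀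
  have hN : ∀ y ∈ Ω, (N y).1 = 0 := fun y hy =>
    eq_zero_of_flatForm_self (h.hyperplane y hy).mem.1 (h.hyperplane y hy).normal_mem.1
      (by rw [(h.hyperplane y hy).flatForm_fst_self, ht y hy, sub_self])
  have hN₂ : (N y₀).2 ≠ 0 := fun h0 => by
    have := ht y₀ hy₀
    rw [h0, flatForm_zero_left] at this
    norm_num at this
  have hβ : ∀ y ∈ Ω, ∀ X, flatForm c₂ (N y).2 (fderiv ℝ f y X).2 = 0 := fun y hy X => by
    have := (h.hyperplane y hy).flatForm_fst_add_snd X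
    rw [hN y hy, flatForm_zero_left] at this
    exact neg_eq_zero.1 this.symm
  obtain ⟨p₁, hp₁⟩ := exists_injOn_clm (tangentSubmodule c₁ (f y₀).1) (d := k)
    (finrank_tangentSubmodule H.mem.1).le
  obtain ⟨p₂, hp₂⟩ := exists_injOn_clm (normalComplement c₂ (f y₀).2 (N y₀).2) (d := d₂) (by
    have := finrank_normalComplement_lt H.mem.2 H.normal_mem.2 hN₂
    omega)
  refine exists_split_coordinates (f₁ := fun z => (f z).1) (f₂ := fun z => (f z).2)
    h.isOpen (by have := H.finrank_add_one; omega)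
    (contDiff_fst.comp_contDiffOn h.smooth) (contDiff_snd.comp_contDiffOn h.smooth)
    (fun y hy => (h.hyperplane y hy).mem.1) (fun y hy => (h.hyperplane y hy).mem.2)
    (fun y hy => h.exists_split_fderiv hy (hβ y hy)) p₁ p₂ hy₀ fun X h1 h2 => ?_
  rw [h.fderiv_fst hy₀] at h1
  rw [h.fderiv_snd hy₀] at h2
  refine (injective_iff_map_eq_zero _).1 H.inj X (Prod.ext (hp₁ _ ?_ h1) (hp₂ _ ?_ h2))
  · exact mem_tangentSubmodule.2 (H.tangent X).1
  · exact mem_normalComplement.2 ⟨(H.tangent X).2, hβ y₀ hy₀ X⟩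

end Split

/-! ### Partial diffeomorphisms to a manifold -/

section PartialDiffeo

variable {E : Type*} [NormedAddCommGroup E] [NormedSpace ℝ E] {H : Type*} [TopologicalSpace H]
  {I : ModelWithCorners ℝ E H} {M : Type*} [TopologicalSpace M] [ChartedSpace H M]
  [IsManifold I ∞ M]
  {F : Type*} [NormedAddCommGroup F] [NormedSpace ℝ F] {H' : Type*} [TopologicalSpace H']
  {J : ModelWithCorners ℝ F H'} {P : Type*} [TopologicalSpace P] [ChartedSpace H' P]

/-- Composition of a local diffeomorphism to the model space with the inverse of a chart. -/
theorem exists_partialDiffeomorph (x : M) (Φ : OpenPartialHomeomorph P E)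
    (hsub : Φ.target ⊆ (extChartAt I x).target) (hΦ : ContMDiffOn J 𝓘(ℝ, E) ∞ Φ Φ.source)
    (hΦ' : ContMDiffOn 𝓘(ℝ, E) J ∞ Φ.symm Φ.target) :
    ∃ Θ : PartialDiffeomorph J I P M ∞, Θ.source = Φ.source ∧
      Θ.target = (extChartAt I x).source ∩ extChartAt I x ⁻¹' Φ.target ∧
      ∀ z, Θ z = (extChartAt I x).symm (Φ z) := by
  have ht : IsOpen ((extChartAt I x).source ∩ extChartAt I x ⁻¹' Φ.target) :=
    (continuousOn_extChartAt x).isOpen_inter_preimage (isOpen_extChartAt_source x) Φ.open_target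
  refine ⟨⟨⟨fun z => (extChartAt I x).symm (Φ z), fun p => Φ.symm (extChartAt I x p), Φ.source,
    (extChartAt I x).source ∩ extChartAt I x ⁻¹' Φ.target, fun z hz => ?_, fun p hp => ?_,
    fun z hz => ?_, fun p hp => ?_⟩, Φ.open_source, ht, ?_, ?_⟩, rfl, rfl, fun z => rfl⟩
  · have h1 := Φ.map_source hz
    refine ⟨(extChartAt I x).map_target (hsub h1), ?_⟩
    rw [mem_preimage, (extChartAt I x).right_inv (hsub h1)]
    exact h1
  · exact Φ.map_target hp.2
  · rw [(extChartAt I x).right_inv (hsub (Φ.map_source hz)), Φ.left_inv hz]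
  · rw [Φ.right_inv hp.2, (extChartAt I x).left_inv hp.1]
  · exact (contMDiffOn_extChartAt_symm x).comp hΦ fun z hz => hsub (Φ.map_source hz)
  · refine hΦ'.comp ((contMDiffOn_extChartAt (I := I) (x := x)).mono fun p hp => ?_)
      fun p hp => hp.2
    rw [← extChartAt_source (I := I)]
    exact hp.1

end PartialDiffeo

/-! ### Products of vector spaces as manifolds -/

section ProductModel

variable {F₁ F₂ F₃ G : Type*} [NormedAddCommGroup F₁] [NormedSpace ℝ F₁] [NormedAddCommGroup F₂]
  [NormedSpace ℝ F₂] [NormedAddCommGroup F₃] [NormedSpace ℝ F₃] [NormedAddCommGroup G]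
  [NormedSpace ℝ G]

/-- The product manifold structure agrees with the vector space structure of F₁ × F₂ only after
rewriting, which is done once for each shape of product. -/
theorem contMDiffOn_prod_left {u : F₁ × F₂ → G} {s : Set (F₁ × F₂)} (hu : ContDiffOn ℝ ∞ u s) :
    ContMDiffOn (𝓘(ℝ, F₁).prod 𝓘(ℝ, F₂)) 𝓘(ℝ, G) ∞ u s := by
  rw [← modelWithCornersSelf_prod, chartedSpaceSelf_prod]
  exact hu.contMDiffOn

theorem contMDiffOn_prod_right {u : G → F₁ × F₂} {s : Set G} (hu : ContDiffOn ℝ ∞ u s) :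
    ContMDiffOn 𝓘(ℝ, G) (𝓘(ℝ, F₁).prod 𝓘(ℝ, F₂)) ∞ u s := by
  rw [← modelWithCornersSelf_prod, chartedSpaceSelf_prod]
  exact hu.contMDiffOn

theorem contMDiffOn_prod_prod_left {u : F₁ × (F₂ × F₃) → G} {s : Set (F₁ × (F₂ × F₃))}
    (hu : ContDiffOn ℝ ∞ u s) :
    ContMDiffOn (𝓘(ℝ, F₁).prod (𝓘(ℝ, F₂).prod 𝓘(ℝ, F₃))) 𝓘(ℝ, G) ∞ u s := by
  rw [← modelWithCornersSelf_prod (E := F₂), chartedSpaceSelf_prod (H := F₂)]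
  exact contMDiffOn_prod_left hu

theorem contMDiffOn_prod_prod_right {u : G → F₁ × (F₂ × F₃)} {s : Set G}
    (hu : ContDiffOn ℝ ∞ u s) :
    ContMDiffOn 𝓘(ℝ, G) (𝓘(ℝ, F₁).prod (𝓘(ℝ, F₂).prod 𝓘(ℝ, F₃))) ∞ u s := by
  rw [← modelWithCornersSelf_prod (E := F₂), chartedSpaceSelf_prod (H := F₂)]
  exact contMDiffOn_prod_right hu

end ProductModel

/-! ### Restriction to open subsets -/

section Restrict

variable {E : Type*} [NormedAddCommGroup E] [NormedSpace ℝ E] {H : Type*} [TopologicalSpace H]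
  {I : ModelWithCorners ℝ E H} {M : Type*} [TopologicalSpace M] [ChartedSpace H M]
  {V : Type*} [NormedAddCommGroup V] [NormedSpace ℝ V]

theorem IsImmersionOn.mono {Q : Set V} {U U' : Set M} {f : M → V} (h : IsImmersionOn I Q U f)
    (hU : U' ⊆ U) : IsImmersionOn I Q U' f :=
  ⟨h.smooth.mono hU, h.mapsTo.mono_left hU, fun x hx => h.immersion x (hU hx)⟩

theorem IsUnitNormalOn.mono {B : V → V → ℝ} {T : V → Set V} {U U' : Set M} {f N : M → V}
    (h : IsUnitNormalOn I B T U f N) (hU : U' ⊆ U) : IsUnitNormalOn I B T U' f N :=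
  ⟨h.smooth.mono hU, fun x hx => h.tangent x (hU hx), fun x hx => h.unit x (hU hx),
    fun x hx => h.normal x (hU hx)⟩

theorem InClassAOn.mono {c₁ c₂ : ℝ} {k l : ℕ} {U U' : Set M}
    {f : M → FlatSpace c₁ k × FlatSpace c₂ l} (h : InClassAOn I c₁ c₂ U f) (hU : U' ⊆ U)
    (hU' : IsOpen U') : InClassAOn I c₁ c₂ U' f := fun x hx => by
  obtain ⟨W, N, A, R, hW, hxW, -, hN, hA, hR, hcomm⟩ := h x (hU hx)
  exact ⟨W ∩ U', N, A, R, hW.inter hU', ⟨hxW, hx⟩, inter_subset_right, hN.mono inter_subset_left,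
    hA, hR, hcomm⟩

end Restrict

/-! ### The dichotomy -/

section Dichotomy

variable {c₁ c₂ : ℝ} {n k l d₁ d₂ : ℕ} {M : Type*} [TopologicalSpace M]
  [ChartedSpace (EuclideanSpace ℝ (Fin n)) M] [IsManifold (𝓡 n) ∞ M]
  {f N : M → FlatSpace c₁ k × FlatSpace c₂ l} {W : Set M}

/-- Near a point where the normal vector is not tangent to a factor, a hypersurface in class `𝒜`
is a cylinder over parallel families. -/
theorem InClassAOn.exists_cylinder (hdim : n + 1 = k + l) (hk : k = d₁ + 1) (hl : l = d₂ + 1)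
    (hW : IsOpen W)
    (hf : IsImmersionOn (𝓡 n) (spaceForm c₁ k ×ˢ spaceForm c₂ l) W f)
    (hN : IsUnitNormalOn (𝓡 n) (prodForm c₁ c₂)
      (fun y => spaceFormTangent c₁ y.1 ×ˢ spaceFormTangent c₂ y.2) W f N)
    (hA : InClassAOn (𝓡 n) c₁ c₂ W f) {x : M} (hx : x ∈ W)
    (ht : flatForm c₂ (N x).2 (N x).2 ∈ Ioo (0 : ℝ) 1) :
    ∃ (O₁ : Set (EuclideanSpace ℝ (Fin d₁))) (O₂ : Set (EuclideanSpace ℝ (Fin d₂)))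
      (h Nh : EuclideanSpace ℝ (Fin d₁) → FlatSpace c₁ k)
      (g Ng : EuclideanSpace ℝ (Fin d₂) → FlatSpace c₂ l)
      (δ : ℝ) (a b : ℝ → ℝ)
      (Φ : PartialDiffeomorph (𝓘(ℝ, ℝ).prod ((𝓡 d₁).prod (𝓡 d₂))) (𝓡 n)
        (ℝ × (EuclideanSpace ℝ (Fin d₁) × EuclideanSpace ℝ (Fin d₂))) M ∞),
      IsOpen O₁ ∧ IsOpen O₂ ∧
      IsHypersurfaceWithNormalOn (𝓡 d₁) c₁ O₁ h Nh ∧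
      IsHypersurfaceWithNormalOn (𝓡 d₂) c₂ O₂ g Ng ∧
      IsAdmissiblePair δ a b ∧
      Φ.source = Set.Ioo (-δ) δ ×ˢ (O₁ ×ˢ O₂) ∧ x ∈ Φ.target ∧
      ∀ z ∈ Set.Ioo (-δ) δ ×ˢ (O₁ ×ˢ O₂), f (Φ z) = cylinderMap c₁ c₂ h Nh g Ng a b z := by
  have hdim' : Module.finrank ℝ (EuclideanSpace ℝ (Fin n)) + 1 = k + l := by simpa using hdim
  obtain ⟨O₁, O₂, h, Nh, g, Ng, δ, a, b, Φ, hO₁, hO₂, hh, hg, hab, hs, hxt, hsub, hΦ, hΦ', hfΦ⟩ :=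
    (isHypersurfaceOn_chartDomain hdim' hW hf hN x).exists_cylinder
      (fun y hy X Y => hA.flatForm_fderiv_symm hdim' hW hf hN x hy X Y) hk hl
      (mem_chartDomain hx) (by simpa using ht)
  obtain ⟨Θ, hΘs, hΘt, hΘ⟩ := exists_partialDiffeomorph (I := 𝓡 n) x Φ
    (hsub.trans inter_subset_left) (contMDiffOn_prod_prod_left hΦ) (contMDiffOn_prod_prod_right hΦ')
  refine ⟨O₁, O₂, h, Nh, g, Ng, δ, a, b, Θ, hO₁, hO₂, hh, hg, hab, hΘs.trans hs, ?_,
    fun z hz => ?_⟩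
  · rw [hΘt]; exact ⟨mem_extChartAt_source x, hxt⟩
  · rw [hΘ]; exact hfΦ z hz

/-- A hypersurface splits near every point of an open set on which its normal vectors are all
tangent to a factor. -/
theorem exists_splitsOn (hdim : n + 1 = k + l) (hk : 1 ≤ k) (hl : 1 ≤ l) (hW : IsOpen W)
    (hf : IsImmersionOn (𝓡 n) (spaceForm c₁ k ×ˢ spaceForm c₂ l) W f)
    (hN : IsUnitNormalOn (𝓡 n) (prodForm c₁ c₂)
      (fun y => spaceFormTangent c₁ y.1 ×ˢ spaceFormTangent c₂ y.2) W f N)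
    {x : M} (hx : x ∈ W) (ht : ∀ y ∈ W, flatForm c₂ (N y).2 (N y).2 ∉ Ioo (0 : ℝ) 1) :
    ∃ U : Set M, IsOpen U ∧ x ∈ U ∧ SplitsOn n c₁ c₂ U f := by
  have hdim' : Module.finrank ℝ (EuclideanSpace ℝ (Fin n)) + 1 = k + l := by simpa using hdim
  have H := isHypersurfaceOn_chartDomain hdim' hW hf hN x
  set Ω := chartDomain (𝓡 n) x W with hΩ
  have hxΩ : extChartAt (𝓡 n) x x ∈ Ω := mem_chartDomain hx
  set t := fun y => flatForm c₂ ((N ∘ (extChartAt (𝓡 n) x).symm) y).2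
    ((N ∘ (extChartAt (𝓡 n) x).symm) y).2 with htdef
  have hc : ContinuousOn t Ω := H.contDiffOn_angle.continuousOn
  have ht01 : ∀ y ∈ Ω, t y = 0 ∨ t y = 1 := fun y hy => by
    have h0 : 0 ≤ t y := (H.hyperplane y hy).angle_nonneg
    have h1 : t y ≤ 1 := (H.hyperplane y hy).angle_le_one
    have h2 : ¬ (0 < t y ∧ t y < 1) := ht _ hy.2
    rcases h0.eq_or_lt with h | h
    · exact Or.inl h.symm
    · exact Or.inr (h1.antisymm (not_lt.1 fun h' => h2 ⟨h, h'⟩))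
  -- A continuous function with values in {0, 1} has open levels, so t is constant near x.
  rcases ht01 _ hxΩ with h0 | h1
  · obtain ⟨O₁, O₂, F₁, F₂, Φ, hO₁, hO₂, hF₁, -, hF₂, hF₂', hs, hxt, hsub, hΦ, hΦ', hfΦ⟩ :=
      (H.mono (hc.isOpen_inter_preimage H.isOpen (isOpen_Iio (a := 1)))
        inter_subset_left).exists_split_of_angle_eq_zero
        (fun y hy => (ht01 y hy.1).resolve_right hy.2.ne) (d₁ := k - 1) (by omega)
        ⟨hxΩ, h0.trans_lt one_pos⟩
    obtain ⟨Θ, hΘs, hΘt, hΘ⟩ := exists_partialDiffeomorph (I := 𝓡 n) x Φ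
      (hsub.trans (inter_subset_left.trans inter_subset_left)) (contMDiffOn_prod_left hΦ)
      (contMDiffOn_prod_right hΦ')
    refine ⟨Θ.target, Θ.open_target, ?_, Or.inl ⟨O₁, O₂, F₁, F₂, Θ, hO₁, hO₂, hF₁, hF₂, hF₂',
      hΘs.trans hs, rfl, fun z hz => ?_⟩⟩
    · rw [hΘt]; exact ⟨mem_extChartAt_source x, hxt⟩
    · rw [hΘ]; exact hfΦ z hz
  · obtain ⟨O₁, O₂, F₁, F₂, Φ, hO₁, hO₂, hF₁, hF₁', hF₂, -, hs, hxt, hsub, hΦ, hΦ', hfΦ⟩ :=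
      (H.mono (hc.isOpen_inter_preimage H.isOpen (isOpen_Ioi (a := 0)))
        inter_subset_left).exists_split_of_angle_eq_one
        (fun y hy => (ht01 y hy.1).resolve_left hy.2.ne') (d₂ := l - 1) (by omega)
        ⟨hxΩ, one_pos.trans_eq h1.symm⟩
    obtain ⟨Θ, hΘs, hΘt, hΘ⟩ := exists_partialDiffeomorph (I := 𝓡 n) x Φ
      (hsub.trans (inter_subset_left.trans inter_subset_left)) (contMDiffOn_prod_left hΦ)
      (contMDiffOn_prod_right hΦ')
    refine ⟨Θ.target, Θ.open_target, ?_, Or.inr ⟨O₁, O₂, F₁, F₂, Θ, hO₁, hO₂, hF₁, hF₁', hF₂,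
      hΘs.trans hs, rfl, fun z hz => ?_⟩⟩
    · rw [hΘt]; exact ⟨mem_extChartAt_source x, hxt⟩
    · rw [hΘ]; exact hfΦ z hz

end Dichotomy

/-! ### The theorem -/

theorem theorem3p1 (n k : ℕ) (hk : 2 ≤ k) (hkn : k + 1 ≤ n) (c₁ c₂ : ℝ) :
    (∀ (M₁ : Type u) [TopologicalSpace M₁] [ChartedSpace (EuclideanSpace ℝ (Fin (k - 1))) M₁]
        [IsManifold (𝓡 (k - 1)) ∞ M₁]
        (M₂ : Type v) [TopologicalSpace M₂] [ChartedSpace (EuclideanSpace ℝ (Fin (n - k))) M₂]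
        [IsManifold (𝓡 (n - k)) ∞ M₂]
        (h Nh : M₁ → FlatSpace c₁ k) (g Ng : M₂ → FlatSpace c₂ (n - k + 1))
        (δ : ℝ) (a b : ℝ → ℝ),
      IsHypersurfaceWithNormalOn (𝓡 (k - 1)) c₁ Set.univ h Nh →
      IsHypersurfaceWithNormalOn (𝓡 (n - k)) c₂ Set.univ g Ng →
      IsAdmissiblePair δ a b →
      IsOpen (regularPoints (d₁ := k - 1) (d₂ := n - k) δ (cylinderMap c₁ c₂ h Nh g Ng a b)) ∧
      IsImmersionOn (𝓘(ℝ, ℝ).prod ((𝓡 (k - 1)).prod (𝓡 (n - k))))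
        (spaceForm c₁ k ×ˢ spaceForm c₂ (n - k + 1))
        (regularPoints (d₁ := k - 1) (d₂ := n - k) δ (cylinderMap c₁ c₂ h Nh g Ng a b))
        (cylinderMap c₁ c₂ h Nh g Ng a b) ∧
      InClassAOn (𝓘(ℝ, ℝ).prod ((𝓡 (k - 1)).prod (𝓡 (n - k)))) c₁ c₂
        (regularPoints (d₁ := k - 1) (d₂ := n - k) δ (cylinderMap c₁ c₂ h Nh g Ng a b))
        (cylinderMap c₁ c₂ h Nh g Ng a b)) ∧
    (∀ (M : Type w) [TopologicalSpace M] [ChartedSpace (EuclideanSpace ℝ (Fin n)) M]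
        [IsManifold (𝓡 n) ∞ M] (f : M → FlatSpace c₁ k × FlatSpace c₂ (n - k + 1)),
      IsImmersionOn (𝓡 n) (spaceForm c₁ k ×ˢ spaceForm c₂ (n - k + 1)) Set.univ f →
      InClassAOn (𝓡 n) c₁ c₂ Set.univ f →
      (∀ U : Set M, IsOpen U → U.Nonempty → ¬ SplitsOn n c₁ c₂ U f) →
      ∃ W : Set M, IsOpen W ∧ Dense W ∧ ∀ x ∈ W,
        ∃ (O₁ : Set (EuclideanSpace ℝ (Fin (k - 1)))) (O₂ : Set (EuclideanSpace ℝ (Fin (n - k))))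
          (h Nh : EuclideanSpace ℝ (Fin (k - 1)) → FlatSpace c₁ k)
          (g Ng : EuclideanSpace ℝ (Fin (n - k)) → FlatSpace c₂ (n - k + 1))
          (δ : ℝ) (a b : ℝ → ℝ)
          (Φ : PartialDiffeomorph (𝓘(ℝ, ℝ).prod ((𝓡 (k - 1)).prod (𝓡 (n - k)))) (𝓡 n)
            (ℝ × (EuclideanSpace ℝ (Fin (k - 1)) × EuclideanSpace ℝ (Fin (n - k)))) M ∞),
          IsOpen O₁ ∧ IsOpen O₂ ∧
          IsHypersurfaceWithNormalOn (𝓡 (k - 1)) c₁ O₁ h Nh ∧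
          IsHypersurfaceWithNormalOn (𝓡 (n - k)) c₂ O₂ g Ng ∧
          IsAdmissiblePair δ a b ∧
          Φ.source = Set.Ioo (-δ) δ ×ˢ (O₁ ×ˢ O₂) ∧ x ∈ Φ.target ∧
          ∀ z ∈ Set.Ioo (-δ) δ ×ˢ (O₁ ×ˢ O₂), f (Φ z) = cylinderMap c₁ c₂ h Nh g Ng a b z) := by
  refine ⟨fun M₁ _ _ _ M₂ _ _ _ h Nh g Ng δ a b hh hg hab =>
    cylinderMap_inClassAOn (by omega) hh hg hab, fun M _ _ _ f hf hA hns => ?_⟩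
  have hdim : n + 1 = k + (n - k + 1) := by omega
  -- W is the union of the images of all cylinder parametrisations: it is open by definition, and
  -- density is the only claim with content.
  let W : Set M := ⋃₀ {V | ∃ (O₁ : Set (EuclideanSpace ℝ (Fin (k - 1))))
      (O₂ : Set (EuclideanSpace ℝ (Fin (n - k))))
      (h Nh : EuclideanSpace ℝ (Fin (k - 1)) → FlatSpace c₁ k)
      (g Ng : EuclideanSpace ℝ (Fin (n - k)) → FlatSpace c₂ (n - k + 1))
      (δ : ℝ) (a b : ℝ → ℝ)
      (Φ : PartialDiffeomorph (𝓘(ℝ, ℝ).prod ((𝓡 (k - 1)).prod (𝓡 (n - k)))) (𝓡 n)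
        (ℝ × (EuclideanSpace ℝ (Fin (k - 1)) × EuclideanSpace ℝ (Fin (n - k)))) M ∞),
      IsOpen O₁ ∧ IsOpen O₂ ∧
      IsHypersurfaceWithNormalOn (𝓡 (k - 1)) c₁ O₁ h Nh ∧
      IsHypersurfaceWithNormalOn (𝓡 (n - k)) c₂ O₂ g Ng ∧
      IsAdmissiblePair δ a b ∧
      Φ.source = Set.Ioo (-δ) δ ×ˢ (O₁ ×ˢ O₂) ∧ Φ.target = V ∧
      ∀ z ∈ Set.Ioo (-δ) δ ×ˢ (O₁ ×ˢ O₂), f (Φ z) = cylinderMap c₁ c₂ h Nh g Ng a b z}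
  refine ⟨W, isOpen_sUnion ?_, dense_iff_inter_open.2 fun U hU hne => ?_, ?_⟩
  · rintro V ⟨-, -, -, -, -, -, -, -, -, Φ, -, -, -, -, -, -, rfl, -⟩
    exact Φ.open_target
  · obtain ⟨x, hxU⟩ := hne
    obtain ⟨W', N, -, -, hW', hxW', -, hN, -⟩ := hA x (mem_univ x)
    have hV : IsOpen (U ∩ W') := hU.inter hW'
    have hfV := hf.mono (subset_univ (U ∩ W'))
    have hNV := hN.mono (inter_subset_right (s := U))
    -- Either some point has 0 < t < 1 and lies in a cylinder, or N is tangent to a factor at every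
    -- point of U ∩ W' and f splits near x, which is excluded.
    by_cases ht : ∃ y ∈ U ∩ W', flatForm c₂ (N y).2 (N y).2 ∈ Ioo (0 : ℝ) 1
    · obtain ⟨y, hy, hty⟩ := ht
      obtain ⟨O₁, O₂, h, Nh, g, Ng, δ, a, b, Φ, hO₁, hO₂, hh, hg, hab, hs, hyt, hfΦ⟩ :=
        (hA.mono (subset_univ _) hV).exists_cylinder hdim (d₁ := k - 1) (d₂ := n - k) (by omega)
          rfl hV hfV hNV hy hty
      exact ⟨y, hy.1, mem_sUnion.2 ⟨Φ.target, ⟨O₁, O₂, h, Nh, g, Ng, δ, a, b, Φ, hO₁, hO₂, hh, hg,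
        hab, hs, rfl, hfΦ⟩, hyt⟩⟩
    · push Not at ht
      obtain ⟨V, hVo, hxV, hsplit⟩ := exists_splitsOn hdim (by omega) (by omega) hV hfV hNV
        ⟨hxU, hxW'⟩ ht
      exact absurd hsplit (hns V hVo ⟨x, hxV⟩)
  · rintro x ⟨V, ⟨O₁, O₂, h, Nh, g, Ng, δ, a, b, Φ, hO₁, hO₂, hh, hg, hab, hs, rfl, hfΦ⟩, hx⟩
    exact ⟨O₁, O₂, h, Nh, g, Ng, δ, a, b, Φ, hO₁, hO₂, hh, hg, hab, hs, hx, hfΦ⟩
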